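/- **Theorem (Factoring, general noise).** Let $F$ be an isotropic probability distribution on $\mathbb R^n$ (mean $0$, covariance $I_n$) with finite moments up to order $m\ge 1$, and let $\gamma_j$ be the $j$-th moment of a standard Gaussian variable. For a subspace $V$ let $F_VF_{V^\perp}$ be the product of the marginals of $F$ on $V$ and $V^\perp$, and put $d_j(F,G)=\max_{\|u\|=1}|\mathbb E_F(x^Tu)^j-\mathbb E_G(x^Tu)^j|$. Suppose that there is a subspace $V$ with $\dim V=k$ and $d_j(F,F_VF_{V^\perp})=0$ for $j=1,\dots,m$. Suppose that the entries $\mathbb E_F[x_{i_1}\cdots x_{i_j}]$, $j\le m$, are available exactly, and so are exact local optima: an oracle which, given a tensor $G$, a finite set $C\subset\mathbb R^n$ and a unit vector $v\in C^\perp$, returns a local maximum (or, on request, a local minimum) $u^*$ of $u\mapsto G(u,\dots,u)$ on the unit sphere of $C^\perp$ with $G(u^*,\dots,u^*)\ge G(v,\dots,v)$ (respectively $\le$). Let $\delta>0$. Then, for every such oracle, Algorithm Factor (below) finds, with probability at least $1-\delta$, a $k$-dimensional subspace $U$ with $d_j(F,F_UF_{U^\perp})=0$ for $j=1,\dots,m$.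 It always makes at most $\max(2,n)^{C(k+m)}\log(2+1/\delta)$ steps, where $C$ is a universal constant; a step is an arithmetic operation, square root or comparison on real numbers, loading an integer constant, the drawing of a random integer from $\{1,\dots,N\}$, the reading of a moment entry, an oracle call, or a loop iteration. *Identity test.* Whether a form $G$ of degree $d$ is constantly $c$ on the unit sphere of $C^\perp$ (with $c=0$ if $d$ is odd) is tested with $\lceil\log_2(n/\delta)\rceil$ random vectors with independent uniform coordinates in $\{1,\dots,2m\}$: each is projected to a $v\in C^\perp$, and $G(v,\dots,v)$ is compared with $c\|v\|^d$. If they differ for some $v$, the first such $v/\|v\|$ is passed to the oracle, which returns a local maximum $u^*$ if $G(v,\dots,v)>c\|v\|^d$ and a local minimum $u^*$ otherwise. *FindBasis.* Start with $B=\emptyset$, $j=2$. While $|B|<n$ and $j\le m$: test whether $\mathbb E(x^Tu)^j\equiv\gamma_j$ on the unit sphere of $B^\perp$; if the test finds no difference, increase $j$ by $1$, otherwise add $u^*$ to $B$. *ExtendBasis*$(S,T,p)$. Start with $j=2$. While $|S|<p$ and $j\le m$: for each choice with repetition $v_1,\dots,v_l\in S$, $1\le l<j$, test whether $\mathbb E[(x^Tu)^{j-l}\prod_t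 x^Tv_t]-\mathbb E[(x^Tu)^{j-l}]\,\mathbb E[\prod_t x^Tv_t]\equiv 0$ on the unit sphere of $(S\cup T)^\perp$. At the first choice where a difference is found, add $u^*$ to $S$ and continue with $j=3$; if there is none, increase $j$ by $1$. *Factor.* Run FindBasis to get $B$. For every $T\subseteq B$ with $|T|\le k$ let $S'$ be the output of ExtendBasis$(T,B\setminus T,k)$ and $T'$ that of ExtendBasis$(B\setminus T,S',n-k)$. Skip $T$ if $|S'|>k$ or $|T'|>n-k$. Otherwise complete $S'\cup T'$ to an orthonormal basis of $\mathbb R^n$, add $k-|S'|$ of the new vectors to $S'$ to get a basis of a subspace $U$, and, for $3\le l\le m$, compute $\Delta_U^l$, the sum over all $l$-tuples of basis vectors of $U$ and $U^\perp$ of the squared difference between the joint moment of $F$ in these directions and the product of the joint moment of those in $U$ and that of those in $U^\perp$. Return the $U$ for which $(\Delta_U^3,\dots,\Delta_U^m)$ is lexicographically least. -/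

import Mathlib

open MeasureTheory

namespace GenICA

/-! ### Moments, moment distance, factorization -/

/-- The entry `E[x_{i₁} ⋯ x_{i_d}]` of the `d`-th moment tensor of `F`, with `is = [i₁, …, i_d]`. -/
noncomputable def momentEntry {n : ℕ} (F : Measure (EuclideanSpace ℝ (Fin n)))
    (is : List (Fin n)) : ℝ :=
  ∫ x, (is.map fun i => x i).prod ∂F

/-- Mean zero and identity covariance matrix. -/
def IsIsotropic {n : ℕ} (F : Measure (EuclideanSpace ℝ (Fin n))) : Prop :=
  (∀ i, ∫ x, x i ∂F = 0) ∧ ∀ i j, ∫ x, x i * x j ∂F = if i = j then 1 else 0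

/-- The `j`-th moment distance `max_{‖u‖ = 1} |E_F (xᵀu)^j - E_G (xᵀu)^j|`. -/
noncomputable def momentDist {n : ℕ} (j : ℕ) (F G : Measure (EuclideanSpace ℝ (Fin n))) : ENNReal :=
  ⨆ u ∈ Metric.sphere (0 : EuclideanSpace ℝ (Fin n)) 1,
    ‖(∫ x, (inner ℝ x u) ^ j ∂F) - ∫ x, (inner ℝ x u) ^ j ∂G‖ₑ

/-- The marginal `F_V` of `F` on the subspace `V`, as a measure on the whole space. -/
noncomputable def marginal {n : ℕ} (F : Measure (EuclideanSpace ℝ (Fin n)))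
    (V : Submodule ℝ (EuclideanSpace ℝ (Fin n))) : Measure (EuclideanSpace ℝ (Fin n)) :=
  F.map fun x => V.starProjection x

/-- The product distribution `F_V F_W`, `W = Vᗮ`: the component in `V` is drawn from `F_V` and,
independently, the component in `W` from `F_W`. -/
noncomputable def factored {n : ℕ} (F : Measure (EuclideanSpace ℝ (Fin n)))
    (V : Submodule ℝ (EuclideanSpace ℝ (Fin n))) : Measure (EuclideanSpace ℝ (Fin n)) :=
  ((marginal F V).prod (marginal F Vᗮ)).map fun p => p.1 + p.2

/-- The `j`-th moment `γ_j` of a standard Gaussian random variable. -/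
def gaussianMoment (j : ℕ) : ℕ := if Even j then Nat.doubleFactorial (j - 1) else 0

/-! ### Programs with a step count

Programs are written over an abstract type `R` of number registers, so they can compute with
numbers only through the instructions below. -/

abbrev Vec (R : Type) (n : ℕ) : Type := Fin n → R

/-- Order `d` tensors, as arrays of `n ^ d` coefficients. -/
abbrev Tensor (R : Type) (n d : ℕ) : Type := (Fin d → Fin n) → R

inductive ArithOp
  | add | sub | mul | div

inductive Prog (R : Type) (n : ℕ) (α : Type) : Type
  /-- stop with a result (free) -/
  | ret (a : α) : Prog R n α
  /-- one step of bookkeeping, charged once per loop iteration -/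
  | tick (next : Prog R n α) : Prog R n α
  /-- load an integer constant -/
  | const (c : ℕ) (next : R → Prog R n α) : Prog R n α
  | arith (o : ArithOp) (x y : R) (next : R → Prog R n α) : Prog R n α
  | sqrt (x : R) (next : R → Prog R n α) : Prog R n α
  /-- test `x < y` -/
  | less (x y : R) (next : Bool → Prog R n α) : Prog R n α
  /-- a uniformly random element of `{1, …, N}` -/
  | draw (N : ℕ) (next : R → Prog R n α) : Prog R n α
  /-- read one entry of a moment tensor -/
  | moment (is : List (Fin n)) (next : R → Prog R n α) : Prog R n α
  /-- ask for a local maximum (`b = true`) or local minimum (`b = false`) of the form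
  `u ↦ G(u, …, u)` on the unit sphere of the orthogonal complement of the vectors in `C`,
  starting from the unit vector `v` -/
  | localOpt (b : Bool) (d : ℕ) (G : Tensor R n d) (C : List (Vec R n)) (v : Vec R n)
      (next : Vec R n → Prog R n α) : Prog R n α

namespace Prog

variable {R : Type} {n : ℕ}

def bind {α β : Type} : Prog R n α → (α → Prog R n β) → Prog R n β
  | ret a, f => f a
  | tick k, f => tick (k.bind f)
  | const c k, f => const c fun x => (k x).bind f
  | arith o x y k, f => arith o x y fun z => (k z).bind f
  | sqrt x k, f => sqrt x fun z => (k z).bind f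
  | less x y k, f => less x y fun b => (k b).bind f
  | draw N k, f => draw N fun z => (k z).bind f
  | moment is k, f => moment is fun z => (k z).bind f
  | localOpt b d G C v k, f => localOpt b d G C v fun u => (k u).bind f

instance : Monad (Prog R n) where
  pure := ret
  bind := bind

end Prog

/-! ### The local optimum oracle -/

/-- The form `u ↦ G(u, …, u)`. -/
def Tensor.form {n d : ℕ} (G : Tensor ℝ n d) (u : Vec ℝ n) : ℝ :=
  ∑ a : Fin d → Fin n, G a * ∏ t, u (a t)

/-- The unit sphere of the orthogonal complement of the vectors in `C`. -/
def sphereOrth {n : ℕ} (C : List (Vec ℝ n)) : Set (Vec ℝ n) :=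
  {u | u ⬝ᵥ u = 1 ∧ ∀ b ∈ C, b ⬝ᵥ u = 0}

abbrev LocalOptOracle (n : ℕ) : Type :=
  Bool → (d : ℕ) → Tensor ℝ n d → List (Vec ℝ n) → Vec ℝ n → Vec ℝ n

/-- The oracle returns exact local optima, which are at least as good as the starting point. -/
def LocalOptOracle.IsExact {n : ℕ} (O : LocalOptOracle n) : Prop :=
  ∀ (d : ℕ) (G : Tensor ℝ n d) (C : List (Vec ℝ n)), ∀ v ∈ sphereOrth C,
    (O true d G C v ∈ sphereOrth C ∧
      IsLocalMaxOn (Tensor.form G) (sphereOrth C) (O true d G C v) ∧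
      Tensor.form G v ≤ Tensor.form G (O true d G C v)) ∧
    (O false d G C v ∈ sphereOrth C ∧
      IsLocalMinOn (Tensor.form G) (sphereOrth C) (O false d G C v) ∧
      Tensor.form G (O false d G C v) ≤ Tensor.form G v)

/-! ### Execution over the real numbers -/

noncomputable def ArithOp.eval : ArithOp → ℝ → ℝ → ℝ
  | add, x, y => x + y
  | sub, x, y => x - y
  | mul, x, y => x * y
  | div, x, y => x / y

open Classical in
/-- The joint distribution of the result of a program and the number of steps it makes, for given
moment entries `M` and local optimum oracle `O`. Each instruction costs one step. -/
noncomputable def Prog.run {n : ℕ} {α : Type} (M : List (Fin n) → ℝ) (O : LocalOptOracle n) :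
    Prog ℝ n α → PMF (α × ℕ)
  | ret a => PMF.pure (a, 0)
  | tick k => (k.run M O).map fun p => (p.1, p.2 + 1)
  | const c k => ((k (c : ℝ)).run M O).map fun p => (p.1, p.2 + 1)
  | arith o x y k => ((k (o.eval x y)).run M O).map fun p => (p.1, p.2 + 1)
  | sqrt x k => ((k (Real.sqrt x)).run M O).map fun p => (p.1, p.2 + 1)
  | less x y k => ((k (decide (x < y))).run M O).map fun p => (p.1, p.2 + 1)
  | draw N k =>
      (PMF.uniformOfFinset (Finset.Icc 1 (max 1 N)) ⟨1, by simp⟩).bind fun z =>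
        ((k (z : ℝ)).run M O).map fun p => (p.1, p.2 + 1)
  | moment is k => ((k (M is)).run M O).map fun p => (p.1, p.2 + 1)
  | localOpt b d G C v k => ((k (O b d G C v)).run M O).map fun p => (p.1, p.2 + 1)

/-! ### Basic subroutines -/

section Algorithms

variable {R : Type} {n : ℕ}

def step : Prog R n Unit := .tick (.ret ())
def const (c : ℕ) : Prog R n R := .const c .ret
def add (x y : R) : Prog R n R := .arith .add x y .ret
def sub (x y : R) : Prog R n R := .arith .sub x y .ret
def mul (x y : R) : Prog R n R := .arith .mul x y .ret
def div (x y : R) : Prog R n R := .arith .div x y .ret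
def sqrt (x : R) : Prog R n R := .sqrt x .ret
def less (x y : R) : Prog R n Bool := .less x y .ret
def draw (N : ℕ) : Prog R n R := .draw N .ret
def moment (is : List (Fin n)) : Prog R n R := .moment is .ret
def localOpt (b : Bool) {d : ℕ} (G : Tensor R n d) (C : List (Vec R n)) (v : Vec R n) :
    Prog R n (Vec R n) := .localOpt b d G C v .ret

def sumOver {β : Type} : List β → (β → Prog R n R) → Prog R n R
  | [], _ => const 0
  | b :: l, f => do
      let x ← f b
      let s ← sumOver l f
      add x s

/-- The results of `f` along a list. -/
def listOf {β γ : Type} : List β → (β → Prog R n γ) → Prog R n (List γ)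
  | [], _ => .ret []
  | b :: l, f => do
      let x ← f b
      let s ← listOf l f
      return x :: s

/-- Run `f` along a list until it first returns a value. -/
def firstSome {β γ : Type} : List β → (β → Prog R n (Option γ)) → Prog R n (Option γ)
  | [], _ => .ret none
  | b :: l, f => do
      step
      match ← f b with
      | some c => return some c
      | none => firstSome l f

def tabulate {γ : Type} : (N : ℕ) → (Fin N → Prog R n γ) → Prog R n (Fin N → γ)
  | 0, _ => .ret Fin.elim0
  | N + 1, f => do
      let x ← f 0
      let g ← tabulate N fun i => f i.succ
      return Fin.cons x g

def tabulateTensor : (d : ℕ) → ((Fin d → Fin n) → Prog R n R) → Prog R n (Tensor R n d)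
  | 0, f => do
      let x ← f Fin.elim0
      return fun _ => x
  | d + 1, f => do
      let g ← tabulate n fun i => tabulateTensor d fun a => f (Fin.cons i a)
      return fun a => g (a 0) (Fin.tail a)

/-- `G(v, …, v)` -/
def evalTensor : (d : ℕ) → Tensor R n d → Vec R n → Prog R n R
  | 0, G, _ => .ret (G Fin.elim0)
  | d + 1, G, v => sumOver (List.finRange n) fun i => do
      let y ← evalTensor d (fun a => G (Fin.cons i a)) v
      mul (v i) y

def power (x : R) : ℕ → Prog R n R
  | 0 => const 1
  | e + 1 => do
      let y ← power x e
      mul x y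

def dot (u v : Vec R n) : Prog R n R := sumOver (List.finRange n) fun i => mul (u i) (v i)

def unitVec (i : Fin n) : Prog R n (Vec R n) := tabulate n fun t => const (if t = i then 1 else 0)

/-- `v / ‖v‖` -/
def normalize (v : Vec R n) : Prog R n (Vec R n) := do
  let q ← dot v v
  let s ← sqrt q
  tabulate n fun i => div (v i) s

/-- The projection of `x` orthogonal to the (orthonormal) vectors in the list. -/
def project : List (Vec R n) → Vec R n → Prog R n (Vec R n)
  | [], x => .ret x
  | b :: C, x => do
      let s ← dot b x
      let y ← tabulate n fun i => do
        let t ← mul s (b i)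
        sub (x i) t
      project C y

/-- `E[x_{i₁} ⋯ x_{i_p} (xᵀv₁) ⋯ (xᵀv_l)]` for `is = [i₁, …, i_p]` and the list `v₁, …, v_l`. -/
def contract : List (Fin n) → List (Vec R n) → Prog R n R
  | is, [] => moment is
  | is, v :: vs => sumOver (List.finRange n) fun i => do
      let y ← contract (is ++ [i]) vs
      mul (v i) y

/-- The tensor of the form `u ↦ E[(xᵀu)^d]`. -/
def momentTensor (d : ℕ) : Prog R n (Tensor R n d) :=
  tabulateTensor d fun a => moment (List.ofFn a)

/-- The tensor of the form `u ↦ E[(xᵀu)^d ∏ₜ (xᵀvₜ)] - E[(xᵀu)^d] E[∏ₜ (xᵀvₜ)]`. -/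
def correlationTensor (d : ℕ) (vs : List (Vec R n)) : Prog R n (Tensor R n d) := do
  let e ← contract [] vs
  tabulateTensor d fun a => do
    let y ← contract (List.ofFn a) vs
    let z ← moment (List.ofFn a)
    let t ← mul z e
    sub y t

/-- All `l`-tuples of elements of a list. -/
def tuples {β : Type} (S : List β) : ℕ → List (List β)
  | 0 => [[]]
  | l + 1 => S.flatMap fun v => (tuples S l).map fun vs => v :: vs

/-- All ways of splitting a list into a part `T` of at most `k` elements and the rest `B - T`. -/
def splits {β : Type} : ℕ → List β → List (List β × List β)
  | _, [] => [([], [])]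
  | 0, B => [([], B)]
  | k + 1, b :: B =>
      ((splits k B).map fun p => (b :: p.1, p.2)) ++ (splits (k + 1) B).map fun p => (p.1, b :: p.2)

/-! ### FindBasis, ExtendBasis, Factor -/

/-- The identity test `G(u, …, u) ≡ c` on the unit sphere of `C^⊥` (where `c = 0` if `d` is odd),
with `r` random trials; a trial picks a vector with independent uniform coordinates in
`{1, …, 2m}`, projects it to `C^⊥` and evaluates the homogeneous polynomial
`G(v, …, v) - c ‖v‖^d`. From the first point where it does not vanish a local optimum on the same
side of `c` is computed. -/
def findOptimum (m : ℕ) {d : ℕ} (G : Tensor R n d) (c : ℕ) (C : List (Vec R n)) :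
    (r : ℕ) → Prog R n (Option (Vec R n))
  | 0 => .ret none
  | r + 1 => do
      let x ← tabulate n fun _ => draw (2 * m)
      let v ← project C x
      let y ← evalTensor d G v
      let q ← dot v v
      let s ← power q (d / 2)
      let g ← const c
      let z ← mul g s
      if ← less z y then
        let w ← normalize v
        let u ← localOpt true G C w
        return some u
      else if ← less y z then
        let w ← normalize v
        let u ← localOpt false G C w
        return some u
      else findOptimum m G c C r

/-- The loop of FindBasis, from the current `B` and `j`. -/
def findBasis (m r : ℕ) (B : List (Vec R n)) (j : ℕ) : Prog R n (List (Vec R n)) :=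
  if _h : B.length < n ∧ j ≤ m then do
    step
    let G ← momentTensor j
    match ← findOptimum m G (gaussianMoment j) B r with
    | none => findBasis m r B (j + 1)
    | some u => findBasis m r (B ++ [u]) j
  else .ret B
termination_by (n - B.length) + (m + 1 - j)
decreasing_by
  · omega
  · simp only [List.length_append, List.length_cons, List.length_nil]
    omega

/-- The loop of ExtendBasis, from the current `S` and `j`, with at most `cap` vectors in `S`; new
vectors are sought orthogonal to both `S` and `T`. -/
def extendBasis (m r cap : ℕ) (T S : List (Vec R n)) (j : ℕ) : Prog R n (List (Vec R n)) :=
  if _h : S.length < cap ∧ j ≤ m then do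
    step
    let choices := (List.range' 1 (j - 1)).flatMap fun l => tuples S l
    let w ← firstSome choices fun vs => do
      let G ← correlationTensor (j - vs.length) vs
      findOptimum m G 0 (S ++ T) r
    match w with
    | none => extendBasis m r cap T S (j + 1)
    | some u => extendBasis m r cap T (S ++ [u]) 3
  else .ret S
termination_by (cap - S.length, m + 1 - j)
decreasing_by
  · apply Prod.Lex.right
    omega
  · apply Prod.Lex.left
    simp only [List.length_append, List.length_cons, List.length_nil]
    omega

/-- Vectors that complete the orthonormal list `C` to an orthonormal basis (Gram–Schmidt on the
standard basis vectors with index in the given list). -/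
def complete : List (Fin n) → List (Vec R n) → Prog R n (List (Vec R n))
  | [], _ => .ret []
  | i :: is, C => do
      let e ← unitVec i
      let p ← project C e
      let q ← dot p p
      let zero ← const 0
      if ← less zero q then
        let b ← normalize p
        let A ← complete is (C ++ [b])
        return b :: A
      else complete is C

/-- `Δ_U^l`, for an orthonormal basis `U` of a subspace and an orthonormal basis `W` of its
orthogonal complement: the sum over all `l`-tuples of basis vectors of the squared difference
between the joint moment and the product of the moment of the `U` part and of the `W` part. -/
def momentGap (U W : List (Vec R n)) (l : ℕ) : Prog R n R :=
  sumOver (tuples ((U.map fun v => (v, true)) ++ W.map fun v => (v, false)) l) fun p => do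
    let x ← contract [] (p.map Prod.fst)
    let a ← contract [] ((p.filter fun q => q.2).map Prod.fst)
    let b ← contract [] ((p.filter fun q => !q.2).map Prod.fst)
    let ab ← mul a b
    let d ← sub x ab
    mul d d

/-- Strict lexicographic comparison. -/
def lexLess : List R → List R → Prog R n Bool
  | x :: xs, y :: ys => do
      if ← less x y then return true
      else if ← less y x then return false
      else lexLess xs ys
  | _, _ => .ret false

/-- The loop of Factor over the splittings `(T, B - T)`; `best` holds the best `U` so far and its
list `Δ_U^3, …, Δ_U^m`. -/
def selectBest (m k r : ℕ) : List (List (Vec R n) × List (Vec R n)) →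
    Option (List (Vec R n) × List R) → Prog R n (Option (List (Vec R n) × List R))
  | [], best => .ret best
  | (T, rest) :: l, best => do
      step
      let S₁ ← extendBasis m r k rest T 2
      let T₁ ← extendBasis m r (n - k) S₁ rest 2
      if k < S₁.length ∨ n - k < T₁.length then
        selectBest m k r l best
      else
        let A ← complete (List.finRange n) (S₁ ++ T₁)
        let U := S₁ ++ A.take (k - S₁.length)
        let W := T₁ ++ A.drop (k - S₁.length)
        let gaps ← listOf (List.range' 3 (m - 2)) fun l => momentGap U W l
        match best with
        | none => selectBest m k r l (some (U, gaps))
        | some b =>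
            if ← lexLess gaps b.2 then selectBest m k r l (some (U, gaps))
            else selectBest m k r l (some b)

/-- Algorithm Factor, with `r` trials in each identity test. The result is a basis of the subspace
found. -/
def factor (m k r : ℕ) : Prog R n (Option (List (Vec R n))) := do
  let B ← findBasis m r [] 2
  let best ← selectBest m k r (splits k B) none
  return best.map Prod.fst

end Algorithms

/-- The number `⌈log₂ (n / δ)⌉` of trials in each identity test. -/
noncomputable def trials (n : ℕ) (δ : ℝ) : ℕ := ⌈Real.logb 2 (n / δ)⌉₊

/-- The subspace spanned by a list of coordinate vectors. -/
def spanOf {n : ℕ} (L : List (Vec ℝ n)) : Submodule ℝ (EuclideanSpace ℝ (Fin n)) :=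
  Submodule.span ℝ {x | ∃ v ∈ L, x = WithLp.toLp 2 v}

end GenICA

/-!
The algorithm uses the distribution `F` only through the linear functional `Λ(p) = E_F[p(x)]` on
polynomials (`momentFunctional`). By `momentDist_factored_iff`, the hypothesis on `V` and the
conclusion on `U` both say that `Λ` is multiplicative, in total degree at most `m`, on products of
linear forms of the subspace with linear forms of its orthogonal complement (`MomentIndep`); the
passage from powers of single linear forms to arbitrary products is polarization.

*Local optima respect the factorization.* Suppose that the moments of order less than `j` are
Gaussian on `C^⊥`, where all vectors of `C` lie in `V` or in `W = V^⊥`. Then the difference `D_j`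
between the `j`-th moment and the Gaussian one is additive over orthogonal components
(`gaussGap_add`), so `D_j(x p + y q) = x^j D_j(p) + y^j D_j(q)` for `p ∈ V`, `q ∈ W` in `C^⊥`. For
`j ≥ 3` strict convexity of `s ↦ s^{j/2}` shows that a local maximum with positive value on the
sphere, or a local minimum with negative value, lies in `V` or in `W`
(`Factors.mem_of_farOptimum`). Hence FindBasis collects vectors of `V ∪ W` until the moments on the
orthogonal complement are Gaussian. In ExtendBasis with `S ⊂ V` and `T ⊂ W`, the first nonzero
correlation depends on the component in `V` only, so its optima lie in `V`
(`Factors.mem_left_of_farOptimum`).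

*The right splitting has no gap.* For the splitting `T = B ∩ V`, the extended lists either fill `V`
or `W`, or what remains is uncorrelated with both and has Gaussian moments. A Gaussian part factors
over any pair of orthogonal subspaces (`momentIndep_of_gaussGap`), so every completion to an
orthonormal basis has `Δ_U = 0` (`Factors.momentIndep_of_good`). As the gaps are nonnegative, the
lexicographically least list is then zero, and a candidate with zero gaps is a solution
(`momentIndep_of_gapValue`, `IsPerfect.momentDist_eq_zero`).

*Probability.* True identities always pass the test, and by the Schwartz–Zippel lemma a false one
passes `r` trials with probability at most `2^{-r}` (`expect_findOptimum_none_le`). Every false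
identity that is recognized adds a vector to an orthonormal list, and so only `n` tests of false
identities matter along the right splitting. This is carried out with the potential
`(n - number of vectors found) 2^{-r}` as a bound for the conditional probability of failure
(`basisRisk`, `extensionRisk`). Other splittings cannot do harm: a candidate with zero gaps is a
solution wherever it comes from.

*Steps.* `Prog.Ensures` is a program logic with step counts; the counts of the subroutines are
added up and compared with `max(2, n)^{23 (k + m)} log (2 + 1/δ)` in `total_cost_le` and
`trials_add_one_le`.
-/

namespace GenICA

section

/-! ### Reasoning about programs -/

namespace Prog

variable {n : ℕ} {α β : Type} {M : List (Fin n) → ℝ} {O : LocalOptOracle n}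

/-- The steps of a sequential composition are those of its two parts together. -/
theorem run_bind (p : Prog ℝ n α) (f : α → Prog ℝ n β) :
    (p >>= f).run M O =
      (p.run M O).bind fun x => ((f x.1).run M O).map fun y => (y.1, x.2 + y.2) := by
  have hstep : ∀ k : Prog ℝ n α, (k.bind f).run M O =
      ((k.run M O).bind fun x => ((f x.1).run M O).map fun y => (y.1, x.2 + y.2)) →
      ((k.bind f).run M O).map (fun p => (p.1, p.2 + 1)) =
        ((k.run M O).map fun p => (p.1, p.2 + 1)).bind
          fun x => ((f x.1).run M O).map fun y => (y.1, x.2 + y.2) := by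
    intro k ih
    rw [ih, PMF.map_bind, PMF.bind_map]
    congr 1
    funext x
    rw [PMF.map_comp]
    simp only [Function.comp_def]
    congr 1
    funext y
    simp only [Prod.mk.injEq, true_and]
    omega
  change (p.bind f).run M O = _
  induction p with
  | ret a =>
    simp only [Prog.bind, Prog.run, PMF.pure_bind, Nat.zero_add, Prod.mk.eta]
    exact (PMF.map_id _).symm
  | tick k ih => exact hstep _ ih
  | const c k ih => exact hstep _ (ih _)
  | arith o x y k ih => exact hstep _ (ih _)
  | sqrt x k ih => exact hstep _ (ih _)
  | less x y k ih => exact hstep _ (ih _)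
  | draw N k ih =>
    simp only [Prog.bind, Prog.run, PMF.bind_bind]
    congr 1
    funext z
    exact hstep _ (ih _)
  | moment is k ih => exact hstep _ (ih _)
  | localOpt b d G C v k ih => exact hstep _ (ih _)

/-- Every possible outcome of the program `p` satisfies `Q` and is reached in at most `c` steps. -/
def Ensures (M : List (Fin n) → ℝ) (O : LocalOptOracle n) (p : Prog ℝ n α) (c : ℕ)
    (Q : α → Prop) : Prop :=
  ∀ x ∈ (p.run M O).support, x.2 ≤ c ∧ Q x.1

/-- The expectation of `φ` at the result of the program `p`. -/
noncomputable def expect (M : List (Fin n) → ℝ) (O : LocalOptOracle n) (p : Prog ℝ n α)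
    (φ : α → ENNReal) : ENNReal :=
  ∑' x, p.run M O x * φ x.1

theorem Ensures.mono {p : Prog ℝ n α} {c c' : ℕ} {Q Q' : α → Prop} (h : Ensures M O p c Q)
    (hc : c ≤ c') (hQ : ∀ a, Q a → Q' a) : Ensures M O p c' Q' :=
  fun x hx => ⟨(h x hx).1.trans hc, hQ _ (h x hx).2⟩

theorem ensures_ret {a : α} {Q : α → Prop} (c : ℕ) (h : Q a) : Ensures M O (.ret a) c Q := by
  intro x hx
  simp only [Prog.run, PMF.support_pure, Set.mem_singleton_iff] at hx
  subst hx
  exact ⟨Nat.zero_le _, h⟩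

theorem ensures_pure {a : α} {Q : α → Prop} (c : ℕ) (h : Q a) :
    Ensures M O (pure a : Prog ℝ n α) c Q := ensures_ret c h

theorem Ensures.bind {p : Prog ℝ n α} {f : α → Prog ℝ n β} {c c' : ℕ} {Q : α → Prop}
    {Q' : β → Prop} (h : Ensures M O p c Q) (hf : ∀ a, Q a → Ensures M O (f a) c' Q') :
    Ensures M O (p >>= f) (c + c') Q' := by
  intro x hx
  rw [run_bind] at hx
  simp only [PMF.support_bind, PMF.support_map, Set.mem_iUnion, Set.mem_image] at hx
  obtain ⟨y, hy, z, hz, rfl⟩ := hx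
  have h1 := h y hy
  have h2 := hf _ h1.2 z hz
  exact ⟨Nat.add_le_add h1.1 h2.1, h2.2⟩

/-- The form of `Ensures.bind` in which the total number of steps is given. -/
theorem Ensures.bind' {p : Prog ℝ n α} {f : α → Prog ℝ n β} {c c' t : ℕ} {Q : α → Prop}
    {Q' : β → Prop} (h : Ensures M O p c Q) (ht : c + c' ≤ t)
    (hf : ∀ a, Q a → Ensures M O (f a) c' Q') : Ensures M O (p >>= f) t Q' :=
  (h.bind hf).mono ht fun _ => id

theorem ensures_step {α : Type} {k : Prog ℝ n α} {c : ℕ} {Q : α → Prop}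
    {p : Prog ℝ n α} (hp : p.run M O = (k.run M O).map fun p => (p.1, p.2 + 1))
    (h : Ensures M O k c Q) : Ensures M O p (c + 1) Q := by
  intro x hx
  rw [hp, PMF.support_map] at hx
  obtain ⟨y, hy, rfl⟩ := hx
  exact ⟨Nat.add_le_add_right (h y hy).1 1, (h y hy).2⟩

theorem ensures_tick : Ensures M O (step : Prog ℝ n Unit) 1 fun _ => True :=
  ensures_step rfl (ensures_ret 0 trivial)

theorem ensures_const (c : ℕ) : Ensures M O (GenICA.const c) 1 (· = (c : ℝ)) :=
  ensures_step rfl (ensures_ret 0 rfl)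

theorem ensures_add (x y : ℝ) : Ensures M O (add x y) 1 (· = x + y) :=
  ensures_step rfl (ensures_ret 0 rfl)

theorem ensures_sub (x y : ℝ) : Ensures M O (sub x y) 1 (· = x - y) :=
  ensures_step rfl (ensures_ret 0 rfl)

theorem ensures_mul (x y : ℝ) : Ensures M O (mul x y) 1 (· = x * y) :=
  ensures_step rfl (ensures_ret 0 rfl)

theorem ensures_div (x y : ℝ) : Ensures M O (div x y) 1 (· = x / y) :=
  ensures_step rfl (ensures_ret 0 rfl)

theorem ensures_sqrt (x : ℝ) : Ensures M O (GenICA.sqrt x) 1 (· = Real.sqrt x) :=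
  ensures_step rfl (ensures_ret 0 rfl)

theorem ensures_less (x y : ℝ) : Ensures M O (GenICA.less x y) 1 fun b => (b = true ↔ x < y) :=
  ensures_step rfl (ensures_ret 0 (by simp))

theorem ensures_moment (is : List (Fin n)) : Ensures M O (GenICA.moment is) 1 (· = M is) :=
  ensures_step rfl (ensures_ret 0 rfl)

theorem ensures_localOpt (b : Bool) {d : ℕ} (G : Tensor ℝ n d) (C : List (Vec ℝ n))
    (v : Vec ℝ n) : Ensures M O (GenICA.localOpt b G C v) 1 (· = O b d G C v) :=
  ensures_step rfl (ensures_ret 0 rfl)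

theorem ensures_draw (N : ℕ) : Ensures M O (GenICA.draw N) 1 fun _ => True := by
  intro x hx
  simp only [GenICA.draw, Prog.run, PMF.support_bind, PMF.support_map, PMF.support_pure,
    Set.mem_iUnion, Set.mem_image, Set.mem_singleton_iff] at hx
  obtain ⟨_, _, _, rfl, rfl⟩ := hx
  simp

theorem expect_ret (a : α) (φ : α → ENNReal) : expect M O (.ret a) φ = φ a := by
  rw [expect, tsum_eq_single (a, 0)]
  · simp [Prog.run]
  · intro x hx
    simp [Prog.run, PMF.pure_apply, hx]

theorem tsum_bind_mul {γ δ : Type} (p : PMF γ) (f : γ → PMF δ) (φ : δ → ENNReal) :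
    ∑' x, p.bind f x * φ x = ∑' a, p a * ∑' x, f a x * φ x := by
  simp only [PMF.bind_apply, ← ENNReal.tsum_mul_right, ← ENNReal.tsum_mul_left]
  rw [ENNReal.tsum_comm]
  simp only [mul_assoc]

theorem tsum_map_mul {γ δ : Type} (p : PMF γ) (g : γ → δ) (φ : δ → ENNReal) :
    ∑' x, p.map g x * φ x = ∑' a, p a * φ (g a) := by
  rw [← PMF.bind_pure_comp, tsum_bind_mul]
  congr 1
  funext a
  congr 1
  rw [tsum_eq_single (g a)]
  · simp
  · intro x hx
    simp [PMF.pure_apply, hx]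

theorem expect_bind (p : Prog ℝ n α) (f : α → Prog ℝ n β) (φ : β → ENNReal) :
    expect M O (p >>= f) φ = expect M O p fun a => expect M O (f a) φ := by
  simp only [expect]
  rw [run_bind, tsum_bind_mul]
  congr 1
  funext x
  congr 1
  rw [tsum_map_mul]

theorem Ensures.expect_mono {p : Prog ℝ n α} {c : ℕ} {Q : α → Prop} (h : Ensures M O p c Q)
    {φ ψ : α → ENNReal} (hle : ∀ a, Q a → φ a ≤ ψ a) : expect M O p φ ≤ expect M O p ψ := by
  refine ENNReal.tsum_le_tsum fun x => ?_
  by_cases hx : x ∈ (p.run M O).support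
  · gcongr
    exact hle _ (h x hx).2
  · rw [PMF.mem_support_iff, not_not] at hx
    simp [hx]

theorem expect_mono (p : Prog ℝ n α) {φ ψ : α → ENNReal} (hle : ∀ a, φ a ≤ ψ a) :
    expect M O p φ ≤ expect M O p ψ :=
  ENNReal.tsum_le_tsum fun x => by gcongr; exact hle x.1

theorem expect_const (p : Prog ℝ n α) (b : ENNReal) : expect M O p (fun _ => b) = b := by
  rw [expect, ENNReal.tsum_mul_right, PMF.tsum_coe, one_mul]

theorem Ensures.expect_le {p : Prog ℝ n α} {c : ℕ} {Q : α → Prop} (h : Ensures M O p c Q)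
    {φ : α → ENNReal} {b : ENNReal} (hle : ∀ a, Q a → φ a ≤ b) : expect M O p φ ≤ b :=
  (h.expect_mono hle).trans_eq (expect_const p b)

theorem expect_le {p : Prog ℝ n α} {φ : α → ENNReal} {b : ENNReal} (hle : ∀ a, φ a ≤ b) :
    expect M O p φ ≤ b :=
  (expect_mono p hle).trans_eq (expect_const p b)

theorem expect_add (p : Prog ℝ n α) (φ ψ : α → ENNReal) :
    expect M O p (fun a => φ a + ψ a) = expect M O p φ + expect M O p ψ := by
  simp only [expect, mul_add, ENNReal.tsum_add]

theorem Ensures.expect_bind_le {p : Prog ℝ n α} {f : α → Prog ℝ n β} {c : ℕ} {Q : α → Prop}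
    (h : Ensures M O p c Q) {φ : β → ENNReal} {b : ENNReal}
    (hle : ∀ a, Q a → expect M O (f a) φ ≤ b) : expect M O (p >>= f) φ ≤ b := by
  rw [expect_bind]
  exact h.expect_le hle

theorem expect_draw (N : ℕ) (hN : 1 ≤ N) (φ : ℝ → ENNReal) :
    expect M O (GenICA.draw N) φ = ∑ z ∈ Finset.Icc 1 N, (N : ENNReal)⁻¹ * φ (z : ℝ) := by
  have hN' : max 1 N = N := by omega
  have hmem : ∀ z ∈ Finset.Icc 1 N, (PMF.uniformOfFinset (Finset.Icc 1 (max 1 N)) ⟨1, by simp⟩) z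
      = (N : ENNReal)⁻¹ := fun z hz =>
    (PMF.uniformOfFinset_apply_of_mem _ (by rwa [hN'])).trans (by simp [hN'])
  have hnot : ∀ z ∉ Finset.Icc 1 N, (PMF.uniformOfFinset (Finset.Icc 1 (max 1 N)) ⟨1, by simp⟩) z
      = 0 := fun z hz => PMF.uniformOfFinset_apply_of_notMem _ (by rwa [hN'])
  have hret : ∀ z : ℕ, ∑' x, ((Prog.ret (z : ℝ) : Prog ℝ n ℝ).run M O).map
      (fun p => (p.1, p.2 + 1)) x * φ x.1 = φ z := fun z => by
    rw [tsum_map_mul]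
    exact expect_ret (M := M) (O := O) (z : ℝ) φ
  rw [expect, GenICA.draw]
  unfold Prog.run
  rw [tsum_bind_mul, tsum_eq_sum (s := Finset.Icc 1 N)]
  · refine Finset.sum_congr rfl fun z hz => ?_
    rw [hret]
    exact congrArg (· * φ z) (hmem z hz)
  · intro z hz
    exact mul_eq_zero_of_left (hnot z hz) _

open Classical in
theorem toOuterMeasure_run (p : Prog ℝ n α) (S : Set α) :
    (p.run M O).toOuterMeasure {x | x.1 ∈ S} = expect M O p fun a => if a ∈ S then 1 else 0 := by
  rw [PMF.toOuterMeasure_apply, expect]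
  congr 1
  funext x
  by_cases hx : x.1 ∈ S
  · simp [hx]
  · simp [hx]

end Prog

end

section

/-! ### Values and costs of the subroutines -/

/-- The linear form `u ↦ vᵀu` as a polynomial. -/
noncomputable def linForm {n : ℕ} : Vec ℝ n →ₗ[ℝ] MvPolynomial (Fin n) ℝ :=
  Fintype.linearCombination ℝ (MvPolynomial.X : Fin n → MvPolynomial (Fin n) ℝ)

theorem linForm_apply {n : ℕ} (v : Vec ℝ n) : linForm v = ∑ i, v i • MvPolynomial.X i := rfl

/-- The projection orthogonal to the vectors of an orthonormal list, computed one vector at a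
time. -/
def projOrth {n : ℕ} : List (Vec ℝ n) → Vec ℝ n → Vec ℝ n
  | [], x => x
  | b :: C, x => projOrth C (x - (b ⬝ᵥ x) • b)

theorem Tensor.form_zero {n : ℕ} (G : Tensor ℝ n 0) (v : Vec ℝ n) :
    Tensor.form G v = G Fin.elim0 := by
  rw [Tensor.form, Fintype.sum_unique]
  simp only [Finset.univ_eq_empty, Finset.prod_empty, mul_one]
  congr 1

theorem Tensor.form_succ {n d : ℕ} (G : Tensor ℝ n (d + 1)) (v : Vec ℝ n) :
    Tensor.form G v = ∑ i, v i * Tensor.form (fun a => G (Fin.cons i a)) v := by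
  simp only [Tensor.form]
  rw [← (Fin.consEquiv (fun _ : Fin (d + 1) => Fin n)).sum_comp, Fintype.sum_prod_type]
  refine Finset.sum_congr rfl fun i _ => ?_
  rw [Finset.mul_sum]
  refine Finset.sum_congr rfl fun a _ => ?_
  simp only [Fin.consEquiv, Equiv.coe_fn_mk, Fin.prod_univ_succ, Fin.cons_zero, Fin.cons_succ]
  ring

/-- The form of the tensor of values of a linear functional `φ` at monomials is
`u ↦ φ((uᵀX)^d)`. -/
theorem Tensor.form_functional {n d : ℕ} (φ : MvPolynomial (Fin n) ℝ →ₗ[ℝ] ℝ) (u : Vec ℝ n) :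
    Tensor.form (fun a : Fin d → Fin n => φ ((List.ofFn a).map MvPolynomial.X).prod) u =
      φ (linForm u ^ d) := by
  rw [linForm_apply, Fintype.sum_pow, map_sum, Tensor.form]
  refine Finset.sum_congr rfl fun a _ => ?_
  rw [Finset.prod_smul, map_smul, smul_eq_mul, mul_comm, List.map_ofFn, List.prod_ofFn]
  rfl

namespace Prog

variable {n : ℕ} {β γ : Type} {M : List (Fin n) → ℝ} {O : LocalOptOracle n}

theorem ensures_sumOver {l : List β} {f : β → Prog ℝ n ℝ} {g : β → ℝ} {c : ℕ}
    (h : ∀ b ∈ l, Ensures M O (f b) c (· = g b)) :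
    Ensures M O (sumOver l f) (l.length * (c + 1) + 1) (· = (l.map g).sum) := by
  induction l with
  | nil => exact (ensures_const 0).mono (by simp) (by simp)
  | cons b l ih =>
    refine (h b (by simp)).bind' (c' := l.length * (c + 1) + 1 + 1) ?_ ?_
    · simp only [List.length_cons]; ring_nf; omega
    rintro x rfl
    refine (ih fun b hb => h b (by simp [hb])).bind ?_
    rintro s rfl
    exact (ensures_add _ _).mono le_rfl (by simp)

theorem ensures_sum_univ {f : Fin n → Prog ℝ n ℝ} {g : Fin n → ℝ} {c : ℕ}
    (h : ∀ i, Ensures M O (f i) c (· = g i)) :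
    Ensures M O (sumOver (List.finRange n) f) (n * (c + 1) + 1) (· = ∑ i, g i) :=
  (ensures_sumOver fun i _ => h i).mono (by simp) (by simp [Fin.sum_univ_def])

theorem ensures_listOf {l : List β} {f : β → Prog ℝ n γ} {g : β → γ} {c : ℕ}
    (h : ∀ b ∈ l, Ensures M O (f b) c (· = g b)) :
    Ensures M O (listOf l f) (l.length * c) (· = l.map g) := by
  induction l with
  | nil => exact ensures_ret _ rfl
  | cons b l ih =>
    refine (h b (by simp)).bind' (c' := l.length * c + 0) ?_ ?_
    · simp only [List.length_cons]; ring_nf; omega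
    rintro x rfl
    refine (ih fun b hb => h b (by simp [hb])).bind ?_
    rintro s rfl
    exact ensures_pure _ (by simp)

theorem ensures_firstSome {l : List β} {f : β → Prog ℝ n (Option γ)} {c : ℕ}
    {Q : Option γ → Prop} (hnone : Q none) (h : ∀ b ∈ l, Ensures M O (f b) c Q) :
    Ensures M O (firstSome l f) (l.length * (c + 1)) Q := by
  induction l with
  | nil => exact ensures_ret _ hnone
  | cons b l ih =>
    refine ensures_tick.bind' (c' := c + l.length * (c + 1)) ?_ ?_
    · simp only [List.length_cons]; ring_nf; omega
    intro _ _
    refine (h b (by simp)).bind ?_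
    rintro (_ | x) hx
    · exact ih fun b hb => h b (by simp [hb])
    · exact ensures_pure _ hx

theorem ensures_tabulate {N : ℕ} {f : Fin N → Prog ℝ n γ} {Q : Fin N → γ → Prop} {c : ℕ}
    (h : ∀ i, Ensures M O (f i) c (Q i)) :
    Ensures M O (tabulate N f) (N * c) fun g => ∀ i, Q i (g i) := by
  induction N with
  | zero => exact ensures_ret _ fun i => i.elim0
  | succ N ih =>
    refine (h 0).bind' (c' := N * c + 0) (by ring_nf; omega) fun x hx => ?_
    refine (ih fun i => h i.succ).bind fun g hg => ensures_pure _ fun i => ?_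
    refine Fin.cases ?_ (fun i => ?_) i
    · simpa using hx
    · simpa using hg i

theorem ensures_tabulate_eq {N : ℕ} {f : Fin N → Prog ℝ n γ} {g : Fin N → γ} {c : ℕ}
    (h : ∀ i, Ensures M O (f i) c (· = g i)) : Ensures M O (tabulate N f) (N * c) (· = g) :=
  (ensures_tabulate h).mono le_rfl fun _ => funext

theorem ensures_tabulateTensor {d : ℕ} {f : (Fin d → Fin n) → Prog ℝ n ℝ} {g : Tensor ℝ n d}
    {c : ℕ} (h : ∀ a, Ensures M O (f a) c (· = g a)) :
    Ensures M O (tabulateTensor d f) (n ^ d * c) (· = g) := by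
  induction d with
  | zero =>
    refine (h Fin.elim0).bind' (c' := 0) (by simp) ?_
    rintro x rfl
    refine ensures_pure _ (funext fun a => ?_)
    rw [Subsingleton.elim a Fin.elim0]
  | succ d ih =>
    refine (ensures_tabulate_eq (c := n ^ d * c) (g := fun i a => g (Fin.cons i a))
      fun i => ih fun a => h _).bind' (c' := 0) (by rw [pow_succ]; apply le_of_eq; ring) ?_
    rintro x rfl
    refine ensures_pure _ (funext fun a => ?_)
    simp only [Fin.cons_self_tail]

theorem ensures_evalTensor {N : ℕ} (hN : 2 ≤ N) (hn : n ≤ N) (v : Vec ℝ n) :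
    ∀ (d : ℕ) (G : Tensor ℝ n d),
      Ensures M O (evalTensor d G v) (N ^ (3 * d)) (· = Tensor.form G v)
  | 0, G => ensures_ret _ (Tensor.form_zero G v).symm
  | d + 1, G => by
    rw [Tensor.form_succ]
    refine (ensures_sum_univ (c := N ^ (3 * d) + 1) fun i => ?_).mono ?_ fun _ => id
    · refine (ensures_evalTensor hN hn v d _).bind ?_
      rintro y rfl
      exact ensures_mul _ _
    · have h1 : 1 ≤ N ^ (3 * d) := Nat.one_le_pow _ _ (by omega)
      have : N ^ (3 * (d + 1)) = N ^ 3 * N ^ (3 * d) := by ring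
      rw [this]
      generalize N ^ (3 * d) = t at *
      have h2 : n * (t + 1 + 1) + 1 ≤ N * (t + 1 + 1) + 1 := by gcongr
      nlinarith [Nat.mul_le_mul hN hN, Nat.mul_le_mul (Nat.mul_le_mul hN hN) h1,
        Nat.mul_le_mul (Nat.mul_le_mul hN hN) (le_refl (N * t))]

theorem ensures_power (x : ℝ) : ∀ e : ℕ, Ensures M O (power x e) (e + 1) (· = x ^ e)
  | 0 => (ensures_const 1).mono le_rfl (by simp)
  | e + 1 => by
    refine (ensures_power x e).bind ?_
    rintro y rfl
    exact (ensures_mul _ _).mono le_rfl (by simp [pow_succ'])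

theorem ensures_dot (u v : Vec ℝ n) : Ensures M O (dot u v) (n * 2 + 1) (· = u ⬝ᵥ v) :=
  ensures_sum_univ fun i => ensures_mul (u i) (v i)

theorem ensures_unitVec (i : Fin n) :
    Ensures M O (unitVec i) n (· = Pi.single i 1) := by
  refine (ensures_tabulate_eq (c := 1) fun t => ?_).mono (by simp) fun _ => id
  refine (ensures_const _).mono le_rfl ?_
  rintro _ rfl
  by_cases h : t = i <;> simp [h]

theorem ensures_normalize (v : Vec ℝ n) :
    Ensures M O (normalize v) (n * 3 + 2) (· = (Real.sqrt (v ⬝ᵥ v))⁻¹ • v) := by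
  refine (ensures_dot v v).bind' (c' := 1 + n * 1) (by omega) ?_
  rintro _ rfl
  refine (ensures_sqrt _).bind ?_
  rintro _ rfl
  exact ensures_tabulate_eq fun i => (ensures_div _ _).mono le_rfl
    (by simp [div_eq_inv_mul])

theorem ensures_project : ∀ (C : List (Vec ℝ n)) (x : Vec ℝ n),
    Ensures M O (project C x) (C.length * (n * 4 + 1)) (· = projOrth C x)
  | [], x => ensures_ret _ rfl
  | b :: C, x => by
    refine (ensures_dot b x).bind' (c' := n * 2 + C.length * (n * 4 + 1)) ?_ ?_
    · simp only [List.length_cons]; ring_nf; omega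
    rintro _ rfl
    refine (ensures_tabulate_eq (g := x - (b ⬝ᵥ x) • b) (c := 2) fun i => ?_).bind ?_
    · refine (ensures_mul _ _).bind' (c' := 1) le_rfl ?_
      rintro _ rfl
      exact (ensures_sub _ _).mono le_rfl (by simp)
    · rintro _ rfl
      exact ensures_project C _

variable {Lam : MvPolynomial (Fin n) ℝ →ₗ[ℝ] ℝ}

theorem ensures_contract {N : ℕ} (hN : 2 ≤ N) (hn : n ≤ N)
    (hM : ∀ is, M is = Lam (is.map MvPolynomial.X).prod) :
    ∀ (vs : List (Vec ℝ n)) (is : List (Fin n)),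
      Ensures M O (contract is vs) (N ^ (3 * vs.length))
        (· = Lam ((is.map MvPolynomial.X).prod * (vs.map linForm).prod))
  | [], is => (ensures_moment is).mono (by simp) (by simp [hM])
  | v :: vs, is => by
    have hval : Lam ((is.map MvPolynomial.X).prod * ((v :: vs).map linForm).prod) =
        ∑ i, v i * Lam (((is ++ [i]).map MvPolynomial.X).prod * (vs.map linForm).prod) := by
      simp only [List.map_cons, List.prod_cons, List.map_append, List.prod_append, List.map_nil,
        List.prod_nil, mul_one]
      rw [linForm_apply, Finset.sum_mul, Finset.mul_sum, map_sum]
      refine Finset.sum_congr rfl fun i _ => ?_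
      rw [smul_mul_assoc, mul_smul_comm, map_smul, smul_eq_mul, mul_assoc]
    rw [hval]
    refine (ensures_sum_univ (c := N ^ (3 * vs.length) + 1) fun i => ?_).mono ?_ fun _ => id
    · refine (ensures_contract hN hn hM vs _).bind ?_
      rintro y rfl
      exact ensures_mul _ _
    · have h1 : 1 ≤ N ^ (3 * vs.length) := Nat.one_le_pow _ _ (by omega)
      have : N ^ (3 * (v :: vs).length) = N ^ 3 * N ^ (3 * vs.length) := by
        rw [List.length_cons]; ring
      rw [this]
      generalize N ^ (3 * vs.length) = t at *
      have h2 : n * (t + 1 + 1) + 1 ≤ N * (t + 1 + 1) + 1 := by gcongr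
      nlinarith [Nat.mul_le_mul hN hN, Nat.mul_le_mul (Nat.mul_le_mul hN hN) h1,
        Nat.mul_le_mul (Nat.mul_le_mul hN hN) (le_refl (N * t))]

theorem ensures_contract_nil {N : ℕ} (hN : 2 ≤ N) (hn : n ≤ N)
    (hM : ∀ is, M is = Lam (is.map MvPolynomial.X).prod) (vs : List (Vec ℝ n)) :
    Ensures M O (contract [] vs) (N ^ (3 * vs.length)) (· = Lam (vs.map linForm).prod) :=
  (ensures_contract hN hn hM vs []).mono le_rfl (by simp)

/-- The linear functional `p ↦ Λ(pq) - Λ(p)Λ(q)`. -/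
noncomputable def covWith (Lam : MvPolynomial (Fin n) ℝ →ₗ[ℝ] ℝ) (q : MvPolynomial (Fin n) ℝ) :
    MvPolynomial (Fin n) ℝ →ₗ[ℝ] ℝ :=
  Lam ∘ₗ LinearMap.mulRight ℝ q - Lam q • Lam

theorem covWith_apply (Lam : MvPolynomial (Fin n) ℝ →ₗ[ℝ] ℝ) (q p : MvPolynomial (Fin n) ℝ) :
    covWith Lam q p = Lam (p * q) - Lam p * Lam q := by
  simp [covWith, mul_comm]

/-- The order `d` tensor of a linear functional on polynomials. -/
noncomputable def tensorOf (φ : MvPolynomial (Fin n) ℝ →ₗ[ℝ] ℝ) (d : ℕ) : Tensor ℝ n d :=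
  fun a => φ ((List.ofFn a).map MvPolynomial.X).prod

theorem form_tensorOf (φ : MvPolynomial (Fin n) ℝ →ₗ[ℝ] ℝ) (d : ℕ) (u : Vec ℝ n) :
    Tensor.form (tensorOf φ d) u = φ (linForm u ^ d) := Tensor.form_functional φ u

theorem ensures_momentTensor (hM : ∀ is, M is = Lam (is.map MvPolynomial.X).prod) (d : ℕ) :
    Ensures M O (momentTensor d) (n ^ d) (· = tensorOf Lam d) :=
  (ensures_tabulateTensor (c := 1) fun a => (ensures_moment _).mono le_rfl
    (by simp [hM, tensorOf])).mono (by simp) fun _ => id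

theorem ensures_correlationTensor {N : ℕ} (hN : 2 ≤ N) (hn : n ≤ N)
    (hM : ∀ is, M is = Lam (is.map MvPolynomial.X).prod) (d : ℕ) (vs : List (Vec ℝ n)) :
    Ensures M O (correlationTensor d vs)
      (N ^ (3 * vs.length) + n ^ d * (N ^ (3 * vs.length) + 3))
      (· = tensorOf (covWith Lam (vs.map linForm).prod) d) := by
  refine (ensures_contract_nil hN hn hM vs).bind ?_
  rintro _ rfl
  refine ensures_tabulateTensor fun a => ?_
  refine (ensures_contract hN hn hM vs _).bind' (c' := 1 + (1 + 1)) le_rfl ?_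
  rintro _ rfl
  refine (ensures_moment _).bind ?_
  rintro _ rfl
  refine (ensures_mul _ _).bind ?_
  rintro _ rfl
  exact (ensures_sub _ _).mono le_rfl (by simp [tensorOf, covWith_apply, hM])

end Prog

end

section

/-! ### Orthonormal lists -/

variable {n : ℕ}

/-- The list consists of pairwise orthogonal unit vectors. -/
def OrthoList (L : List (Vec ℝ n)) : Prop :=
  (∀ v ∈ L, v ⬝ᵥ v = 1) ∧ L.Pairwise fun u v => u ⬝ᵥ v = 0

theorem orthoList_nil : OrthoList ([] : List (Vec ℝ n)) := ⟨by simp, List.Pairwise.nil⟩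

theorem OrthoList.perm {L L' : List (Vec ℝ n)} (h : OrthoList L) (hp : L.Perm L') :
    OrthoList L' :=
  ⟨fun v hv => h.1 v (hp.mem_iff.2 hv),
    (hp.pairwise_iff fun {_ _} hxy => by rw [dotProduct_comm]; exact hxy).1 h.2⟩

theorem orthoList_append {L L' : List (Vec ℝ n)} :
    OrthoList (L ++ L') ↔ OrthoList L ∧ OrthoList L' ∧ ∀ u ∈ L, ∀ v ∈ L', u ⬝ᵥ v = 0 := by
  simp only [OrthoList, List.mem_append, List.pairwise_append]
  constructor
  · rintro ⟨h1, h2, h3, h4⟩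
    exact ⟨⟨fun v hv => h1 v (Or.inl hv), h2⟩, ⟨fun v hv => h1 v (Or.inr hv), h3⟩, h4⟩
  · rintro ⟨⟨h1, h2⟩, ⟨h3, h4⟩, h5⟩
    exact ⟨fun v hv => hv.elim (h1 v) (h3 v), h2, h4, h5⟩

theorem OrthoList.concat {C : List (Vec ℝ n)} {u : Vec ℝ n} (hC : OrthoList C)
    (hu : u ∈ sphereOrth C) : OrthoList (C ++ [u]) := by
  refine orthoList_append.2 ⟨hC, ⟨?_, List.pairwise_singleton _ _⟩, ?_⟩
  · simpa using hu.1
  · simpa using hu.2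

/-- Adding a vector orthogonal to `S` and `T` to the first of the two lists. -/
theorem OrthoList.insert {S T : List (Vec ℝ n)} {u : Vec ℝ n} (h : OrthoList (S ++ T))
    (hu : u ∈ sphereOrth (S ++ T)) : OrthoList (S ++ [u] ++ T) := by
  refine (h.concat hu).perm ?_
  rw [List.append_assoc, List.append_assoc]
  exact List.Perm.append_left _ List.perm_append_comm

theorem OrthoList.length_le {L : List (Vec ℝ n)} (hL : OrthoList L)
    (W : Submodule ℝ (Vec ℝ n)) (hW : ∀ v ∈ L, v ∈ W) : L.length ≤ Module.finrank ℝ W := by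
  have horth : ∀ i j : Fin L.length, i ≠ j → L.get i ⬝ᵥ L.get j = 0 := by
    intro i j hij
    rcases lt_or_gt_of_ne hij with h | h
    · exact List.pairwise_iff_get.1 hL.2 i j h
    · rw [dotProduct_comm]
      exact List.pairwise_iff_get.1 hL.2 j i h
  have hli : LinearIndependent ℝ fun i : Fin L.length => (⟨L.get i, hW _ (L.get_mem i)⟩ : W) := by
    refine LinearIndependent.of_comp W.subtype (Fintype.linearIndependent_iff.2 fun g hg i => ?_)
    have := congrArg (L.get i ⬝ᵥ ·) hg
    simp only [Function.comp, Submodule.subtype_apply, dotProduct_zero, dotProduct_sum,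
      dotProduct_smul, smul_eq_mul] at this
    rw [Finset.sum_eq_single i (fun j _ hj => by rw [horth i j hj.symm, mul_zero]) (by simp),
      hL.1 _ (L.get_mem i), mul_one] at this
    exact this
  simpa using hli.fintype_card_le_finrank

theorem OrthoList.length_le_dim {L : List (Vec ℝ n)} (hL : OrthoList L) : L.length ≤ n := by
  simpa using hL.length_le ⊤ (by simp)

theorem dotProduct_self_pos {p : Vec ℝ n} (hp : p ≠ 0) : 0 < p ⬝ᵥ p :=
  lt_of_le_of_ne (Finset.sum_nonneg fun i _ => mul_self_nonneg (p i))
    fun h => hp (dotProduct_self_eq_zero.1 h.symm)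

theorem normalize_mem_sphereOrth {C : List (Vec ℝ n)} {p : Vec ℝ n} (hp : p ≠ 0)
    (hC : ∀ b ∈ C, b ⬝ᵥ p = 0) : (Real.sqrt (p ⬝ᵥ p))⁻¹ • p ∈ sphereOrth C := by
  have h := dotProduct_self_pos hp
  refine ⟨?_, fun b hb => by rw [dotProduct_smul, hC b hb, smul_zero]⟩
  rw [smul_dotProduct, dotProduct_smul, smul_eq_mul, smul_eq_mul, ← mul_assoc, ← mul_inv,
    Real.mul_self_sqrt h.le, inv_mul_cancel₀ h.ne']

/-- An orthonormal list of maximal length in a subspace has no nonzero vector of the subspace in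
its orthogonal complement. -/
theorem OrthoList.eq_zero_of_orth {S : List (Vec ℝ n)} (hS : OrthoList S)
    {W : Submodule ℝ (Vec ℝ n)} (hW : ∀ v ∈ S, v ∈ W) (hlen : S.length = Module.finrank ℝ W)
    {p : Vec ℝ n} (hp : p ∈ W) (hpS : ∀ b ∈ S, b ⬝ᵥ p = 0) : p = 0 := by
  by_contra h0
  have := (hS.concat (normalize_mem_sphereOrth h0 hpS)).length_le W (by
    intro v hv
    rcases List.mem_append.1 hv with hv | hv
    · exact hW v hv
    · rw [List.mem_singleton.1 hv]
      exact W.smul_mem _ hp)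
  simp only [List.length_append, List.length_singleton] at this
  omega

theorem length_eq_of_orth_trivial {L : List (Vec ℝ n)} (hL : OrthoList L)
    (h : ∀ u : Vec ℝ n, (∀ b ∈ L, b ⬝ᵥ u = 0) → u = 0) : L.length = n := by
  refine le_antisymm hL.length_le_dim ?_
  let f : Vec ℝ n →ₗ[ℝ] (Fin L.length → ℝ) := Matrix.mulVecLin (Matrix.of fun i => L.get i)
  have hf : Function.Injective f := by
    rw [← LinearMap.ker_eq_bot, LinearMap.ker_eq_bot']
    intro u hu
    refine h u fun b hb => ?_
    obtain ⟨i, rfl⟩ := List.get_of_mem hb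
    exact congrFun hu i
  simpa using LinearMap.finrank_le_finrank_of_injective hf

theorem dotProduct_projOrth (C : List (Vec ℝ n)) (x u : Vec ℝ n) (hu : ∀ b ∈ C, b ⬝ᵥ u = 0) :
    u ⬝ᵥ projOrth C x = u ⬝ᵥ x := by
  induction C generalizing x with
  | nil => rfl
  | cons b C ih =>
    rw [projOrth, ih _ fun c hc => hu c (by simp [hc]), dotProduct_sub, dotProduct_smul,
      dotProduct_comm u b, hu b (by simp), smul_zero, sub_zero]

theorem projOrth_orth : ∀ {C : List (Vec ℝ n)}, OrthoList C → ∀ x : Vec ℝ n,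
    ∀ b ∈ C, b ⬝ᵥ projOrth C x = 0
  | [], _, _, _, h => by simp at h
  | b :: C, hC, x, c, hc => by
    obtain ⟨hb, hC'⟩ := List.pairwise_cons.1 hC.2
    rcases List.mem_cons.1 hc with rfl | hc
    · rw [projOrth, dotProduct_projOrth C _ _ fun d hd => by rw [dotProduct_comm]; exact hb d hd,
        dotProduct_sub, dotProduct_smul, hC.1 _ (by simp), smul_eq_mul, mul_one, sub_self]
    · exact projOrth_orth ⟨fun v hv => hC.1 v (by simp [hv]), hC'⟩ _ c hc

theorem projOrth_eq_self (C : List (Vec ℝ n)) {x : Vec ℝ n} (hx : ∀ b ∈ C, b ⬝ᵥ x = 0) :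
    projOrth C x = x := by
  induction C with
  | nil => rfl
  | cons b C ih =>
    rw [projOrth, hx b (by simp), zero_smul, sub_zero]
    exact ih fun c hc => hx c (by simp [hc])

theorem exists_linearMap_projOrth (C : List (Vec ℝ n)) :
    ∃ A : Vec ℝ n →ₗ[ℝ] Vec ℝ n, ∀ x, A x = projOrth C x := by
  induction C with
  | nil => exact ⟨LinearMap.id, fun x => rfl⟩
  | cons b C ih =>
    obtain ⟨A, hA⟩ := ih
    refine ⟨A ∘ₗ (LinearMap.id - (dotProductBilin ℝ ℝ b).smulRight b), fun x => ?_⟩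
    simp [hA, projOrth]

namespace Prog

variable {M : List (Fin n) → ℝ} {O : LocalOptOracle n}

/-- The completed list is orthonormal, and only the zero vector is orthogonal to all of it. -/
theorem ensures_complete {K : ℕ} : ∀ (is : List (Fin n)) (C : List (Vec ℝ n)), OrthoList C →
    C.length + is.length ≤ K →
    Ensures M O (complete is C) (is.length * (K * (n * 4 + 1) + n * 6 + 5)) fun A =>
      OrthoList (C ++ A) ∧ A.length ≤ is.length ∧
        ∀ u : Vec ℝ n, (∀ b ∈ C ++ A, b ⬝ᵥ u = 0) → ∀ i ∈ is, u i = 0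
  | [], C, hC, _ => ensures_ret _ ⟨by simpa using hC, le_rfl, by simp⟩
  | i :: is, C, hC, hK => by
    have hK' : C.length + is.length + 1 ≤ K := by simpa [add_assoc] using hK
    generalize hR : is.length * (K * (n * 4 + 1) + n * 6 + 5) = R
    refine (ensures_unitVec i).bind'
      (c' := C.length * (n * 4 + 1) + ((n * 2 + 1) + (1 + (1 + (n * 3 + 2 + (R + 0)))))) ?_ ?_
    · have : C.length * (n * 4 + 1) ≤ K * (n * 4 + 1) := Nat.mul_le_mul_right _ (by omega)
      rw [List.length_cons, Nat.succ_mul, hR]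
      omega
    rintro _ rfl
    refine (ensures_project C _).bind ?_
    rintro _ rfl
    set p := projOrth C (Pi.single i 1) with hp
    have hpC := projOrth_orth hC (Pi.single i 1)
    have hpu : ∀ u : Vec ℝ n, (∀ b ∈ C, b ⬝ᵥ u = 0) → u ⬝ᵥ p = u i := fun u hu => by
      rw [hp, dotProduct_projOrth C _ u hu, dotProduct_single_one]
    refine (ensures_dot p p).bind ?_
    rintro _ rfl
    refine (ensures_const 0).bind ?_
    rintro _ rfl
    refine (ensures_less _ _).bind fun b hb => ?_
    cases b with
    | false =>
      have hp0 : p = 0 := by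
        by_contra h
        exact absurd (hb.2 (by simpa using dotProduct_self_pos h)) (by simp)
      refine (ensures_complete (K := K) is C hC (by omega)).mono (by omega) ?_
      rintro A ⟨h1, h2, h3⟩
      refine ⟨h1, h2.trans (by simp), fun u hu j hj => ?_⟩
      rcases List.mem_cons.1 hj with rfl | hj
      · rw [← hpu u fun b hb => hu b (by simp [hb]), hp0, dotProduct_zero]
      · exact h3 u hu j hj
    | true =>
      have hp0 : p ≠ 0 := by
        intro h
        have := hb.1 rfl
        simp [h] at this
      refine (ensures_normalize p).bind ?_
      rintro _ rfl
      have hmem := normalize_mem_sphereOrth hp0 hpC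
      have hCb := hC.concat hmem
      refine (hR ▸ ensures_complete is _ hCb (by simp; omega)).bind ?_
      rintro A ⟨h1, h2, h3⟩
      refine ensures_pure _ ⟨by simpa using h1, by simpa using h2, fun u hu j hj => ?_⟩
      rcases List.mem_cons.1 hj with rfl | hj
      · rw [← hpu u fun b hb => hu b (by simp [hb])]
        have := hu _ (List.mem_append_right C (List.mem_cons_self ..))
        rw [smul_dotProduct, smul_eq_mul] at this
        rw [dotProduct_comm]
        exact (mul_eq_zero.1 this).resolve_left
          (inv_ne_zero (Real.sqrt_pos.2 (dotProduct_self_pos hp0)).ne')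
      · exact h3 u (by simpa using hu) j hj

end Prog

end

section

/-! ### Polarization and independence of moments -/

section Polarization

variable {n : ℕ}

open MvPolynomial Finset

/-- A real polynomial that vanishes everywhere has zero coefficients. -/
theorem coeff_eq_zero_of_forall_sum {d : ℕ} {c : ℕ → ℝ}
    (h : ∀ t : ℝ, ∑ i ∈ range (d + 1), c i * t ^ i = 0) {i : ℕ} (hi : i ≤ d) : c i = 0 := by
  have hp : ∑ i ∈ range (d + 1), Polynomial.C (c i) * Polynomial.X ^ i = 0 :=
    Polynomial.funext fun t => by simpa [Polynomial.eval_finsetSum] using h t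
  have := congrArg (fun p => Polynomial.coeff p i) hp
  simp only [Polynomial.finsetSum_coeff, Polynomial.coeff_C_mul, Polynomial.coeff_X_pow,
    Polynomial.coeff_zero] at this
  rw [Finset.sum_eq_single i (fun j _ hj => by simp [hj.symm])
    (fun h => absurd (mem_range.2 (Nat.lt_succ_of_le hi)) h)] at this
  simpa using this

theorem map_smul_add_pow (φ : MvPolynomial (Fin n) ℝ →ₗ[ℝ] ℝ) (a b : MvPolynomial (Fin n) ℝ)
    (t : ℝ) (d : ℕ) :
    φ ((t • a + b) ^ d) = ∑ i ∈ range (d + 1), d.choose i * φ (a ^ i * b ^ (d - i)) * t ^ i := by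
  rw [add_pow, map_sum]
  refine Finset.sum_congr rfl fun i _ => ?_
  rw [smul_pow, smul_mul_assoc, smul_mul_assoc, map_smul, smul_eq_mul,
    ← nsmul_eq_mul', map_nsmul, nsmul_eq_mul]
  ring

/-- The induction step behind `polarization`: one factor at a time is split off, as the linear
coefficient in `t` of the `(e + 1)`-st power of `u + t v`. -/
theorem polarization_aux {W : Submodule ℝ (Vec ℝ n)} : ∀ (us : List (Vec ℝ n)) (e : ℕ)
    (φ : MvPolynomial (Fin n) ℝ →ₗ[ℝ] ℝ), (∀ u ∈ us, u ∈ W) →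
    (∀ u ∈ W, φ (linForm u ^ (e + us.length)) = 0) →
    ∀ u ∈ W, φ (linForm u ^ e * (us.map linForm).prod) = 0
  | [], e, φ, _, h, u, hu => by simpa using h u hu
  | v :: us, e, φ, hus, h, u, hu => by
    have ih := polarization_aux us (e + 1) φ (fun u hu => hus u (by simp [hu]))
      (fun u hu => by
        have := h u hu
        rwa [List.length_cons, Nat.add_comm us.length, ← Nat.add_assoc] at this)
    have key : ∀ t : ℝ, ∑ i ∈ range (e + 1 + 1), ((e + 1).choose i *
        (φ ∘ₗ LinearMap.mulRight ℝ (us.map linForm).prod)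
          (linForm v ^ i * linForm u ^ (e + 1 - i))) * t ^ i = 0 := by
      intro t
      rw [← map_smul_add_pow, ← map_smul, ← map_add]
      exact ih _ (W.add_mem (W.smul_mem _ (hus v (by simp))) hu)
    -- the coefficient of `t` is `e + 1` times the value in question
    have := coeff_eq_zero_of_forall_sum key (i := 1) (by omega)
    rw [Nat.choose_one_right, mul_eq_zero] at this
    have h2 := this.resolve_left (by positivity)
    rw [← h2]
    simp only [LinearMap.comp_apply, LinearMap.mulRight_apply, List.map_cons, List.prod_cons,
      Nat.add_sub_cancel, pow_one]
    congr 1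
    ring

/-- Polarization: a linear functional that vanishes at the `d`-th powers of the linear forms of a
subspace vanishes at the products of `d` of them. -/
theorem polarization {W : Submodule ℝ (Vec ℝ n)} {φ : MvPolynomial (Fin n) ℝ →ₗ[ℝ] ℝ}
    {us : List (Vec ℝ n)} (hus : ∀ u ∈ us, u ∈ W)
    (h : ∀ u ∈ W, φ (linForm u ^ us.length) = 0) : φ (us.map linForm).prod = 0 := by
  simpa using polarization_aux us 0 φ hus (by simpa using h) 0 W.zero_mem

/-- The functional `Λ` is multiplicative on products, of total degree at most `m`, of linear forms
from `X` with linear forms from `Y`. -/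
def MomentIndep (Lam : MvPolynomial (Fin n) ℝ →ₗ[ℝ] ℝ) (m : ℕ) (X Y : Set (Vec ℝ n)) : Prop :=
  ∀ as bs : List (Vec ℝ n), (∀ a ∈ as, a ∈ X) → (∀ b ∈ bs, b ∈ Y) → as.length + bs.length ≤ m →
    Lam ((as.map linForm).prod * (bs.map linForm).prod) =
      Lam (as.map linForm).prod * Lam (bs.map linForm).prod

variable {Lam : MvPolynomial (Fin n) ℝ →ₗ[ℝ] ℝ} {m : ℕ}

theorem MomentIndep.symm {X Y : Set (Vec ℝ n)} (h : MomentIndep Lam m X Y) :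
    MomentIndep Lam m Y X := fun as bs ha hb hl => by
  rw [mul_comm, h bs as hb ha (by omega), mul_comm]

theorem MomentIndep.mono {X Y X' Y' : Set (Vec ℝ n)} (h : MomentIndep Lam m X Y)
    (hX : X' ⊆ X) (hY : Y' ⊆ Y) : MomentIndep Lam m X' Y' :=
  fun as bs ha hb => h as bs (fun a h => hX (ha a h)) fun b h => hY (hb b h)

theorem covWith_comm (p q : MvPolynomial (Fin n) ℝ) :
    Prog.covWith Lam p q = Prog.covWith Lam q p := by
  rw [Prog.covWith_apply, Prog.covWith_apply, mul_comm, mul_comm (Lam p)]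

/-- Multiplicativity on powers of the linear forms of two subspaces suffices: the mixed monomials
are the coefficients in `t` of the moments in direction `t a + b`, and products of different linear
forms are obtained by polarization in each of the two subspaces. -/
theorem momentIndep_of_pow {W₁ W₂ : Submodule ℝ (Vec ℝ n)}
    (h : ∀ a ∈ W₁, ∀ b ∈ W₂, ∀ j ≤ m, Lam (linForm (a + b) ^ j) = ∑ i ∈ range (j + 1),
      j.choose i * (Lam (linForm a ^ i) * Lam (linForm b ^ (j - i)))) :
    MomentIndep Lam m W₁ W₂ := by
  have hpow : ∀ i e, i + e ≤ m → ∀ a ∈ W₁, ∀ b ∈ W₂,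
      Prog.covWith Lam (linForm b ^ e) (linForm a ^ i) = 0 := by
    intro i e hie a ha b hb
    have key : ∀ t : ℝ, ∑ s ∈ range (i + e + 1), ((i + e).choose s *
        (Lam (linForm a ^ s * linForm b ^ (i + e - s)) -
          Lam (linForm a ^ s) * Lam (linForm b ^ (i + e - s)))) * t ^ s = 0 := by
      intro t
      have h1 := h (t • a) (W₁.smul_mem _ ha) b hb (i + e) hie
      rw [map_add, map_smul, map_smul_add_pow] at h1
      simp only [mul_sub, sub_mul, Finset.sum_sub_distrib]
      rw [h1, sub_eq_zero]
      refine Finset.sum_congr rfl fun s _ => ?_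
      rw [smul_pow, map_smul, smul_eq_mul]
      ring
    have := coeff_eq_zero_of_forall_sum key (i := i) (by omega)
    rw [Nat.add_sub_cancel_left, mul_eq_zero] at this
    rw [Prog.covWith_apply]
    refine this.resolve_left ?_
    exact_mod_cast (Nat.choose_pos (by omega)).ne'
  intro as bs ha hb hl
  have h1 : ∀ b ∈ W₂, Prog.covWith Lam (as.map linForm).prod (linForm b ^ bs.length) = 0 := by
    intro b hb
    rw [covWith_comm]
    exact polarization ha fun a ha => hpow _ _ hl a ha b hb
  have h2 := polarization hb h1
  rw [covWith_comm, Prog.covWith_apply] at h2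
  exact sub_eq_zero.1 h2

theorem MomentIndep.pow_eq {X Y : Set (Vec ℝ n)} (h : MomentIndep Lam m X Y) {a b : Vec ℝ n}
    (ha : a ∈ X) (hb : b ∈ Y) {j : ℕ} (hj : j ≤ m) :
    Lam (linForm (a + b) ^ j) = ∑ i ∈ range (j + 1),
      j.choose i * (Lam (linForm a ^ i) * Lam (linForm b ^ (j - i))) := by
  have h1 := map_smul_add_pow Lam (linForm a) (linForm b) 1 j
  rw [one_smul, ← map_add] at h1
  rw [h1]
  refine Finset.sum_congr rfl fun i hi => ?_
  have hi' := mem_range.1 hi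
  have := h (List.replicate i a) (List.replicate (j - i) b)
    (fun x hx => by rw [(List.mem_replicate.1 hx).2]; exact ha)
    (fun x hx => by rw [(List.mem_replicate.1 hx).2]; exact hb) (by simp; omega)
  simp only [List.map_replicate, List.prod_replicate] at this
  rw [this]
  ring

theorem map_prod_eq_zero_of_span {X : Set (Vec ℝ n)} : ∀ (us : List (Vec ℝ n))
    (φ : MvPolynomial (Fin n) ℝ →ₗ[ℝ] ℝ),
    (∀ vs : List (Vec ℝ n), (∀ v ∈ vs, v ∈ X) → vs.length = us.length →
      φ (vs.map linForm).prod = 0) →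
    (∀ u ∈ us, u ∈ Submodule.span ℝ X) → φ (us.map linForm).prod = 0
  | [], φ, h, _ => by simpa using h [] (by simp) rfl
  | u :: us, φ, h, hus => by
    have hx : ∀ x ∈ X, φ (linForm x * (us.map linForm).prod) = 0 := by
      intro x hx
      have := map_prod_eq_zero_of_span us (φ ∘ₗ LinearMap.mulLeft ℝ (linForm x)) (by
        intro vs hvs hl
        simpa using h (x :: vs) (by simpa using ⟨hx, hvs⟩) (by simp [hl]))
        (fun u hu => hus u (by simp [hu]))
      simpa using this
    rw [List.map_cons, List.prod_cons]
    refine Submodule.span_induction (p := fun u _ => φ (linForm u * (us.map linForm).prod) = 0)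
      hx (by simp) ?_ ?_ (hus u (by simp))
    · intro x y _ _ hx hy
      rw [map_add, add_mul, map_add, hx, hy, add_zero]
    · intro c x _ hx
      rw [map_smul, smul_mul_assoc, map_smul, hx, smul_zero]

theorem MomentIndep.span {X Y : Set (Vec ℝ n)} (h : MomentIndep Lam m X Y) :
    MomentIndep Lam m (Submodule.span ℝ X) (Submodule.span ℝ Y) := by
  intro as bs ha hb hl
  rw [← sub_eq_zero, ← Prog.covWith_apply]
  refine map_prod_eq_zero_of_span as _ (fun as' ha' hl' => ?_) ha
  rw [covWith_comm]
  refine map_prod_eq_zero_of_span bs _ (fun bs' hb' hl'' => ?_) hb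
  rw [covWith_comm, Prog.covWith_apply, sub_eq_zero]
  exact h as' bs' ha' hb' (by omega)

end Polarization

/-! ### Gaussian moments -/

section Gaussian

variable {n : ℕ}

open Finset

theorem gaussianMoment_odd {j : ℕ} (hj : ¬ Even j) : gaussianMoment j = 0 := if_neg hj

theorem gaussianMoment_even (i : ℕ) :
    gaussianMoment (2 * i) * (2 ^ i * i.factorial) = (2 * i).factorial := by
  rw [gaussianMoment, if_pos (even_two_mul i)]
  rcases i with _ | i
  · rfl
  · have h := Nat.factorial_eq_mul_doubleFactorial (2 * i + 1)
    rw [show 2 * i + 1 + 1 = 2 * (i + 1) by ring, Nat.doubleFactorial_two_mul] at h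
    rw [h, show 2 * (i + 1) - 1 = 2 * i + 1 by omega]
    ring

/-- The identity that turns the even part of the binomial expansion of order `2h` with Gaussian
moments into the expansion of the `h`-th power of the sum of the variances. -/
theorem gaussianMoment_choose {h i : ℕ} (hi : i ≤ h) :
    ((2 * h).choose (2 * i) : ℝ) * (gaussianMoment (2 * i) * gaussianMoment (2 * (h - i))) =
      gaussianMoment (2 * h) * h.choose i := by
  have e : ∀ i, (gaussianMoment (2 * i) : ℝ) = (2 * i).factorial / (2 ^ i * i.factorial) := by
    intro i
    rw [eq_div_iff (by positivity)]
    exact_mod_cast gaussianMoment_even i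
  rw [Nat.cast_choose ℝ (show 2 * i ≤ 2 * h by omega), Nat.cast_choose ℝ hi, e, e, e,
    show 2 * h - 2 * i = 2 * (h - i) by omega]
  have h2 : (2 : ℝ) ^ h = 2 ^ i * 2 ^ (h - i) := by rw [← pow_add]; congr 1; omega
  rw [h2]
  field_simp

theorem sum_range_even {f : ℕ → ℝ} (hf : ∀ i, ¬ Even i → f i = 0) (h : ℕ) :
    ∑ i ∈ range (2 * h + 1), f i = ∑ i ∈ range (h + 1), f (2 * i) := by
  induction h with
  | zero => simp
  | succ h ih =>
    rw [show 2 * (h + 1) + 1 = 2 * h + 1 + 1 + 1 by ring, sum_range_succ, sum_range_succ, ih,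
      sum_range_succ _ (h + 1), hf (2 * h + 1) (by simp), add_zero]
    ring_nf

/-- The `j`-th moment of a centered Gaussian variable of variance `x`. -/
noncomputable def gaussPow (j : ℕ) (x : ℝ) : ℝ := gaussianMoment j * x ^ (j / 2)

/-- The moments of the sum of two independent centered Gaussian variables. -/
theorem gaussPow_add (j : ℕ) (x y : ℝ) : gaussPow j (x + y) =
    ∑ i ∈ range (j + 1), j.choose i * (gaussPow i x * gaussPow (j - i) y) := by
  by_cases hj : Even j
  · obtain ⟨h, rfl⟩ := hj
    rw [← two_mul, sum_range_even]
    · rw [gaussPow, Nat.mul_div_cancel_left h two_pos, add_pow, Finset.mul_sum]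
      refine Finset.sum_congr rfl fun i hi => ?_
      have hi' : i ≤ h := by have := mem_range.1 hi; omega
      rw [gaussPow, gaussPow, show 2 * h - 2 * i = 2 * (h - i) by omega,
        Nat.mul_div_cancel_left _ two_pos, Nat.mul_div_cancel_left _ two_pos]
      linear_combination -(x ^ i * y ^ (h - i)) * gaussianMoment_choose hi'
    · intro i hi
      simp [gaussPow, gaussianMoment_odd hi]
  · rw [gaussPow, gaussianMoment_odd hj, Nat.cast_zero, zero_mul]
    refine (Finset.sum_eq_zero fun i hi => ?_).symm
    by_cases hi' : Even i
    · have : ¬ Even (j - i) := by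
        have h1 := mem_range.1 hi
        intro h2
        apply hj
        have := hi'.add h2
        rwa [Nat.add_sub_cancel' (by omega)] at this
      simp [gaussPow, gaussianMoment_odd this]
    · simp [gaussPow, gaussianMoment_odd hi']

/-- The difference between the `j`-th moment in direction `u` and the Gaussian one. -/
noncomputable def gaussGap (Lam : MvPolynomial (Fin n) ℝ →ₗ[ℝ] ℝ) (j : ℕ) (u : Vec ℝ n) : ℝ :=
  Lam (linForm u ^ j) - gaussPow j (u ⬝ᵥ u)

variable {Lam : MvPolynomial (Fin n) ℝ →ₗ[ℝ] ℝ} {m : ℕ}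

theorem dotProduct_add_self {p q : Vec ℝ n} (h : p ⬝ᵥ q = 0) :
    (p + q) ⬝ᵥ (p + q) = p ⬝ᵥ p + q ⬝ᵥ q := by
  rw [add_dotProduct, dotProduct_add, dotProduct_add, dotProduct_comm q p, h]
  ring

theorem gaussGap_smul (j : ℕ) (x : ℝ) (u : Vec ℝ n) :
    gaussGap Lam j (x • u) = x ^ j * gaussGap Lam j u := by
  have : gaussPow j ((x • u) ⬝ᵥ (x • u)) = x ^ j * gaussPow j (u ⬝ᵥ u) := by
    rw [smul_dotProduct, dotProduct_smul, smul_eq_mul, smul_eq_mul]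
    by_cases hj : Even j
    · obtain ⟨h, rfl⟩ := hj
      rw [← two_mul, gaussPow, gaussPow, Nat.mul_div_cancel_left h two_pos]
      ring
    · simp [gaussPow, gaussianMoment_odd hj]
  rw [gaussGap, gaussGap, this, map_smul, smul_pow, map_smul, smul_eq_mul]
  ring

/-- The first non-Gaussian moment is additive over independent orthogonal directions. -/
theorem gaussGap_add {X Y : Set (Vec ℝ n)} (h : MomentIndep Lam m X Y) (h1 : Lam 1 = 1)
    {p q : Vec ℝ n} (hp : p ∈ X) (hq : q ∈ Y) (hpq : p ⬝ᵥ q = 0) {j : ℕ} (hj : 1 ≤ j)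
    (hjm : j ≤ m) (hgp : ∀ i < j, gaussGap Lam i p = 0) (hgq : ∀ i < j, gaussGap Lam i q = 0) :
    gaussGap Lam j (p + q) = gaussGap Lam j p + gaussGap Lam j q := by
  have h0 : ∀ u : Vec ℝ n, Lam (linForm u ^ 0) = gaussPow 0 (u ⬝ᵥ u) := by
    intro u
    simp [gaussPow, gaussianMoment, h1]
  have hγ : ∀ x, gaussPow 0 x = 1 := by intro x; simp [gaussPow, gaussianMoment]
  rw [gaussGap, gaussGap, gaussGap, h.pow_eq hp hq hjm, dotProduct_add_self hpq, gaussPow_add,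
    ← Finset.sum_sub_distrib]
  obtain ⟨j, rfl⟩ : ∃ j', j = j' + 1 := ⟨j - 1, by omega⟩
  rw [sum_range_succ, sum_range_succ', Finset.sum_eq_zero]
  · rw [h0, Nat.sub_self, h0, hγ, hγ, Nat.choose_self, Nat.choose_zero_right, Nat.sub_zero]
    ring
  · intro i hi
    have hi' := mem_range.1 hi
    have e1 := sub_eq_zero.1 (hgp (i + 1) (by omega))
    have e2 := sub_eq_zero.1 (hgq (j + 1 - (i + 1)) (by omega))
    rw [e1, e2, sub_self]

/-- Directions with Gaussian moments are independent if they are orthogonal. -/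
theorem momentIndep_of_gaussGap {W₁ W₂ R : Submodule ℝ (Vec ℝ n)} (h₁ : W₁ ≤ R) (h₂ : W₂ ≤ R)
    (horth : ∀ a ∈ W₁, ∀ b ∈ W₂, a ⬝ᵥ b = 0) (hR : ∀ j ≤ m, ∀ u ∈ R, gaussGap Lam j u = 0) :
    MomentIndep Lam m W₁ W₂ := by
  refine momentIndep_of_pow fun a ha b hb j hj => ?_
  have e : ∀ i ≤ m, ∀ u ∈ R, Lam (linForm u ^ i) = gaussPow i (u ⬝ᵥ u) :=
    fun i hi u hu => sub_eq_zero.1 (hR i hi u hu)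
  rw [e j hj _ (R.add_mem (h₁ ha) (h₂ hb)), dotProduct_add_self (horth a ha b hb), gaussPow_add]
  refine Finset.sum_congr rfl fun i hi => ?_
  have hi' := mem_range.1 hi
  rw [e i (by omega) a (h₁ ha), e (j - i) (by omega) b (h₂ hb)]

end Gaussian

end

section

/-! ### Local optima of forms -/

variable {n : ℕ}

/-- A local maximum of `f` on the unit sphere of the orthogonal complement of `C` with value above
`c`, or a local minimum with value below `c`. -/
def FarOptimum (f : Vec ℝ n → ℝ) (c : ℝ) (C : List (Vec ℝ n)) (u : Vec ℝ n) : Prop :=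
  u ∈ sphereOrth C ∧ ((IsLocalMaxOn f (sphereOrth C) u ∧ c < f u) ∨
    (IsLocalMinOn f (sphereOrth C) u ∧ f u < c))

/-- Bernoulli's inequality for the exponent `j / 2`, at the point `x²`: the strict convexity of
`s ↦ s^{j/2}`. -/
theorem one_add_lt_pow {x : ℝ} (hx : 0 ≤ x) (hx1 : x ≠ 1) {j : ℕ} (hj : 3 ≤ j) :
    1 + (j / 2 : ℝ) * (x ^ 2 - 1) < x ^ j := by
  have hj' : (3 : ℝ) ≤ j := by exact_mod_cast hj
  have h := one_add_mul_self_lt_rpow_one_add (s := x ^ 2 - 1) (p := (j : ℝ) / 2)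
    (by nlinarith [sq_nonneg x]) (fun h => hx1 (by nlinarith)) (by linarith)
  have e : (1 + (x ^ 2 - 1)) ^ ((j : ℝ) / 2) = x ^ j := by
    rw [add_sub_cancel, ← Real.rpow_natCast, ← Real.rpow_natCast, ← Real.rpow_mul hx]
    congr 1
    push_cast
    ring
  rwa [e] at h

/-- If `p + q` is a local maximum of `D`, then at some point of the sphere on the way from `p + q`
towards `p`, where `p` is scaled up and `q` is scaled down, `D` is not larger. -/
theorem exists_scale_of_isLocalMaxOn {D : Vec ℝ n → ℝ} {C : List (Vec ℝ n)} {p q : Vec ℝ n}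
    (hp : p ≠ 0) (hq : q ≠ 0) (hpq : p ⬝ᵥ q = 0) (hpC : ∀ b ∈ C, b ⬝ᵥ p = 0)
    (hqC : ∀ b ∈ C, b ⬝ᵥ q = 0) (hu : p + q ∈ sphereOrth C)
    (hmax : IsLocalMaxOn D (sphereOrth C) (p + q)) :
    ∃ x y : ℝ, 1 < x ∧ 0 ≤ y ∧ y < 1 ∧ x ^ 2 * (p ⬝ᵥ p) + y ^ 2 * (q ⬝ᵥ q) = p ⬝ᵥ p + q ⬝ᵥ q ∧
      D (x • p + y • q) ≤ D (p + q) := by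
  have hP := dotProduct_self_pos hp
  have hQ := dotProduct_self_pos hq
  set P := p ⬝ᵥ p with hPdef
  set Q := q ⬝ᵥ q with hQdef
  have hPQ : P + Q = 1 := by
    have := hu.1
    rwa [dotProduct_add_self hpq] at this
  -- a path on the sphere along which the squared norms of the two components change linearly
  let γ : ℝ → Vec ℝ n := fun t => Real.sqrt (1 + t / P) • p + Real.sqrt (1 - t / Q) • q
  have hcont : Continuous γ := by fun_prop
  have hγ0 : γ 0 = p + q := by simp [γ]
  have hsq : ∀ t ∈ Set.Ioo 0 Q, Real.sqrt (1 + t / P) ^ 2 * P + Real.sqrt (1 - t / Q) ^ 2 * Q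
      = P + Q := by
    intro t ht
    have h1 : 0 ≤ 1 + t / P := by have := div_pos ht.1 hP; linarith
    have h2 : 0 ≤ 1 - t / Q := by have := (div_le_one hQ).2 ht.2.le; linarith
    rw [Real.sq_sqrt h1, Real.sq_sqrt h2]
    field_simp
    ring
  have hmem : ∀ t ∈ Set.Ioo 0 Q, γ t ∈ sphereOrth C := by
    intro t ht
    refine ⟨?_, fun b hb => ?_⟩
    · rw [dotProduct_add_self]
      · simp only [smul_dotProduct, dotProduct_smul, smul_eq_mul]
        have := hsq t ht
        rw [← hPdef, ← hQdef]
        nlinarith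
      · rw [smul_dotProduct, dotProduct_smul, hpq, smul_zero, smul_zero]
    · simp only [γ, dotProduct_add, dotProduct_smul, hpC b hb, hqC b hb, smul_zero, add_zero]
  have hev : ∀ᶠ w in nhdsWithin (γ 0) (sphereOrth C), D w ≤ D (p + q) := by
    rw [hγ0]; exact hmax
  have htend : Filter.Tendsto γ (nhdsWithin 0 (Set.Ioo 0 Q)) (nhdsWithin (γ 0) (sphereOrth C)) :=
    tendsto_nhdsWithin_iff.2 ⟨(hcont.tendsto 0).mono_left nhdsWithin_le_nhds,
      eventually_nhdsWithin_of_forall hmem⟩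
  have hne : (nhdsWithin (0 : ℝ) (Set.Ioo 0 Q)).NeBot := by
    rw [nhdsWithin_Ioo_eq_nhdsGT hQ]
    infer_instance
  obtain ⟨t, ht1, ht2⟩ := ((htend.eventually hev).and self_mem_nhdsWithin).exists
  refine ⟨_, _, ?_, Real.sqrt_nonneg _, ?_, hsq t ht2, ht1⟩
  · rw [Real.lt_sqrt zero_le_one]
    have := div_pos ht2.1 hP
    linarith
  · rw [Real.sqrt_lt' one_pos]
    have := div_pos ht2.1 hQ
    linarith

/-- A local maximum with positive value of a function of the form `x^j α + y^j β`, where `j ≥ 3`,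
does not lie between `p` and `q`: since `(s, t) ↦ s^{j/2} α + t^{j/2} β` is strictly convex for
`α, β > 0`, the value increases when moving towards the end with the larger value. -/
theorem not_isLocalMaxOn_of_pow {D : Vec ℝ n → ℝ} {C : List (Vec ℝ n)} {p q : Vec ℝ n}
    (hp : p ≠ 0) (hq : q ≠ 0) (hpq : p ⬝ᵥ q = 0) (hpC : ∀ b ∈ C, b ⬝ᵥ p = 0)
    (hqC : ∀ b ∈ C, b ⬝ᵥ q = 0) (hu : p + q ∈ sphereOrth C) {j : ℕ} (hj : 3 ≤ j)
    (hD : ∀ x y : ℝ, D (x • p + y • q) = x ^ j * D p + y ^ j * D q) (hpos : 0 < D (p + q)) :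
    ¬ IsLocalMaxOn D (sphereOrth C) (p + q) := by
  have hP := dotProduct_self_pos hp
  have hQ := dotProduct_self_pos hq
  -- the case in which `p` is the end with the larger value relative to its squared norm
  have key : ∀ {P Q α β x y : ℝ}, 0 < P → 0 < Q → 0 < α + β → β * P ≤ α * Q → 1 < x → 0 ≤ y →
      y < 1 → x ^ 2 * P + y ^ 2 * Q = P + Q → α + β < x ^ j * α + y ^ j * β := by
    intro P Q α β x y hP hQ hsum hle hx hy hy1 he
    have hα : 0 < α := by
      by_contra h
      have h1 : β * P ≤ 0 := hle.trans (mul_nonpos_of_nonpos_of_nonneg (by linarith) hQ.le)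
      have h2 : β ≤ 0 := by
        by_contra h'
        have := mul_pos (not_le.1 h') hP
        linarith
      linarith
    have hxj : 1 + (j / 2 : ℝ) * (x ^ 2 - 1) < x ^ j := one_add_lt_pow (by linarith) hx.ne' hj
    have hyj : 1 + (j / 2 : ℝ) * (y ^ 2 - 1) < y ^ j := one_add_lt_pow hy hy1.ne hj
    rcases le_or_gt β 0 with hβ | hβ
    · have h1 : 1 < x ^ j := one_lt_pow₀ hx (by omega)
      have h2 : y ^ j ≤ 1 := pow_le_one₀ hy hy1.le
      nlinarith
    · have h1 : (x ^ 2 - 1) * P = (1 - y ^ 2) * Q := by linarith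
      have h2 : 0 ≤ α * (x ^ 2 - 1) + β * (y ^ 2 - 1) := by
        have h3 : 0 ≤ (1 - y ^ 2) * (α * Q - β * P) :=
          mul_nonneg (by nlinarith) (by linarith)
        have h4 : 0 ≤ (α * (x ^ 2 - 1) + β * (y ^ 2 - 1)) * P := by nlinarith
        exact nonneg_of_mul_nonneg_left h4 hP
      have hj' : (0 : ℝ) ≤ j / 2 := by positivity
      nlinarith [mul_lt_mul_of_pos_right hxj hα, mul_lt_mul_of_pos_right hyj hβ,
        mul_nonneg hj' h2]
  intro hmax
  have hDu : D (p + q) = D p + D q := by simpa using hD 1 1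
  rw [hDu] at hpos
  rcases le_total (D q * (p ⬝ᵥ p)) (D p * (q ⬝ᵥ q)) with hle | hle
  · obtain ⟨x, y, hx, hy, hy1, he, hle'⟩ :=
      exists_scale_of_isLocalMaxOn hp hq hpq hpC hqC hu hmax
    rw [hD, hDu] at hle'
    exact absurd hle' (not_le.2 (key hP hQ hpos hle hx hy hy1 he))
  · rw [add_comm] at hu hmax
    obtain ⟨x, y, hx, hy, hy1, he, hle'⟩ := exists_scale_of_isLocalMaxOn hq hp
      (by rw [dotProduct_comm, hpq]) hqC hpC hu hmax
    rw [add_comm, hD, add_comm q, hDu] at hle'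
    have := key hQ hP (by linarith) hle hx hy hy1 he
    linarith

/-- Both kinds of optimum are local maxima with positive value, of `f - c` or of `c - f`. -/
theorem FarOptimum.exists_isLocalMaxOn {f D : Vec ℝ n → ℝ} {c : ℝ} {C : List (Vec ℝ n)}
    {u : Vec ℝ n} (h : FarOptimum f c C u) (hf : ∀ w ∈ sphereOrth C, f w = D w + c) :
    (IsLocalMaxOn D (sphereOrth C) u ∧ 0 < D u) ∨
      (IsLocalMaxOn (-D) (sphereOrth C) u ∧ 0 < (-D) u) := by
  obtain ⟨hu, ⟨h1, h2⟩ | ⟨h1, h2⟩⟩ := h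
  · refine Or.inl ⟨?_, by rw [hf u hu] at h2; linarith⟩
    filter_upwards [h1, self_mem_nhdsWithin] with w hw hwC
    rw [hf w hwC, hf u hu] at hw
    linarith
  · refine Or.inr ⟨?_, by rw [hf u hu] at h2; simp only [Pi.neg_apply]; linarith⟩
    filter_upwards [h1, self_mem_nhdsWithin] with w hw hwC
    rw [hf w hwC, hf u hu] at hw
    simp only [Pi.neg_apply]
    linarith

/-- The local optima of a form that splits into a function of the component `p` and a function of
the component `q` lie in one of the two parts. -/
theorem FarOptimum.eq_zero_or_eq_zero {f D : Vec ℝ n → ℝ} {c : ℝ} {C : List (Vec ℝ n)}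
    {p q : Vec ℝ n} (h : FarOptimum f c C (p + q)) (hf : ∀ w ∈ sphereOrth C, f w = D w + c)
    (hpq : p ⬝ᵥ q = 0) (hpC : ∀ b ∈ C, b ⬝ᵥ p = 0) (hqC : ∀ b ∈ C, b ⬝ᵥ q = 0) {j : ℕ}
    (hj : 3 ≤ j) (hD : ∀ x y : ℝ, D (x • p + y • q) = x ^ j * D p + y ^ j * D q) :
    p = 0 ∨ q = 0 := by
  by_contra! h0
  rcases h.exists_isLocalMaxOn hf with ⟨h1, h2⟩ | ⟨h1, h2⟩
  · exact not_isLocalMaxOn_of_pow h0.1 h0.2 hpq hpC hqC h.1 hj hD h2 h1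
  · refine not_isLocalMaxOn_of_pow h0.1 h0.2 hpq hpC hqC h.1 hj (fun x y => ?_) h2 h1
    simp only [Pi.neg_apply, hD]
    ring

/-- A function that depends on the component in direction `p` only has its local optima with
nonzero value at `± p / ‖p‖`. -/
theorem FarOptimum.right_eq_zero {f D : Vec ℝ n → ℝ} {c : ℝ} {C : List (Vec ℝ n)}
    {p q : Vec ℝ n} (h : FarOptimum f c C (p + q)) (hf : ∀ w ∈ sphereOrth C, f w = D w + c)
    (hpq : p ⬝ᵥ q = 0) (hpC : ∀ b ∈ C, b ⬝ᵥ p = 0) (hqC : ∀ b ∈ C, b ⬝ᵥ q = 0) {d : ℕ}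
    (hd : 1 ≤ d) (hD : ∀ x y : ℝ, D (x • p + y • q) = x ^ d * D p) : q = 0 := by
  by_contra hq
  have key : ∀ E : Vec ℝ n → ℝ, (∀ x y : ℝ, E (x • p + y • q) = x ^ d * E p) →
      IsLocalMaxOn E (sphereOrth C) (p + q) → ¬ 0 < E (p + q) := by
    intro E hE hmax hpos
    have hEu : E (p + q) = E p := by simpa using hE 1 1
    have hp : p ≠ 0 := by
      rintro rfl
      have h2 := hE 0 1
      simp only [zero_smul, one_smul, zero_pow (by omega : d ≠ 0), zero_mul] at h2
      rw [h2] at hpos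
      exact lt_irrefl _ hpos
    obtain ⟨x, y, hx, -, -, -, hle⟩ := exists_scale_of_isLocalMaxOn hp hq hpq hpC hqC h.1 hmax
    rw [hE, hEu] at hle
    rw [hEu] at hpos
    nlinarith [one_lt_pow₀ hx (by omega : d ≠ 0)]
  rcases h.exists_isLocalMaxOn hf with ⟨h1, h2⟩ | ⟨h1, h2⟩
  · exact key D hD h1 h2
  · refine key (-D) (fun x y => ?_) h1 h2
    simp only [Pi.neg_apply, hD]
    ring

end

section

/-! ### The identity test -/

section

variable {n : ℕ}

/-- The homogeneous polynomial `G(v, …, v) - c ‖v‖^d` evaluated by the identity test. -/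
noncomputable def testGap {d : ℕ} (G : Tensor ℝ n d) (c : ℕ) (v : Vec ℝ n) : ℝ :=
  Tensor.form G v - c * (v ⬝ᵥ v) ^ (d / 2)

theorem Tensor.form_smul {d : ℕ} (G : Tensor ℝ n d) (s : ℝ) (v : Vec ℝ n) :
    Tensor.form G (s • v) = s ^ d * Tensor.form G v := by
  simp only [Tensor.form, Pi.smul_apply, smul_eq_mul, Finset.prod_mul_distrib, Finset.prod_const,
    Finset.card_univ, Fintype.card_fin, Finset.mul_sum]
  refine Finset.sum_congr rfl fun a _ => ?_
  ring

theorem testGap_smul {d : ℕ} {G : Tensor ℝ n d} {c : ℕ} (hc : ¬ Even d → c = 0) (s : ℝ)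
    (v : Vec ℝ n) : testGap G c (s • v) = s ^ d * testGap G c v := by
  rw [testGap, testGap, Tensor.form_smul, smul_dotProduct, dotProduct_smul, smul_eq_mul,
    smul_eq_mul]
  by_cases hd : Even d
  · obtain ⟨h, hh⟩ := hd
    have hs : s ^ d = (s * s) ^ h := by rw [hh]; ring
    rw [show d / 2 = h by omega, hs]
    ring
  · simp [hc hd]

theorem testGap_zero {d : ℕ} {G : Tensor ℝ n d} {c : ℕ} (hd : 1 ≤ d) (hc : ¬ Even d → c = 0) :
    testGap G c 0 = 0 := by
  have := testGap_smul hc (G := G) 0 0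
  rwa [zero_smul, zero_pow (by omega), zero_mul] at this

theorem form_eq_testGap_add {d : ℕ} {G : Tensor ℝ n d} {c : ℕ} {C : List (Vec ℝ n)} :
    ∀ w ∈ sphereOrth C, Tensor.form G w = testGap G c w + c := fun w hw => by
  rw [testGap, hw.1]
  ring

theorem pos_of_testGap {d : ℕ} {G : Tensor ℝ n d} {c : ℕ} (hd : 1 ≤ d)
    (hc : ¬ Even d → c = 0) {v : Vec ℝ n} (h : testGap G c v ≠ 0) : 0 < v ⬝ᵥ v :=
  dotProduct_self_pos fun h0 => h (h0 ▸ testGap_zero hd hc)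

open MvPolynomial in
/-- The gap of the projection of `x`, as a polynomial in `x`. -/
theorem exists_mvPolynomial_testGap {d : ℕ} (G : Tensor ℝ n d) (c : ℕ) (C : List (Vec ℝ n)) :
    ∃ P : MvPolynomial (Fin n) ℝ, P.totalDegree ≤ d ∧
      ∀ x, eval x P = testGap G c (projOrth C x) := by
  obtain ⟨A, hA⟩ := exists_linearMap_projOrth C
  let L : Fin n → MvPolynomial (Fin n) ℝ := fun i =>
    ∑ j, MvPolynomial.C (A (Pi.single j 1) i) * X j
  have hLdeg : ∀ i, (L i).totalDegree ≤ 1 := fun i =>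
    totalDegree_finsetSum_le fun j _ => (totalDegree_mul _ _).trans (by simp)
  have hLeval : ∀ x i, eval x (L i) = projOrth C x i := by
    intro x i
    simp only [L, map_sum, map_mul, eval_C, eval_X, ← hA]
    conv_rhs => rw [← Finset.univ_sum_single x, map_sum, Finset.sum_apply]
    refine Finset.sum_congr rfl fun j _ => ?_
    rw [show (Pi.single j (x j) : Vec ℝ n) = x j • Pi.single j 1 by
      rw [← Pi.single_smul', smul_eq_mul, mul_one], map_smul, Pi.smul_apply, smul_eq_mul, mul_comm]
  refine ⟨∑ a : Fin d → Fin n, MvPolynomial.C (G a) * ∏ t, L (a t) -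
    MvPolynomial.C (c : ℝ) * (∑ i, L i * L i) ^ (d / 2), ?_, fun x => ?_⟩
  · refine (totalDegree_sub _ _).trans (max_le ?_ ?_)
    · refine totalDegree_finsetSum_le fun a _ => (totalDegree_mul _ _).trans ?_
      rw [totalDegree_C, zero_add]
      refine (totalDegree_finsetProd _ _).trans ?_
      exact (Finset.sum_le_sum fun t _ => hLdeg (a t)).trans (by simp)
    · refine (totalDegree_mul _ _).trans ?_
      rw [totalDegree_C, zero_add]
      refine (totalDegree_pow _ _).trans ?_
      have : (∑ i, L i * L i).totalDegree ≤ 2 := totalDegree_finsetSum_le fun i _ =>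
        (totalDegree_mul _ _).trans (Nat.add_le_add (hLdeg i) (hLdeg i))
      calc d / 2 * (∑ i, L i * L i).totalDegree ≤ d / 2 * 2 := Nat.mul_le_mul_left _ this
        _ ≤ d := Nat.div_mul_le_self d 2
  · simp only [map_sub, map_sum, map_mul, eval_C, map_prod, map_pow, hLeval]
    rfl

/-- At a uniformly random point of `{1, …, 2m}^n` a nonzero polynomial of degree at most `m`
vanishes with probability at most `1/2`. -/
theorem two_mul_card_zeros_le {m : ℕ} (hm : 1 ≤ m) {P : MvPolynomial (Fin n) ℝ} (hP : P ≠ 0)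
    (hdeg : P.totalDegree ≤ m) {S : Finset ℝ} (hS : S.card = 2 * m) :
    2 * ((Fintype.piFinset fun _ : Fin n => S).filter fun x => MvPolynomial.eval x P = 0).card ≤
      (2 * m) ^ n := by
  have h := MvPolynomial.schwartz_zippel_totalDegree hP S
  rw [hS] at h
  have h2 : ((P.totalDegree : ℚ≥0) / ((2 * m : ℕ) : ℚ≥0)) ≤ 1 / 2 := by
    rw [div_le_div_iff₀ (by positivity) (by positivity)]
    exact_mod_cast (by omega : P.totalDegree * 2 ≤ 1 * (2 * m))
  have h3 := h.trans h2
  rw [div_le_div_iff₀ (by positivity) (by positivity)] at h3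
  rw [mul_comm]
  exact_mod_cast h3.trans_eq (one_mul _)

end

namespace Prog

variable {n : ℕ} {M : List (Fin n) → ℝ} {O : LocalOptOracle n}

/-- A vector returned by the identity test is a local optimum on the side of `c` on which the test
found a value, since the oracle does not return anything worse than its starting point. -/
theorem ensures_findOptimum {N : ℕ} (hN : 2 ≤ N) (hn : n ≤ N) (hO : O.IsExact) {m d : ℕ}
    {G : Tensor ℝ n d} {c : ℕ} (hd : 1 ≤ d) (hc : ¬ Even d → c = 0) {C : List (Vec ℝ n)}
    (hC : OrthoList C) {K t : ℕ} (hK : C.length ≤ K)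
    (ht : K * (n * 4 + 1) + N ^ (3 * d) + n * 6 + d / 2 + 9 ≤ t) : ∀ r : ℕ,
    Ensures M O (findOptimum m G c C r) (r * t) fun o =>
      ∀ u, o = some u → FarOptimum (Tensor.form G) c C u
  | 0 => ensures_ret _ (by simp)
  | r + 1 => by
    have hCK : C.length * (n * 4 + 1) ≤ K * (n * 4 + 1) := Nat.mul_le_mul_right _ hK
    refine (ensures_tabulate (c := 1) fun _ => ensures_draw (2 * m)).bind'
      (c' := C.length * (n * 4 + 1) + (N ^ (3 * d) + ((n * 2 + 1) + ((d / 2 + 1) + (1 + (1 +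
        (1 + (1 + (n * 3 + 2 + (1 + r * t)))))))))) ?_ fun x _ => ?_
    · rw [Nat.succ_mul r t]; omega
    refine (ensures_project C x).bind ?_
    rintro _ rfl
    set v := projOrth C x with hv
    refine (ensures_evalTensor hN hn v d G).bind ?_
    rintro _ rfl
    refine (ensures_dot v v).bind ?_
    rintro _ rfl
    refine (ensures_power _ _).bind ?_
    rintro _ rfl
    refine (ensures_const c).bind ?_
    rintro _ rfl
    refine (ensures_mul _ _).bind ?_
    rintro _ rfl
    have hw : testGap G c v ≠ 0 → (Real.sqrt (v ⬝ᵥ v))⁻¹ • v ∈ sphereOrth C := fun h =>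
      normalize_mem_sphereOrth (fun h0 => h (h0 ▸ testGap_zero hd hc)) (projOrth_orth hC x)
    have hpos : testGap G c v ≠ 0 → 0 < (Real.sqrt (v ⬝ᵥ v))⁻¹ ^ d := fun h =>
      pow_pos (inv_pos.2 (Real.sqrt_pos.2 (pos_of_testGap hd hc h))) d
    refine (ensures_less _ _).bind fun b hb => ?_
    cases b with
    | true =>
      have hlt : 0 < testGap G c v := sub_pos.2 (hb.1 rfl)
      refine (ensures_normalize v).bind' (c' := 1 + 0) (by omega) ?_
      rintro _ rfl
      refine (ensures_localOpt _ _ _ _).bind ?_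
      rintro _ rfl
      refine ensures_pure _ ?_
      rintro _ ⟨⟩
      obtain ⟨h1, h2, h3⟩ := (hO d G C _ (hw hlt.ne')).1
      refine ⟨h1, Or.inl ⟨h2, lt_of_lt_of_le ?_ h3⟩⟩
      rw [form_eq_testGap_add (c := c) _ (hw hlt.ne'), testGap_smul hc]
      have := mul_pos (hpos hlt.ne') hlt
      linarith
    | false =>
      refine (ensures_less _ _).bind' (c' := n * 3 + 2 + (1 + r * t)) (by omega) fun b hb => ?_
      cases b with
      | true =>
        have hlt : testGap G c v < 0 := sub_neg.2 (hb.1 rfl)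
        refine (ensures_normalize v).bind' (c' := 1 + 0) (by omega) ?_
        rintro _ rfl
        refine (ensures_localOpt _ _ _ _).bind ?_
        rintro _ rfl
        refine ensures_pure _ ?_
        rintro _ ⟨⟩
        obtain ⟨h1, h2, h3⟩ := (hO d G C _ (hw hlt.ne)).2
        refine ⟨h1, Or.inr ⟨h2, lt_of_le_of_lt h3 ?_⟩⟩
        rw [form_eq_testGap_add (c := c) _ (hw hlt.ne), testGap_smul hc]
        have := mul_neg_of_pos_of_neg (hpos hlt.ne) hlt
        linarith
      | false => exact (ensures_findOptimum hN hn hO hd hc hC hK ht r).mono (by omega) fun _ => id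

/-- The identity test proceeds to the next trial only if the gap vanishes at the projection of the
random vector. -/
theorem expect_findOptimum_succ_le {m d : ℕ} {G : Tensor ℝ n d} {c : ℕ} {C : List (Vec ℝ n)}
    {r : ℕ} {φ : Option (Vec ℝ n) → ENNReal} (hφ : ∀ u, φ (some u) = 0) :
    expect M O (findOptimum m G c C (r + 1)) φ ≤
      expect M O (tabulate n fun _ => GenICA.draw (2 * m)) fun x =>
        if testGap G c (projOrth C x) = 0 then expect M O (findOptimum m G c C r) φ else 0 := by
  have hN : 2 ≤ max 2 n := le_max_left _ _
  rw [findOptimum, expect_bind]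
  refine (ensures_tabulate (c := 1) fun _ => ensures_draw (2 * m)).expect_mono fun x _ => ?_
  refine (ensures_project C x).expect_bind_le ?_
  rintro _ rfl
  set v := projOrth C x with hv
  refine (ensures_evalTensor hN (le_max_right _ _) v d G).expect_bind_le ?_
  rintro _ rfl
  refine (ensures_dot v v).expect_bind_le ?_
  rintro _ rfl
  refine (ensures_power _ _).expect_bind_le ?_
  rintro _ rfl
  refine (ensures_const c).expect_bind_le ?_
  rintro _ rfl
  refine (ensures_mul _ _).expect_bind_le ?_
  rintro _ rfl
  have hfound : ∀ b, expect M O (do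
      let w ← normalize v
      let u ← GenICA.localOpt b G C w
      return some u) φ ≤ 0 := fun b => by
    refine (ensures_normalize v).expect_bind_le fun w _ => ?_
    refine (ensures_localOpt _ _ _ _).expect_bind_le fun u _ => ?_
    exact (expect_ret _ _).le.trans (hφ u).le
  refine (ensures_less _ _).expect_bind_le fun b hb => ?_
  cases b with
  | true => exact (hfound true).trans zero_le
  | false =>
    refine (ensures_less _ _).expect_bind_le fun b' hb' => ?_
    cases b' with
    | true => exact (hfound false).trans zero_le
    | false =>
      have h1 : ¬ _ := fun h => Bool.false_ne_true (hb.2 h)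
      have h2 : ¬ _ := fun h => Bool.false_ne_true (hb'.2 h)
      have h0 : testGap G c v = 0 := sub_eq_zero.2 (le_antisymm (not_lt.1 h1) (not_lt.1 h2))
      rw [if_pos h0]
      exact le_rfl

/-- A true identity always passes the test. -/
theorem ensures_findOptimum_eq_none (hO : O.IsExact) {m d : ℕ} {G : Tensor ℝ n d} {c : ℕ}
    (hd : 1 ≤ d) (hc : ¬ Even d → c = 0) {C : List (Vec ℝ n)} (hC : OrthoList C)
    (h : ∀ v : Vec ℝ n, (∀ b ∈ C, b ⬝ᵥ v = 0) → testGap G c v = 0) (r : ℕ) :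
    ∃ t, Ensures M O (findOptimum m G c C r) t (· = none) := by
  refine ⟨_, (ensures_findOptimum (le_max_left 2 n) (le_max_right 2 n) hO hd hc hC le_rfl le_rfl
    r).mono le_rfl fun o ho => ?_⟩
  rcases o with _ | u
  · rfl
  · obtain ⟨hu, h'⟩ := ho u rfl
    rw [form_eq_testGap_add (c := c) u hu, h u hu.2, zero_add] at h'
    exact (h'.elim And.right And.right).false.elim

/-- Independent draws are uniformly distributed on a grid. -/
theorem expect_tabulate_draw {N : ℕ} (hN : 1 ≤ N) : ∀ (k : ℕ) (φ : (Fin k → ℝ) → ENNReal),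
    expect M O (tabulate k fun _ => GenICA.draw N) φ =
      ∑ x ∈ Fintype.piFinset fun _ : Fin k => (Finset.Icc 1 N).map Nat.castEmbedding,
        ((N : ENNReal)⁻¹) ^ k * φ x
  | 0, φ => by
    rw [tabulate, expect_ret, pow_zero, Finset.sum_eq_single Fin.elim0]
    · rw [one_mul]
    · intro x _ hx
      exact absurd (Subsingleton.elim _ _) hx
    · intro h
      exact absurd (Fintype.mem_piFinset.2 fun i => i.elim0) h
  | k + 1, φ => by
    rw [tabulate, expect_bind, expect_draw N hN]
    simp only [expect_bind, expect_tabulate_draw hN k]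
    have hpure : ∀ (z : ℝ) (x : Fin k → ℝ),
        expect M O (pure (Fin.cons z x) : Prog ℝ n (Fin (k + 1) → ℝ)) φ = φ (Fin.cons z x) :=
      fun z x => expect_ret _ _
    simp only [hpure, Finset.mul_sum]
    refine (Finset.sum_map (Finset.Icc 1 N) Nat.castEmbedding (fun z : ℝ =>
      ∑ x ∈ Fintype.piFinset fun _ : Fin k => (Finset.Icc 1 N).map Nat.castEmbedding,
        (N : ENNReal)⁻¹ * ((N : ENNReal)⁻¹ ^ k * φ (Fin.cons z x)))).symm.trans ?_
    rw [← Finset.sum_product']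
    refine Finset.sum_nbij' (fun p => Fin.cons p.1 p.2) (fun x => (x 0, Fin.tail x)) ?_ ?_ ?_ ?_ ?_
    · rintro ⟨z, x⟩ h
      rw [Finset.mem_product, Fintype.mem_piFinset] at h
      rw [Fintype.mem_piFinset]
      exact Fin.cases (by simpa using h.1) (fun i => by simpa using h.2 i)
    · intro x h
      rw [Fintype.mem_piFinset] at h
      rw [Finset.mem_product, Fintype.mem_piFinset]
      exact ⟨h 0, fun i => h i.succ⟩
    · rintro ⟨z, x⟩ _
      simp
    · intro x _
      simp
    · rintro ⟨z, x⟩ _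
      rw [pow_succ', mul_assoc]

/-- A false identity passes the test with `r` trials with probability at most `2^{-r}`. -/
theorem expect_findOptimum_none_le {m d : ℕ} (hdm : d ≤ m) (hm : 1 ≤ m) {G : Tensor ℝ n d} {c : ℕ}
    {C : List (Vec ℝ n)} {v : Vec ℝ n} (hv : ∀ b ∈ C, b ⬝ᵥ v = 0)
    (hgap : testGap G c v ≠ 0) {φ : Option (Vec ℝ n) → ENNReal} (hφ : ∀ u, φ (some u) = 0)
    (hφ' : φ none ≤ 1) (r : ℕ) :
    expect M O (findOptimum m G c C r) φ ≤ (2⁻¹ : ENNReal) ^ r := by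
  induction r with
  | zero => exact (expect_ret _ _).le.trans (by simpa using hφ')
  | succ r ih =>
    refine (expect_findOptimum_succ_le hφ).trans ?_
    obtain ⟨P, hPdeg, hPeval⟩ := exists_mvPolynomial_testGap G c C
    have hP : P ≠ 0 := by
      rintro rfl
      apply hgap
      rw [← projOrth_eq_self C hv, ← hPeval, map_zero]
    rw [expect_tabulate_draw (by omega)]
    set S : Finset ℝ := (Finset.Icc 1 (2 * m)).map Nat.castEmbedding with hS
    have hcard : S.card = 2 * m := by simp [hS]
    have hz := two_mul_card_zeros_le hm hP (hPdeg.trans hdm) hcard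
    set Z := (Fintype.piFinset fun _ : Fin n => S).filter fun x => MvPolynomial.eval x P = 0
    set b := expect M O (findOptimum m G c C r) φ
    have hsum : ∑ x ∈ Fintype.piFinset fun _ : Fin n => S, ((2 * m : ℕ) : ENNReal)⁻¹ ^ n *
        (if testGap G c (projOrth C x) = 0 then b else 0) =
        Z.card * (((2 * m : ℕ) : ENNReal)⁻¹ ^ n * b) := by
      simp only [← hPeval, mul_ite, mul_zero]
      rw [← Finset.sum_filter, Finset.sum_const, nsmul_eq_mul]
    rw [hsum]
    have hz' : (Z.card : ENNReal) ≤ 2⁻¹ * ((2 * m : ℕ) : ENNReal) ^ n := by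
      calc (Z.card : ENNReal) = 2⁻¹ * (2 * Z.card) := by
            rw [← mul_assoc, ENNReal.inv_mul_cancel two_ne_zero ENNReal.ofNat_ne_top, one_mul]
        _ ≤ 2⁻¹ * ((2 * m : ℕ) : ENNReal) ^ n := by
            gcongr
            exact_mod_cast hz
    have h0 : ((2 * m : ℕ) : ENNReal) ^ n ≠ 0 := by
      apply pow_ne_zero
      exact_mod_cast (by omega : 2 * m ≠ 0)
    have htop : ((2 * m : ℕ) : ENNReal) ^ n ≠ ⊤ := ENNReal.pow_ne_top (ENNReal.natCast_ne_top _)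
    calc (Z.card : ENNReal) * (((2 * m : ℕ) : ENNReal)⁻¹ ^ n * b)
        ≤ 2⁻¹ * ((2 * m : ℕ) : ENNReal) ^ n * (((2 * m : ℕ) : ENNReal)⁻¹ ^ n * 2⁻¹ ^ r) := by
          gcongr
      _ = 2⁻¹ * (((2 * m : ℕ) : ENNReal) ^ n * (((2 * m : ℕ) : ENNReal) ^ n)⁻¹) * 2⁻¹ ^ r := by
          rw [ENNReal.inv_pow]
          ring
      _ = 2⁻¹ ^ (r + 1) := by
          rw [ENNReal.mul_inv_cancel h0 htop, mul_one, pow_succ']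

/-- One test of a false identity costs failure probability `2^{-r}`, on top of the failure
probability of what follows when a local optimum is found. -/
theorem expect_findOptimum_le (hO : O.IsExact) {m d : ℕ} (hd : 1 ≤ d) (hdm : d ≤ m)
    {G : Tensor ℝ n d} {c : ℕ} (hc : ¬ Even d → c = 0) {C : List (Vec ℝ n)} (hC : OrthoList C)
    {v : Vec ℝ n} (hv : ∀ b ∈ C, b ⬝ᵥ v = 0) (hgap : testGap G c v ≠ 0) {r : ℕ}
    {χ : Option (Vec ℝ n) → ENNReal} {a : ENNReal} (hnone : χ none ≤ 1)
    (hsome : ∀ u, FarOptimum (Tensor.form G) c C u → χ (some u) ≤ a) :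
    expect M O (findOptimum m G c C r) χ ≤ (2⁻¹ : ENNReal) ^ r + a := by
  have h1 := expect_findOptimum_none_le (M := M) (O := O) hdm (hd.trans hdm) hv hgap
    (φ := fun o => o.elim 1 fun _ => 0) (fun _ => rfl) le_rfl r
  refine le_trans ?_ (add_le_add_left h1 a)
  rw [← expect_const (findOptimum m G c C r) a, ← expect_add]
  refine (ensures_findOptimum (le_max_left 2 n) (le_max_right 2 n) hO hd hc hC le_rfl le_rfl
    r).expect_mono fun o ho => ?_
  rcases o with _ | u
  · exact hnone.trans (le_add_of_nonneg_right zero_le)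
  · exact (hsome u (ho u rfl)).trans (le_add_of_nonneg_left zero_le)

/-- When the elements of a list are tried in turn and those with property `P` certainly pass, the
risk is that of the first element without `P`. A failure to recognize it is counted as a failure of
the whole, so that the later elements do not add to the risk. -/
theorem expect_firstSome_le {β γ : Type} {f : β → Prog ℝ n (Option γ)} {P : β → Prop}
    {ψ : Option γ → ENNReal} {a : ENNReal} (hψ : ∀ o, ψ o ≤ 1) : ∀ l : List β,
    (∀ b ∈ l, P b → ∃ t, Ensures M O (f b) t (· = none)) →
    (∀ b ∈ l, ¬ P b → expect M O (f b) (fun o => o.elim 1 fun u => ψ (some u)) ≤ a) →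
    ((∀ b ∈ l, P b) → ψ none ≤ a) → expect M O (firstSome l f) ψ ≤ a
  | [], _, _, h => (expect_ret _ _).le.trans (h (by simp))
  | b :: l, hpass, hfail, hnone => by
    refine ensures_tick.expect_bind_le fun _ _ => ?_
    by_cases hb : P b
    · obtain ⟨t, ht⟩ := hpass b (by simp) hb
      refine ht.expect_bind_le ?_
      rintro _ rfl
      exact expect_firstSome_le hψ l (fun b hb => hpass b (by simp [hb]))
        (fun b hb => hfail b (by simp [hb])) fun h => hnone (by simpa using ⟨hb, h⟩)
    · rw [expect_bind]
      refine le_trans ?_ (hfail b (by simp) hb)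
      refine expect_mono _ fun o => ?_
      rcases o with _ | u
      · exact expect_le hψ
      · exact (expect_ret _ _).le

end Prog

end

section

variable {n : ℕ}

/-! ### Moments that factor over a pair of subspaces -/

/-- `V` and `W` are orthogonal complements of each other, and `Λ` is multiplicative over them up to
degree `m`. -/
structure Factors (Lam : MvPolynomial (Fin n) ℝ →ₗ[ℝ] ℝ) (m : ℕ) (V W : Submodule ℝ (Vec ℝ n)) :
    Prop where
  indep : MomentIndep Lam m V W
  orth : ∀ p ∈ V, ∀ q ∈ W, p ⬝ᵥ q = 0
  decomp : ∀ u, ∃ p ∈ V, ∃ q ∈ W, u = p + q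

/-- The moments of order at most two are those of an isotropic probability distribution. -/
structure IsoMoments (Lam : MvPolynomial (Fin n) ℝ →ₗ[ℝ] ℝ) : Prop where
  one : Lam 1 = 1
  mean : ∀ u, Lam (linForm u) = 0
  cov : ∀ u v, Lam (linForm u * linForm v) = u ⬝ᵥ v

variable {Lam : MvPolynomial (Fin n) ℝ →ₗ[ℝ] ℝ} {m : ℕ} {V W : Submodule ℝ (Vec ℝ n)}

theorem Factors.symm (h : Factors Lam m V W) : Factors Lam m W V where
  indep := h.indep.symm
  orth p hp q hq := by rw [dotProduct_comm]; exact h.orth q hq p hp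
  decomp u := by
    obtain ⟨p, hp, q, hq, rfl⟩ := h.decomp u
    exact ⟨q, hq, p, hp, add_comm _ _⟩

theorem Factors.finrank_add (h : Factors Lam m V W) :
    Module.finrank ℝ V + Module.finrank ℝ W = n := by
  have hinf : V ⊓ W = ⊥ := by
    rw [Submodule.eq_bot_iff]
    rintro x ⟨hx1, hx2⟩
    exact dotProduct_self_eq_zero.1 (h.orth x hx1 x hx2)
  have hsup : V ⊔ W = ⊤ := by
    rw [Submodule.eq_top_iff']
    intro u
    obtain ⟨p, hp, q, hq, rfl⟩ := h.decomp u
    exact Submodule.add_mem_sup hp hq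
  have := Submodule.finrank_sup_add_finrank_inf_eq V W
  rw [hinf, hsup, finrank_bot, finrank_top, add_zero] at this
  simpa using this.symm

/-- If every vector of `C` lies in `V` or in `W`, then the components in `V` and in `W` of a vector of
`C^⊥` lie in `C^⊥`. -/
theorem Factors.orth_components (h : Factors Lam m V W) {C : List (Vec ℝ n)}
    (hC : ∀ b ∈ C, b ∈ V ∨ b ∈ W) {p q : Vec ℝ n} (hp : p ∈ V) (hq : q ∈ W)
    (hu : ∀ b ∈ C, b ⬝ᵥ (p + q) = 0) : (∀ b ∈ C, b ⬝ᵥ p = 0) ∧ ∀ b ∈ C, b ⬝ᵥ q = 0 := by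
  have key : ∀ b ∈ C, b ⬝ᵥ p = 0 ∧ b ⬝ᵥ q = 0 := by
    intro b hb
    have h1 := hu b hb
    rw [dotProduct_add] at h1
    rcases hC b hb with h2 | h2
    · have := h.orth b h2 q hq
      exact ⟨by linarith, this⟩
    · have := h.symm.orth b h2 p hp
      exact ⟨this, by linarith⟩
  exact ⟨fun b hb => (key b hb).1, fun b hb => (key b hb).2⟩

theorem IsoMoments.gaussGap (h : IsoMoments Lam) {j : ℕ} (hj : j ≤ 2) (u : Vec ℝ n) :
    gaussGap Lam j u = 0 := by
  interval_cases j
  · simp [GenICA.gaussGap, gaussPow, gaussianMoment, h.one]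
  · simp [GenICA.gaussGap, gaussPow, gaussianMoment, h.mean]
  · simp [GenICA.gaussGap, gaussPow, gaussianMoment, pow_two, h.cov]

theorem gaussGap_zero (h : IsoMoments Lam) (j : ℕ) : gaussGap Lam j (0 : Vec ℝ n) = 0 := by
  rcases Nat.lt_or_ge 2 j with hj | hj
  · have := gaussGap_smul (Lam := Lam) j 0 (0 : Vec ℝ n)
    rwa [zero_smul, zero_pow (by omega), zero_mul] at this
  · exact h.gaussGap hj 0

theorem testGap_tensorOf (j : ℕ) (u : Vec ℝ n) :
    testGap (Prog.tensorOf Lam j) (gaussianMoment j) u = gaussGap Lam j u := by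
  rw [testGap, Prog.form_tensorOf]
  rfl

theorem testGap_tensorOf_cov (q : MvPolynomial (Fin n) ℝ) (d : ℕ) (u : Vec ℝ n) :
    testGap (Prog.tensorOf (Prog.covWith Lam q) d) 0 u = Prog.covWith Lam q (linForm u ^ d) := by
  rw [testGap, Prog.form_tensorOf, Nat.cast_zero, zero_mul, sub_zero]

/-- The local optima of the first non-Gaussian moment lie in `V` or in `W`. -/
theorem Factors.mem_of_farOptimum (h : Factors Lam m V W) (hiso : IsoMoments Lam)
    {C : List (Vec ℝ n)} (hC : ∀ b ∈ C, b ∈ V ∨ b ∈ W) {j : ℕ} (hj : 3 ≤ j) (hjm : j ≤ m)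
    (hg : ∀ i < j, ∀ u : Vec ℝ n, (∀ b ∈ C, b ⬝ᵥ u = 0) → gaussGap Lam i u = 0) {u : Vec ℝ n}
    (hu : FarOptimum (Tensor.form (Prog.tensorOf Lam j)) (gaussianMoment j) C u) :
    u ∈ V ∨ u ∈ W := by
  obtain ⟨p, hp, q, hq, rfl⟩ := h.decomp u
  obtain ⟨hpC, hqC⟩ := h.orth_components hC hp hq hu.1.2
  have hscale : ∀ {w : Vec ℝ n} (x : ℝ), (∀ b ∈ C, b ⬝ᵥ w = 0) → ∀ b ∈ C, b ⬝ᵥ (x • w) = 0 :=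
    fun x hw b hb => by rw [dotProduct_smul, hw b hb, smul_zero]
  rcases hu.eq_zero_or_eq_zero (D := gaussGap Lam j) (fun w hw => by
      rw [form_eq_testGap_add (c := gaussianMoment j) w hw, testGap_tensorOf]) (h.orth p hp q hq)
      hpC hqC hj (fun x y => by
        rw [gaussGap_add h.indep hiso.one (V.smul_mem x hp) (W.smul_mem y hq)
          (h.orth _ (V.smul_mem x hp) _ (W.smul_mem y hq)) (by omega) hjm
          (fun i hi => hg i hi _ (hscale x hpC)) (fun i hi => hg i hi _ (hscale y hqC)),
          gaussGap_smul, gaussGap_smul]) with h0 | h0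
  · exact Or.inr (by rwa [h0, zero_add])
  · exact Or.inl (by rwa [h0, add_zero])

theorem Factors.covWith_pow_add (h : Factors Lam m V W) {vs : List (Vec ℝ n)}
    (hvs : ∀ v ∈ vs, v ∈ V) {p q : Vec ℝ n} (hp : p ∈ V) (hq : q ∈ W) {d : ℕ}
    (hd : d + vs.length ≤ m) :
    Prog.covWith Lam (vs.map linForm).prod (linForm (p + q) ^ d) =
      ∑ i ∈ Finset.range (d + 1), d.choose i *
        (Prog.covWith Lam (vs.map linForm).prod (linForm p ^ i) * Lam (linForm q ^ (d - i))) := by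
  have h1 := map_smul_add_pow (Prog.covWith Lam (vs.map linForm).prod) (linForm p) (linForm q) 1 d
  rw [one_smul, ← map_add] at h1
  rw [h1]
  refine Finset.sum_congr rfl fun i hi => ?_
  have hi' := Finset.mem_range.1 hi
  have h2 := h.indep (List.replicate i p ++ vs) (List.replicate (d - i) q)
    (fun x hx => by
      rcases List.mem_append.1 hx with hx | hx
      · rw [(List.mem_replicate.1 hx).2]; exact hp
      · exact hvs x hx)
    (fun x hx => by rw [(List.mem_replicate.1 hx).2]; exact hq) (by simp; omega)
  have h3 := h.indep (List.replicate i p) (List.replicate (d - i) q)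
    (fun x hx => by rw [(List.mem_replicate.1 hx).2]; exact hp)
    (fun x hx => by rw [(List.mem_replicate.1 hx).2]; exact hq) (by simp; omega)
  simp only [List.map_append, List.prod_append, List.map_replicate, List.prod_replicate] at h2 h3
  rw [Prog.covWith_apply, Prog.covWith_apply, h3, mul_right_comm (linForm p ^ i), h2]
  ring

/-- The powers of the linear forms of `C^⊥` are uncorrelated with the products of linear forms of
`S`, up to total degree `j`. -/
def Uncorrelated (Lam : MvPolynomial (Fin n) ℝ →ₗ[ℝ] ℝ) (S C : List (Vec ℝ n)) (j : ℕ) : Prop :=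
  ∀ vs : List (Vec ℝ n), (∀ v ∈ vs, v ∈ S) → ∀ d, d + vs.length ≤ j →
    ∀ u : Vec ℝ n, (∀ b ∈ C, b ⬝ᵥ u = 0) →
      Prog.covWith Lam (vs.map linForm).prod (linForm u ^ d) = 0

theorem covWith_one_right (h1 : Lam 1 = 1) (q : MvPolynomial (Fin n) ℝ) :
    Prog.covWith Lam q 1 = 0 := by
  rw [Prog.covWith_apply, h1, one_mul, one_mul, sub_self]

theorem IsoMoments.uncorrelated (h : IsoMoments Lam) {S C : List (Vec ℝ n)}
    (hSC : ∀ v ∈ S, v ∈ C) : Uncorrelated Lam S C 2 := by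
  intro vs hvs d hd u hu
  rcases vs with _ | ⟨v, vs⟩
  · rw [List.map_nil, List.prod_nil, covWith_comm, covWith_one_right h.one]
  rcases d with _ | d
  · rw [pow_zero, covWith_one_right h.one]
  rw [List.length_cons] at hd
  obtain rfl : vs = [] := List.eq_nil_of_length_eq_zero (by omega)
  obtain rfl : d = 0 := by simp at hd; omega
  rw [Prog.covWith_apply, List.map_cons, List.map_nil, List.prod_cons, List.prod_nil, mul_one,
    zero_add, pow_one, h.cov, h.mean, zero_mul, sub_zero, dotProduct_comm,
    hu v (hSC v (hvs v (by simp)))]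

/-- The local optima of the first nonzero correlation with vectors of `V` lie in `V`. -/
theorem Factors.mem_left_of_farOptimum (h : Factors Lam m V W) (hiso : IsoMoments Lam)
    {S C : List (Vec ℝ n)} (hC : ∀ b ∈ C, b ∈ V ∨ b ∈ W) (hS : ∀ v ∈ S, v ∈ V)
    {vs : List (Vec ℝ n)} (hvs : ∀ v ∈ vs, v ∈ S) {d j : ℕ} (hd : 1 ≤ d)
    (hdj : d + vs.length ≤ j + 1) (hjm : j + 1 ≤ m) (hun : Uncorrelated Lam S C j) {u : Vec ℝ n}
    (hu : FarOptimum (Tensor.form (Prog.tensorOf (Prog.covWith Lam (vs.map linForm).prod) d))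
      (0 : ℕ) C u) : u ∈ V := by
  obtain ⟨p, hp, q, hq, rfl⟩ := h.decomp u
  obtain ⟨hpC, hqC⟩ := h.orth_components hC hp hq hu.1.2
  have hq0 : q = 0 := by
    refine hu.right_eq_zero
      (D := fun u => Prog.covWith Lam (vs.map linForm).prod (linForm u ^ d)) (fun w hw => by
      rw [form_eq_testGap_add (c := 0) w hw, testGap_tensorOf_cov]) (h.orth p hp q hq)
      hpC hqC hd fun x y => ?_
    rw [h.covWith_pow_add (fun v hv => hS v (hvs v hv)) (V.smul_mem x hp) (W.smul_mem y hq)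
      (by omega), Finset.sum_range_succ, Finset.sum_eq_zero, zero_add, Nat.choose_self,
      Nat.sub_self, pow_zero, hiso.one, map_smul, smul_pow, map_smul, smul_eq_mul, Nat.cast_one,
      one_mul, mul_one]
    intro i hi
    have hi' := Finset.mem_range.1 hi
    rw [hun vs hvs i (by omega) (x • p) fun b hb => by rw [dotProduct_smul, hpC b hb, smul_zero],
      zero_mul, mul_zero]
  rwa [hq0, add_zero]

/-! ### FindBasis -/

/-- The outcome of a run of FindBasis without failures. -/
structure GoodBasis (Lam : MvPolynomial (Fin n) ℝ →ₗ[ℝ] ℝ) (m : ℕ) (V W : Submodule ℝ (Vec ℝ n))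
    (B : List (Vec ℝ n)) : Prop where
  ortho : OrthoList B
  mem : ∀ b ∈ B, b ∈ V ∨ b ∈ W
  gauss : ∀ j ≤ m, ∀ u : Vec ℝ n, (∀ b ∈ B, b ⬝ᵥ u = 0) → gaussGap Lam j u = 0

open Classical in
/-- A bound for the conditional probability of failure after FindBasis: every further vector that
can be found is at risk of being overlooked with probability `ε`. -/
noncomputable def basisRisk (Lam : MvPolynomial (Fin n) ℝ →ₗ[ℝ] ℝ) (m : ℕ)
    (V W : Submodule ℝ (Vec ℝ n)) (ε : ENNReal) (B : List (Vec ℝ n)) : ENNReal :=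
  if GoodBasis Lam m V W B then (n - B.length : ℕ) * ε else 1

theorem natCast_sub_mul_le_one {ε : ENNReal} (hε : (n : ENNReal) * ε ≤ 1) (i : ℕ) :
    ((n - i : ℕ) : ENNReal) * ε ≤ 1 :=
  le_trans (by gcongr; exact Nat.sub_le n i) hε

namespace Prog

variable {M : List (Fin n) → ℝ} {O : LocalOptOracle n}

/-- The measure `μ` decreases in every iteration, since `B` or `j` grows. -/
theorem ensures_findBasis {N : ℕ} (hN : 2 ≤ N) (hn : n ≤ N) (hO : O.IsExact)
    (hM : ∀ is, M is = Lam (is.map MvPolynomial.X).prod) {r t T : ℕ}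
    (ht : n * (n * 4 + 1) + N ^ (3 * m) + n * 6 + m + 9 ≤ t) (hT : 1 + N ^ m + r * t ≤ T) :
    ∀ (μ : ℕ) (B : List (Vec ℝ n)) (j : ℕ), n - B.length + (m + 1 - j) ≤ μ → 2 ≤ j →
      OrthoList B → Ensures M O (findBasis m r B j) (μ * T) OrthoList := by
  intro μ
  induction μ with
  | zero =>
    intro B j hμ hj hB
    rw [findBasis, dif_neg (by omega)]
    exact ensures_ret _ hB
  | succ μ ih =>
    intro B j hμ hj hB
    rw [findBasis]
    split_ifs with h
    · refine ensures_tick.bind' (c' := n ^ j + (r * t + μ * T)) ?_ fun _ _ => ?_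
      · have : n ^ j ≤ N ^ m :=
          (Nat.pow_le_pow_left hn j).trans (Nat.pow_le_pow_right (by omega) h.2)
        rw [Nat.succ_mul μ T]
        omega
      refine (ensures_momentTensor hM j).bind ?_
      rintro _ rfl
      have hpow : N ^ (3 * j) ≤ N ^ (3 * m) := Nat.pow_le_pow_right (by omega) (by omega)
      refine (ensures_findOptimum (K := n) (t := t) hN hn hO (by omega) gaussianMoment_odd hB
        hB.length_le_dim (by omega) r).bind fun o ho => ?_
      rcases o with _ | u
      · exact ih B (j + 1) (by omega) (by omega) hB
      · exact ih (B ++ [u]) j (by simp; omega) hj (hB.concat (ho u rfl).1)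
    · exact ensures_ret _ hB

/-- The risk does not grow in expectation during FindBasis: an iteration in which the moment of
order `j` is Gaussian is free of risk, and one in which it is not has risk `2^{-r}` and, if the test
succeeds, uses up one of the `n - |B|` missing vectors. -/
theorem expect_findBasis_le (hO : O.IsExact)
    (hM : ∀ is, M is = Lam (is.map MvPolynomial.X).prod) (hF : Factors Lam m V W)
    (hiso : IsoMoments Lam) {r : ℕ} (hε : (n : ENNReal) * 2⁻¹ ^ r ≤ 1) :
    ∀ (μ : ℕ) (B : List (Vec ℝ n)) (j : ℕ), n - B.length + (m + 1 - j) ≤ μ → 2 ≤ j →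
      OrthoList B → (∀ b ∈ B, b ∈ V ∨ b ∈ W) →
      (∀ i < j, ∀ u : Vec ℝ n, (∀ b ∈ B, b ⬝ᵥ u = 0) → gaussGap Lam i u = 0) →
      expect M O (findBasis m r B j) (basisRisk Lam m V W (2⁻¹ ^ r)) ≤
        (n - B.length : ℕ) * 2⁻¹ ^ r := by
  have hle1 : ∀ B, basisRisk Lam m V W (2⁻¹ ^ r) B ≤ 1 := by
    intro B
    rw [basisRisk]
    split_ifs
    exacts [natCast_sub_mul_le_one hε _, le_rfl]
  have hend : ∀ (B : List (Vec ℝ n)) (j : ℕ), ¬ (B.length < n ∧ j ≤ m) →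
      OrthoList B → (∀ b ∈ B, b ∈ V ∨ b ∈ W) →
      (∀ i < j, ∀ u : Vec ℝ n, (∀ b ∈ B, b ⬝ᵥ u = 0) → gaussGap Lam i u = 0) →
      expect M O (.ret B) (basisRisk Lam m V W (2⁻¹ ^ r)) ≤ (n - B.length : ℕ) * 2⁻¹ ^ r := by
    intro B j h hB hmem hg
    have hgood : GoodBasis Lam m V W B := by
      refine ⟨hB, hmem, fun i hi u hu => ?_⟩
      rcases Nat.lt_or_ge i j with hij | hij
      · exact hg i hij u hu
      · have hlen : B.length = n := le_antisymm hB.length_le_dim (by omega)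
        rw [hB.eq_zero_of_orth (W := ⊤) (by simp) (by simpa using hlen) (by simp) hu,
          gaussGap_zero hiso]
    rw [expect_ret, basisRisk, if_pos hgood]
  intro μ
  induction μ with
  | zero =>
    intro B j hμ hj hB hmem hg
    rw [findBasis, dif_neg (by omega)]
    exact hend B j (by omega) hB hmem hg
  | succ μ ih =>
    intro B j hμ hj hB hmem hg
    rw [findBasis]
    split_ifs with h
    · refine ensures_tick.expect_bind_le fun _ _ => ?_
      refine (ensures_momentTensor hM j).expect_bind_le ?_
      rintro _ rfl
      by_cases hid : ∀ v : Vec ℝ n, (∀ b ∈ B, b ⬝ᵥ v = 0) → gaussGap Lam j v = 0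
      · obtain ⟨t, ht⟩ := ensures_findOptimum_eq_none (M := M) (m := m) hO
          (G := tensorOf Lam j) (c := gaussianMoment j) (by omega) gaussianMoment_odd hB
          (fun v hv => (testGap_tensorOf j v).trans (hid v hv)) r
        refine ht.expect_bind_le ?_
        rintro _ rfl
        refine ih B (j + 1) (by omega) (by omega) hB hmem fun i hi u hu => ?_
        rcases Nat.lt_succ_iff_lt_or_eq.1 hi with hi | rfl
        · exact hg i hi u hu
        · exact hid u hu
      · push Not at hid
        obtain ⟨v, hv, hne⟩ := hid
        have hj3 : 3 ≤ j := by
          by_contra hlt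
          exact hne (hiso.gaussGap (by omega) v)
        rw [expect_bind]
        refine (expect_findOptimum_le (a := ((n - (B.length + 1) : ℕ) : ENNReal) * 2⁻¹ ^ r)
          hO (by omega) h.2 gaussianMoment_odd hB hv ((testGap_tensorOf j v).trans_ne hne)
          (expect_le hle1) fun u hu => ?_).trans_eq ?_
        · refine (ih (B ++ [u]) j (by simp; omega) hj (hB.concat hu.1) ?_ ?_).trans_eq (by simp)
          · intro b hb
            rcases List.mem_append.1 hb with hb | hb
            · exact hmem b hb
            · rw [List.mem_singleton.1 hb]
              exact hF.mem_of_farOptimum hiso hmem hj3 h.2 hg hu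
          · exact fun i hi w hw => hg i hi w fun b hb => hw b (by simp [hb])
        · obtain ⟨s, hs⟩ : ∃ s, n - B.length = s + 1 := ⟨n - B.length - 1, by omega⟩
          rw [show n - (B.length + 1) = s by omega, hs]
          push_cast
          ring
    · exact hend B j h hB hmem hg

end Prog

end

section

/-! ### ExtendBasis -/

theorem mem_tuples {β : Type} {S : List β} : ∀ {l : ℕ} {vs : List β},
    vs ∈ tuples S l ↔ vs.length = l ∧ ∀ v ∈ vs, v ∈ S
  | 0, vs => by
    rw [tuples, List.mem_singleton, List.length_eq_zero_iff]
    exact ⟨fun h => ⟨h, by simp [h]⟩, fun h => h.1⟩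
  | l + 1, vs => by
    simp only [tuples, List.mem_flatMap, List.mem_map, mem_tuples]
    constructor
    · rintro ⟨v, hv, ws, ⟨rfl, h⟩, rfl⟩
      exact ⟨rfl, by simpa using ⟨hv, h⟩⟩
    · rintro ⟨hl, h⟩
      rcases vs with _ | ⟨v, ws⟩
      · simp at hl
      · exact ⟨v, h v (by simp), ws, ⟨by simpa using hl, fun w hw => h w (by simp [hw])⟩, rfl⟩

theorem length_tuples {β : Type} (S : List β) (l : ℕ) :
    (tuples S l).length = S.length ^ l := by
  induction l with
  | zero => rfl
  | succ l ih =>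
    simp [tuples, List.length_flatMap, ih, pow_succ']

theorem length_choices_le {β : Type} {S : List β} {N m j : ℕ} (hS : S.length ≤ N) (hN : 1 ≤ N)
    (hj : j ≤ m) :
    ((List.range' 1 (j - 1)).flatMap fun l => tuples S l).length ≤ m * N ^ m := by
  rw [List.length_flatMap]
  refine (List.sum_le_card_nsmul _ (N ^ m) ?_).trans ?_
  · intro x hx
    obtain ⟨l, hl, rfl⟩ := List.mem_map.1 hx
    rw [length_tuples]
    rw [List.mem_range'_1] at hl
    exact (Nat.pow_le_pow_left hS l).trans (Nat.pow_le_pow_right hN (by omega))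
  · rw [List.length_map, List.length_range', smul_eq_mul]
    exact Nat.mul_le_mul_right _ (by omega)

theorem mem_choices {β : Type} {S : List β} {j : ℕ} {vs : List β} :
    (vs ∈ (List.range' 1 (j - 1)).flatMap fun l => tuples S l) ↔
      1 ≤ vs.length ∧ vs.length < j ∧ ∀ v ∈ vs, v ∈ S := by
  simp only [List.mem_flatMap, List.mem_range'_1, mem_tuples]
  constructor
  · rintro ⟨l, hl, rfl, h⟩
    exact ⟨hl.1, by omega, h⟩
  · rintro ⟨h1, h2, h3⟩
    exact ⟨_, ⟨h1, by omega⟩, rfl, h3⟩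

variable {n : ℕ} {Lam : MvPolynomial (Fin n) ℝ →ₗ[ℝ] ℝ} {m : ℕ} {V W : Submodule ℝ (Vec ℝ n)}

/-- The outcome of a run of ExtendBasis`(S, T)` without failures, for `S ⊂ V` and `T ⊂ W`. -/
structure GoodExtension (Lam : MvPolynomial (Fin n) ℝ →ₗ[ℝ] ℝ) (m : ℕ)
    (V : Submodule ℝ (Vec ℝ n)) (T S S' : List (Vec ℝ n)) : Prop where
  ortho : OrthoList (S' ++ T)
  mem : ∀ v ∈ S', v ∈ V
  subset : ∀ v ∈ S, v ∈ S'
  full_or : S'.length = Module.finrank ℝ V ∨ Uncorrelated Lam S' (S' ++ T) m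

open Classical in
/-- A bound for the conditional probability of failure after ExtendBasis: every further vector that
can be found is at risk of being overlooked with probability `ε`. -/
noncomputable def extensionRisk (Lam : MvPolynomial (Fin n) ℝ →ₗ[ℝ] ℝ) (m : ℕ)
    (V : Submodule ℝ (Vec ℝ n)) (T S : List (Vec ℝ n)) (ε : ENNReal) (S' : List (Vec ℝ n)) :
    ENNReal :=
  if GoodExtension Lam m V T S S' then (n - (S' ++ T).length : ℕ) * ε else 1

theorem GoodExtension.of_concat {T S S' : List (Vec ℝ n)} {u : Vec ℝ n}
    (h : GoodExtension Lam m V T (S ++ [u]) S') : GoodExtension Lam m V T S S' where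
  ortho := h.ortho
  mem := h.mem
  subset v hv := h.subset v (by simp [hv])
  full_or := h.full_or

namespace Prog

variable {M : List (Fin n) → ℝ} {O : LocalOptOracle n}

/-- Each vector that is added to `S` resets `j`, so there are at most `m` iterations per vector. -/
theorem ensures_extendBasis {N : ℕ} (hN : 2 ≤ N) (hn : n ≤ N) (hO : O.IsExact)
    (hM : ∀ is, M is = Lam (is.map MvPolynomial.X).prod) {r t T cap : ℕ} (hm : 1 ≤ m)
    (hcap : cap ≤ n) (ht : n * (n * 4 + 1) + N ^ (3 * m) + n * 6 + m + 9 ≤ t)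
    (hT : 1 + m * N ^ m * (N ^ (3 * m) + N ^ m * (N ^ (3 * m) + 3) + r * t + 1) ≤ T)
    (C : List (Vec ℝ n)) :
    ∀ (μ : ℕ) (S : List (Vec ℝ n)) (j : ℕ), (cap - S.length) * m + (m + 1 - j) ≤ μ →
      OrthoList (S ++ C) →
      Ensures M O (extendBasis m r cap C S j) (μ * T) fun S' => OrthoList (S' ++ C) := by
  intro μ
  induction μ with
  | zero =>
    intro S j hμ hS
    have hnot : ¬ (S.length < cap ∧ j ≤ m) := by omega
    rw [extendBasis, dif_neg hnot]
    exact ensures_ret _ hS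
  | succ μ ih =>
    intro S j hμ hS
    have hlen := hS.length_le_dim
    rw [List.length_append] at hlen
    rw [extendBasis]
    split_ifs with h
    · set choices := (List.range' 1 (j - 1)).flatMap fun l => tuples S l with hch
      set K := N ^ (3 * m) + N ^ m * (N ^ (3 * m) + 3) + r * t with hK
      have hlenc : choices.length ≤ m * N ^ m := length_choices_le (by omega) (by omega) h.2
      refine ensures_tick.bind' (c' := choices.length * (K + 1) + μ * T) ?_ fun _ _ => ?_
      · have := Nat.mul_le_mul_right (K + 1) hlenc
        rw [Nat.succ_mul μ T]
        omega
      refine (ensures_firstSome (Q := fun o => ∀ u, o = some u → u ∈ sphereOrth (S ++ C))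
        (by simp) fun vs hvs => ?_).bind fun o ho => ?_
      · rw [hch, mem_choices] at hvs
        have h3 : N ^ (3 * vs.length) ≤ N ^ (3 * m) :=
          Nat.pow_le_pow_right (by omega) (by omega)
        have h4 : n ^ (j - vs.length) ≤ N ^ m :=
          (Nat.pow_le_pow_left hn _).trans (Nat.pow_le_pow_right (by omega) (by omega))
        have h5 : N ^ (3 * (j - vs.length)) ≤ N ^ (3 * m) :=
          Nat.pow_le_pow_right (by omega) (by omega)
        refine ((ensures_correlationTensor hN hn hM _ vs).bind (c' := r * t) ?_).mono ?_
          fun _ => id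
        · rintro _ rfl
          exact (ensures_findOptimum (K := n) hN hn hO (by omega) (fun _ => rfl) hS
            hS.length_le_dim (by omega) r).mono le_rfl fun o ho u hu => (ho u hu).1
        · have := Nat.mul_le_mul h4 (Nat.add_le_add_right h3 3)
          omega
      · rcases o with _ | u
        · exact ih S (j + 1) (by omega) hS
        · refine ih (S ++ [u]) 3 ?_ (hS.insert (ho u rfl))
          obtain ⟨a, ha⟩ : ∃ a, cap - S.length = a + 1 := ⟨cap - S.length - 1, by omega⟩
          rw [ha, Nat.succ_mul] at hμ
          have ha' : cap - (S ++ [u]).length = a := by simp; omega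
          rw [ha']
          omega
    · exact ensures_ret _ hS

/-- The risk does not grow in expectation during ExtendBasis, as for FindBasis. An iteration in
which all correlations of order `j` vanish is free of risk and establishes the invariant for `j`;
after a new vector the invariant is known up to order `2`, by isotropy. -/
theorem expect_extendBasis_le (hO : O.IsExact)
    (hM : ∀ is, M is = Lam (is.map MvPolynomial.X).prod) (hF : Factors Lam m V W)
    (hiso : IsoMoments Lam) {r : ℕ} (hε : (n : ENNReal) * 2⁻¹ ^ r ≤ 1)
    {C : List (Vec ℝ n)} (hC : ∀ b ∈ C, b ∈ W) {cap : ℕ} (hcap : cap = Module.finrank ℝ V)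
    (hm : 1 ≤ m) :
    ∀ (μ : ℕ) (S : List (Vec ℝ n)) (j : ℕ), (cap - S.length) * m + (m + 1 - j) ≤ μ → 2 ≤ j →
      OrthoList (S ++ C) → (∀ v ∈ S, v ∈ V) → Uncorrelated Lam S (S ++ C) (j - 1) →
      expect M O (extendBasis m r cap C S j) (extensionRisk Lam m V C S (2⁻¹ ^ r)) ≤
        (n - (S ++ C).length : ℕ) * 2⁻¹ ^ r := by
  have hle1 : ∀ S S', extensionRisk Lam m V C S (2⁻¹ ^ r) S' ≤ 1 := by
    intro S S'
    rw [extensionRisk]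
    split_ifs
    exacts [natCast_sub_mul_le_one hε _, le_rfl]
  have hanti : ∀ S u S', extensionRisk Lam m V C S (2⁻¹ ^ r) S' ≤
      extensionRisk Lam m V C (S ++ [u]) (2⁻¹ ^ r) S' := by
    intro S u S'
    by_cases h : GoodExtension Lam m V C (S ++ [u]) S'
    · rw [extensionRisk, extensionRisk, if_pos h, if_pos h.of_concat]
    · exact (hle1 S S').trans_eq (by rw [extensionRisk, if_neg h])
  have hend : ∀ (S : List (Vec ℝ n)) (j : ℕ), ¬ (S.length < cap ∧ j ≤ m) →
      OrthoList (S ++ C) → (∀ v ∈ S, v ∈ V) → Uncorrelated Lam S (S ++ C) (j - 1) →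
      expect M O (.ret S) (extensionRisk Lam m V C S (2⁻¹ ^ r)) ≤
        (n - (S ++ C).length : ℕ) * 2⁻¹ ^ r := by
    intro S j h hS hSV hun
    have hgood : GoodExtension Lam m V C S S := by
      refine ⟨hS, hSV, fun _ => id, ?_⟩
      rcases Nat.lt_or_ge S.length cap with h1 | h1
      · exact Or.inr fun vs hvs d hd => hun vs hvs d (by omega)
      · exact Or.inl (le_antisymm ((orthoList_append.1 hS).1.length_le V hSV) (hcap ▸ h1))
    rw [expect_ret, extensionRisk, if_pos hgood]
  intro μ
  induction μ with
  | zero =>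
    intro S j hμ hj hS hSV hun
    have hnot : ¬ (S.length < cap ∧ j ≤ m) := by omega
    rw [extendBasis, dif_neg hnot]
    exact hend S j hnot hS hSV hun
  | succ μ ih =>
    intro S j hμ hj hS hSV hun
    rw [extendBasis]
    split_ifs with h
    · have hmemC : ∀ b ∈ S ++ C, b ∈ V ∨ b ∈ W := fun b hb =>
        (List.mem_append.1 hb).imp (hSV b) (hC b)
      have hlt : (S ++ C).length < n := by
        have h1 := (orthoList_append.1 hS).2.1.length_le W hC
        have h2 := hF.finrank_add
        rw [List.length_append]
        omega
      refine ensures_tick.expect_bind_le fun _ _ => ?_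
      rw [expect_bind]
      refine expect_firstSome_le (P := fun vs => ∀ u : Vec ℝ n, (∀ b ∈ S ++ C, b ⬝ᵥ u = 0) →
        covWith Lam (vs.map linForm).prod (linForm u ^ (j - vs.length)) = 0)
        (fun o => expect_le (hle1 S)) _ ?_ ?_ ?_
      · intro vs hvs hP
        rw [mem_choices] at hvs
        obtain ⟨t, ht⟩ := ensures_findOptimum_eq_none (M := M) (m := m) hO
          (G := tensorOf (covWith Lam (vs.map linForm).prod) (j - vs.length)) (c := 0)
          (by omega) (fun _ => rfl) hS
          (fun v hv => (testGap_tensorOf_cov _ _ v).trans (hP v hv)) r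
        refine ⟨_, (ensures_correlationTensor (le_max_left 2 n) (le_max_right 2 n) hM _ vs).bind
          (c' := t) ?_⟩
        rintro _ rfl
        exact ht
      · intro vs hvs hP
        rw [mem_choices] at hvs
        push Not at hP
        obtain ⟨v, hv, hne⟩ := hP
        refine (ensures_correlationTensor (le_max_left 2 n) (le_max_right 2 n) hM _
          vs).expect_bind_le ?_
        rintro _ rfl
        refine (expect_findOptimum_le (a := ((n - ((S ++ C).length + 1) : ℕ) : ENNReal) * 2⁻¹ ^ r)
          hO (by omega) (by omega) (fun _ => rfl) hS hv
          ((testGap_tensorOf_cov _ _ v).trans_ne hne) le_rfl fun u hu => ?_).trans_eq ?_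
        · have huV : u ∈ V := hF.mem_left_of_farOptimum hiso hmemC hSV hvs.2.2 (j := j - 1)
            (by omega) (by omega) (by omega) hun hu
          have hS' := hS.insert hu.1
          refine ((expect_mono _ (hanti S u)).trans
            (ih (S ++ [u]) 3 ?_ (by omega) hS' ?_ ?_)).trans_eq ?_
          · obtain ⟨a, ha⟩ : ∃ a, cap - S.length = a + 1 := ⟨cap - S.length - 1, by omega⟩
            rw [ha, Nat.succ_mul] at hμ
            have ha' : cap - (S ++ [u]).length = a := by simp; omega
            rw [ha']
            omega
          · intro b hb
            rcases List.mem_append.1 hb with hb | hb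
            · exact hSV b hb
            · rwa [List.mem_singleton.1 hb]
          · exact hiso.uncorrelated fun v hv => List.mem_append_left _ hv
          · have : (S ++ [u] ++ C).length = (S ++ C).length + 1 := by simp; omega
            rw [this]
        · obtain ⟨s, hs⟩ : ∃ s, n - (S ++ C).length = s + 1 :=
            ⟨n - (S ++ C).length - 1, by omega⟩
          rw [show n - ((S ++ C).length + 1) = s by omega, hs]
          push_cast
          ring
      · intro hP
        refine ih S (j + 1) (by omega) (by omega) hS hSV fun vs hvs d hd u hu => ?_
        rcases Nat.lt_or_ge (d + vs.length) j with h1 | h1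
        · exact hun vs hvs d (by omega) u hu
        rcases vs with _ | ⟨v, vs⟩
        · rw [List.map_nil, List.prod_nil, covWith_comm, covWith_one_right hiso.one]
        rcases d with _ | d
        · rw [pow_zero, covWith_one_right hiso.one]
        have := hP (v :: vs) (mem_choices.2 ⟨by simp, by omega, hvs⟩) u hu
        rwa [show j - (v :: vs).length = d + 1 by omega] at this
    · exact hend S j h hS hSV hun

end Prog

end

section

/-! ### The splittings of the basis -/

theorem splits_perm {β : Type} : ∀ (k : ℕ) (B : List β), ∀ p ∈ splits k B, (p.1 ++ p.2).Perm B
  | k, [], p, hp => by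
    rw [splits, List.mem_singleton] at hp
    simp [hp]
  | 0, b :: B, p, hp => by
    rw [splits, List.mem_singleton] at hp
    · simp [hp]
    · simp
  | k + 1, b :: B, p, hp => by
    rw [splits, List.mem_append, List.mem_map, List.mem_map] at hp
    rcases hp with ⟨q, hq, rfl⟩ | ⟨q, hq, rfl⟩
    · exact (splits_perm k B q hq).cons b
    · exact List.perm_middle.trans ((splits_perm (k + 1) B q hq).cons b)

theorem filter_mem_splits {β : Type} (P : β → Bool) : ∀ (k : ℕ) (B : List β),
    (B.filter P).length ≤ k → (B.filter P, B.filter fun b => !P b) ∈ splits k B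
  | k, [], _ => by simp [splits]
  | 0, b :: B, h => by
    have h0 : (b :: B).filter P = [] := List.length_eq_zero_iff.1 (Nat.le_zero.1 h)
    have h1 : (b :: B).filter (fun b => !P b) = b :: B := by
      rw [List.filter_eq_self]
      intro a ha
      have := List.filter_eq_nil_iff.1 h0 a ha
      simpa using this
    rw [h0, h1, splits]
    · simp
    · simp
  | k + 1, b :: B, h => by
    rw [splits, List.mem_append, List.mem_map, List.mem_map]
    by_cases hb : P b = true
    · left
      rw [List.filter_cons_of_pos hb, List.length_cons] at h
      exact ⟨_, filter_mem_splits P k B (by omega), by simp [hb]⟩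
    · right
      rw [List.filter_cons_of_neg hb] at h
      exact ⟨_, filter_mem_splits P (k + 1) B h, by simp [hb]⟩

theorem length_splits_le {β : Type} : ∀ (k : ℕ) (B : List β),
    (splits k B).length ≤ (B.length + 1) ^ k
  | k, [] => by simp [splits]
  | 0, b :: B => by rw [splits] <;> simp
  | k + 1, b :: B => by
    rw [splits, List.length_append, List.length_map, List.length_map, List.length_cons]
    have h1 := length_splits_le k B
    have h2 := length_splits_le (k + 1) B
    have h3 : (B.length + 1) ^ k ≤ (B.length + 1 + 1) ^ k := Nat.pow_le_pow_left (by omega) k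
    calc _ ≤ (B.length + 1) ^ k * (B.length + 1 + 1) := by rw [pow_succ] at h2; linarith
      _ ≤ (B.length + 1 + 1) ^ (k + 1) := by rw [pow_succ]; exact Nat.mul_le_mul_right _ h3

/-! ### The moment gap -/

variable {n : ℕ} {Lam : MvPolynomial (Fin n) ℝ →ₗ[ℝ] ℝ} {m : ℕ} {V W : Submodule ℝ (Vec ℝ n)}

/-- The difference between the joint moment of a tuple of marked vectors and the product of the
moments of the two marked parts. -/
noncomputable def gapTerm (Lam : MvPolynomial (Fin n) ℝ →ₗ[ℝ] ℝ) (p : List (Vec ℝ n × Bool)) : ℝ :=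
  Lam ((p.map Prod.fst).map linForm).prod -
    Lam (((p.filter fun q => q.2).map Prod.fst).map linForm).prod *
      Lam (((p.filter fun q => !q.2).map Prod.fst).map linForm).prod

/-- The value of `Δ_U^l`. -/
noncomputable def gapValue (Lam : MvPolynomial (Fin n) ℝ →ₗ[ℝ] ℝ) (U W : List (Vec ℝ n)) (l : ℕ) :
    ℝ :=
  ((tuples ((U.map fun v => (v, true)) ++ W.map fun v => (v, false)) l).map fun p =>
    gapTerm Lam p * gapTerm Lam p).sum

theorem gapValue_nonneg (U W : List (Vec ℝ n)) (l : ℕ) : 0 ≤ gapValue Lam U W l :=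
  List.sum_nonneg fun x hx => by
    obtain ⟨p, -, rfl⟩ := List.mem_map.1 hx
    exact mul_self_nonneg _

theorem gapTerm_append (as bs : List (Vec ℝ n)) :
    gapTerm Lam ((as.map fun v => (v, true)) ++ bs.map fun v => (v, false)) =
      Lam ((as.map linForm).prod * (bs.map linForm).prod) -
        Lam (as.map linForm).prod * Lam (bs.map linForm).prod := by
  rw [gapTerm]
  simp [List.filter_map, Function.comp_def]

/-- The gaps of order at most `2` need not be computed: they vanish by isotropy and
orthogonality. -/
theorem momentIndep_of_gapValue (hiso : IsoMoments Lam) {U W : List (Vec ℝ n)}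
    (horth : ∀ u ∈ U, ∀ v ∈ W, u ⬝ᵥ v = 0)
    (h : ∀ l, 3 ≤ l → l ≤ m → gapValue Lam U W l = 0) :
    MomentIndep Lam m {u | u ∈ U} {v | v ∈ W} := by
  intro as bs ha hb hl
  rcases as with _ | ⟨a, as⟩
  · simp [hiso.one]
  rcases bs with _ | ⟨b, bs⟩
  · simp [hiso.one]
  rcases Nat.lt_or_ge ((a :: as).length + (b :: bs).length) 3 with h3 | h3
  · simp only [List.length_cons] at h3
    obtain rfl : as = [] := List.eq_nil_of_length_eq_zero (by omega)
    obtain rfl : bs = [] := List.eq_nil_of_length_eq_zero (by omega)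
    simp [hiso.cov, hiso.mean, horth a (ha a (by simp)) b (hb b (by simp))]
  · have h0 := h _ h3 hl
    have h1 := (List.single_le_sum (by
      intro x hx
      obtain ⟨p, -, rfl⟩ := List.mem_map.1 hx
      exact mul_self_nonneg _) _ (List.mem_map.2 ⟨((a :: as).map fun v => (v, true)) ++
      (b :: bs).map fun v => (v, false), mem_tuples.2 ⟨by simp; omega, ?_⟩, rfl⟩)).trans_eq h0
    · rw [gapTerm_append] at h1
      exact sub_eq_zero.1 (mul_self_eq_zero.1 (le_antisymm h1 (mul_self_nonneg _)))
    · intro v hv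
      rw [List.mem_append, List.mem_map, List.mem_map] at hv ⊢
      rcases hv with ⟨x, hx, rfl⟩ | ⟨x, hx, rfl⟩
      · exact Or.inl ⟨x, ha x hx, rfl⟩
      · exact Or.inr ⟨x, hb x hx, rfl⟩

theorem gapValue_eq_zero {U W : List (Vec ℝ n)} (h : MomentIndep Lam m {u | u ∈ U} {v | v ∈ W})
    {l : ℕ} (hl : l ≤ m) : gapValue Lam U W l = 0 := by
  refine List.sum_eq_zero fun x hx => ?_
  obtain ⟨p, hp, rfl⟩ := List.mem_map.1 hx
  obtain ⟨hlen, hmem⟩ := mem_tuples.1 hp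
  rw [mul_self_eq_zero, gapTerm, sub_eq_zero]
  have hmem' : ∀ q ∈ p, (q.2 = true → q.1 ∈ U) ∧ (q.2 = false → q.1 ∈ W) := by
    intro q hq
    have := hmem q hq
    rw [List.mem_append, List.mem_map, List.mem_map] at this
    rcases this with ⟨x, hx, rfl⟩ | ⟨x, hx, rfl⟩
    · exact ⟨fun _ => hx, fun h => by simp at h⟩
    · exact ⟨fun h => by simp at h, fun _ => hx⟩
  have hperm := List.filter_append_perm (fun q : Vec ℝ n × Bool => q.2) p
  rw [← h]
  · rw [← List.prod_append, ← List.map_append, ← List.map_append]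
    exact congrArg Lam ((hperm.map _).map _).prod_eq.symm
  · intro a ha
    obtain ⟨q, hq, rfl⟩ := List.mem_map.1 ha
    rw [List.mem_filter] at hq
    exact (hmem' q hq.1).1 hq.2
  · intro a ha
    obtain ⟨q, hq, rfl⟩ := List.mem_map.1 ha
    rw [List.mem_filter] at hq
    exact (hmem' q hq.1).2 (by simpa using hq.2)
  · rw [List.length_map, List.length_map, ← List.length_append, hperm.length_eq, hlen]
    exact hl

/-! ### The right splitting has no gap -/

/-- The orthogonal complement of the vectors in a list. -/
def orthSubmodule (C : List (Vec ℝ n)) : Submodule ℝ (Vec ℝ n) where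
  carrier := {u | ∀ b ∈ C, b ⬝ᵥ u = 0}
  add_mem' hu hv b hb := by rw [dotProduct_add, hu b hb, hv b hb, add_zero]
  zero_mem' b _ := dotProduct_zero b
  smul_mem' c u hu b hb := by rw [dotProduct_smul, hu b hb, smul_zero]

theorem dotProduct_eq_zero_of_span {X Y : Set (Vec ℝ n)} (h : ∀ x ∈ X, ∀ y ∈ Y, x ⬝ᵥ y = 0)
    {a b : Vec ℝ n} (ha : a ∈ Submodule.span ℝ X) (hb : b ∈ Submodule.span ℝ Y) :
    a ⬝ᵥ b = 0 := by
  refine Submodule.span_induction₂ (p := fun a b _ _ => a ⬝ᵥ b = 0) (fun x y hx hy => h x hx y hy)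
    (fun y _ => zero_dotProduct y) (fun x _ => dotProduct_zero x) ?_ ?_ ?_ ?_ ha hb
  · intro x y z _ _ _ h1 h2
    rw [add_dotProduct, h1, h2, add_zero]
  · intro x y z _ _ _ h1 h2
    rw [dotProduct_add, h1, h2, add_zero]
  · intro r x y _ _ h1
    rw [smul_dotProduct, h1, smul_zero]
  · intro r x y _ _ h1
    rw [dotProduct_smul, h1, smul_zero]

/-- A product of linear forms from two lists, sorted by list. -/
theorem exists_split_prod {S A as : List (Vec ℝ n)} (h : ∀ a ∈ as, a ∈ S ++ A) :
    ∃ s r : List (Vec ℝ n), (∀ v ∈ s, v ∈ S) ∧ (∀ v ∈ r, v ∈ A) ∧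
      s.length + r.length = as.length ∧
      (as.map linForm).prod = (s.map linForm).prod * (r.map linForm).prod := by
  induction as with
  | nil => exact ⟨[], [], by simp⟩
  | cons a as ih =>
    obtain ⟨s, r, hs, hr, hl, hp⟩ := ih fun b hb => h b (by simp [hb])
    rcases List.mem_append.1 (h a (by simp)) with ha | ha
    · refine ⟨a :: s, r, by simpa using ⟨ha, hs⟩, hr, by simp; omega, ?_⟩
      rw [List.map_cons, List.prod_cons, hp, List.map_cons, List.prod_cons, mul_assoc]
    · refine ⟨s, a :: r, hs, by simpa using ⟨ha, hr⟩, by simp; omega, ?_⟩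
      rw [List.map_cons, List.prod_cons, hp, List.map_cons, List.prod_cons, mul_left_comm]

/-- If the directions orthogonal to `S ⊂ V` and `T ⊂ W` are uncorrelated with `S` and with `T`, then
the moments factor into those of `S`, those of `T` and those of the orthogonal complement. -/
theorem Factors.map_prod_three (hF : Factors Lam m V W) {S T : List (Vec ℝ n)}
    (hS : ∀ v ∈ S, v ∈ V) (hT : ∀ v ∈ T, v ∈ W) (hSu : Uncorrelated Lam S (S ++ T) m)
    (hTu : Uncorrelated Lam T (S ++ T) m) {s t r : List (Vec ℝ n)} (hs : ∀ v ∈ s, v ∈ S)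
    (ht : ∀ v ∈ t, v ∈ T) (hr : ∀ v ∈ r, v ∈ orthSubmodule (S ++ T))
    (hl : s.length + t.length + r.length ≤ m) :
    Lam ((r.map linForm).prod * ((s.map linForm).prod * (t.map linForm).prod)) =
      Lam (r.map linForm).prod * (Lam (s.map linForm).prod * Lam (t.map linForm).prod) := by
  set ps := (s.map linForm).prod with hps
  set pt := (t.map linForm).prod with hpt
  have key := polarization (φ := Lam ∘ₗ LinearMap.mulRight ℝ (ps * pt) - (Lam ps * Lam pt) • Lam)
    hr fun u hu => ?_
  · simp only [LinearMap.sub_apply, LinearMap.comp_apply, LinearMap.mulRight_apply,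
      LinearMap.smul_apply, smul_eq_mul] at key
    rw [sub_eq_zero.1 key, mul_comm]
  · obtain ⟨p, hp, q, hq, rfl⟩ := hF.decomp u
    obtain ⟨hpC, hqC⟩ := hF.orth_components
      (fun b hb => (List.mem_append.1 hb).imp (hS b) (hT b)) hp hq hu
    simp only [LinearMap.sub_apply, LinearMap.comp_apply, LinearMap.mulRight_apply,
      LinearMap.smul_apply, smul_eq_mul]
    have h1 := map_smul_add_pow (Lam ∘ₗ LinearMap.mulRight ℝ (ps * pt)) (linForm p) (linForm q) 1
      r.length
    rw [one_smul, ← map_add] at h1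
    simp only [LinearMap.comp_apply, LinearMap.mulRight_apply] at h1
    rw [h1, hF.indep.pow_eq hp hq (by omega), Finset.mul_sum, ← Finset.sum_sub_distrib]
    refine Finset.sum_eq_zero fun i hi => ?_
    have hi' := Finset.mem_range.1 hi
    have h2 := hF.indep (List.replicate i p ++ s) (List.replicate (r.length - i) q ++ t)
      (fun x hx => by
        rcases List.mem_append.1 hx with hx | hx
        · rw [(List.mem_replicate.1 hx).2]; exact hp
        · exact hS x (hs x hx))
      (fun x hx => by
        rcases List.mem_append.1 hx with hx | hx
        · rw [(List.mem_replicate.1 hx).2]; exact hq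
        · exact hT x (ht x hx)) (by simp; omega)
    simp only [List.map_append, List.prod_append, List.map_replicate, List.prod_replicate] at h2
    have h3 := hSu s hs i (by omega) p hpC
    have h4 := hTu t ht (r.length - i) (by omega) q hqC
    rw [Prog.covWith_apply, sub_eq_zero] at h3 h4
    rw [← hps, ← hpt, h3, h4] at h2
    rw [show linForm p ^ i * linForm q ^ (r.length - i) * (ps * pt) =
      linForm p ^ i * ps * (linForm q ^ (r.length - i) * pt) by ring, h2]
    ring

/-- If no test failed, then every completion of the two extended lists makes the moments factor. If
one of the lists is full, its span is `V` or `W` and the new vectors belong to the other subspace.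
Otherwise the space of the new vectors is uncorrelated with both lists and has Gaussian moments, so
it can be divided between the two in any way. -/
theorem Factors.momentIndep_of_good (hF : Factors Lam m V W) (hiso : IsoMoments Lam)
    {B T rest S₁ T₁ A : List (Vec ℝ n)} (hB : GoodBasis Lam m V W B) (hperm : (T ++ rest).Perm B)
    (h₁ : GoodExtension Lam m V rest T S₁) (h₂ : GoodExtension Lam m W S₁ rest T₁)
    (hA : OrthoList (S₁ ++ T₁ ++ A)) (hlen : (S₁ ++ T₁ ++ A).length = n) {i : ℕ}
    (hi : i = Module.finrank ℝ V - S₁.length) :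
    MomentIndep Lam m {u | u ∈ S₁ ++ A.take i} {v | v ∈ T₁ ++ A.drop i} := by
  have hdim := hF.finrank_add
  obtain ⟨hST, hAo, hSTA⟩ := orthoList_append.1 hA
  obtain ⟨hSo, hTo, hSTo⟩ := orthoList_append.1 hST
  have hlS := hSo.length_le V h₁.mem
  have hlT := hTo.length_le W h₂.mem
  simp only [List.length_append] at hlen
  have hAR : ∀ a ∈ A, a ∈ orthSubmodule (S₁ ++ T₁) := fun a ha b hb => hSTA b hb a ha
  have hcomp : ∀ a ∈ A, ∃ p ∈ V, ∃ q ∈ W, a = p + q ∧ (∀ b ∈ S₁ ++ T₁, b ⬝ᵥ p = 0) ∧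
      ∀ b ∈ S₁ ++ T₁, b ⬝ᵥ q = 0 := by
    intro a ha
    obtain ⟨p, hp, q, hq, rfl⟩ := hF.decomp a
    exact ⟨p, hp, q, hq, rfl, hF.orth_components
      (fun b hb => (List.mem_append.1 hb).imp (h₁.mem b) (h₂.mem b)) hp hq (hAR _ ha)⟩
  rcases h₁.full_or with hfull | hSu
  · have hi0 : i = 0 := by omega
    subst hi0
    have hAW : ∀ a ∈ A, a ∈ W := by
      intro a ha
      obtain ⟨p, hp, q, hq, rfl, hpC, -⟩ := hcomp a ha
      rw [hSo.eq_zero_of_orth h₁.mem hfull hp fun b hb => hpC b (by simp [hb]), zero_add]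
      exact hq
    rw [List.take_zero, List.append_nil, List.drop_zero]
    exact hF.indep.mono h₁.mem fun v hv => (List.mem_append.1 hv).elim (h₂.mem v) (hAW v)
  rcases h₂.full_or with hfull | hTu
  · have hAV : ∀ a ∈ A, a ∈ V := by
      intro a ha
      obtain ⟨p, hp, q, hq, rfl, -, hqC⟩ := hcomp a ha
      rw [hTo.eq_zero_of_orth h₂.mem hfull hq fun b hb => hqC b (by simp [hb]), add_zero]
      exact hp
    rw [List.drop_of_length_le (by omega), List.append_nil]
    exact hF.indep.mono (fun v hv => (List.mem_append.1 hv).elim (h₁.mem v)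
      fun h => hAV v (List.mem_of_mem_take h)) h₂.mem
  have hTu' : Uncorrelated Lam T₁ (S₁ ++ T₁) m := fun vs hvs d hd u hu =>
    hTu vs hvs d hd u fun b hb => hu b (List.perm_append_comm.mem_iff.1 hb)
  have hSu' : Uncorrelated Lam S₁ (S₁ ++ T₁) m := fun vs hvs d hd u hu =>
    hSu vs hvs d hd u fun b hb => hu b (by
      rcases List.mem_append.1 hb with hb | hb
      · exact List.mem_append_left _ hb
      · exact List.mem_append_right _ (h₂.subset b hb))
  have hgauss : ∀ j ≤ m, ∀ u ∈ orthSubmodule (S₁ ++ T₁), gaussGap Lam j u = 0 :=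
    fun j hj u hu => hB.gauss j hj u fun b hb => hu b (by
      rcases List.mem_append.1 (hperm.mem_iff.2 hb) with hb | hb
      · exact List.mem_append_left _ (h₁.subset b hb)
      · exact List.mem_append_right _ (h₂.subset b hb))
  have hAA : MomentIndep Lam m (Submodule.span ℝ {v | v ∈ A.take i})
      (Submodule.span ℝ {v | v ∈ A.drop i}) :=
    momentIndep_of_gaussGap (R := orthSubmodule (S₁ ++ T₁))
      (Submodule.span_le.2 fun v hv => hAR v (List.mem_of_mem_take hv))
      (Submodule.span_le.2 fun v hv => hAR v (List.mem_of_mem_drop hv))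
      (fun a ha b hb => dotProduct_eq_zero_of_span (fun x hx y hy => by
        have h3 := hAo
        rw [← List.take_append_drop i A, orthoList_append] at h3
        exact h3.2.2 x hx y hy) ha hb) hgauss
  intro as bs ha hb hl
  obtain ⟨s, r, hs, hr, hl1, hp1⟩ := exists_split_prod ha
  obtain ⟨t, r', ht, hr', hl2, hp2⟩ := exists_split_prod hb
  have hrR : ∀ v ∈ r, v ∈ orthSubmodule (S₁ ++ T₁) :=
    fun v hv => hAR v (List.mem_of_mem_take (hr v hv))
  have hrR' : ∀ v ∈ r', v ∈ orthSubmodule (S₁ ++ T₁) :=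
    fun v hv => hAR v (List.mem_of_mem_drop (hr' v hv))
  have e1 := hF.map_prod_three h₁.mem h₂.mem hSu' hTu' (r := r ++ r') hs ht
    (fun v hv => (List.mem_append.1 hv).elim (hrR v) (hrR' v)) (by simp; omega)
  have e2 := hF.map_prod_three h₁.mem h₂.mem hSu' hTu' (t := []) hs (by simp) hrR (by simp; omega)
  have e3 := hF.map_prod_three h₁.mem h₂.mem hSu' hTu' (s := []) (by simp) ht hrR' (by simp; omega)
  have e4 := hAA r r' (fun v hv => Submodule.subset_span (hr v hv))
    (fun v hv => Submodule.subset_span (hr' v hv)) (by omega)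
  simp only [List.map_nil, List.prod_nil, mul_one, one_mul, hiso.one] at e2 e3
  rw [List.map_append, List.prod_append, e4] at e1
  rw [hp1, hp2, mul_comm (s.map linForm).prod, e2, mul_comm (t.map linForm).prod, e3]
  rw [show (r.map linForm).prod * (s.map linForm).prod * ((r'.map linForm).prod *
    (t.map linForm).prod) = (r.map linForm).prod * (r'.map linForm).prod *
      ((s.map linForm).prod * (t.map linForm).prod) by ring, e1]
  ring

end

section

/-! ### The selection of the best splitting -/

variable {n : ℕ} {Lam : MvPolynomial (Fin n) ℝ →ₗ[ℝ] ℝ} {m k : ℕ}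
  {V W : Submodule ℝ (Vec ℝ n)}

/-- `b` consists of a `k`-element part of an orthonormal basis and of its list of moment gaps. -/
def IsCandidate (Lam : MvPolynomial (Fin n) ℝ →ₗ[ℝ] ℝ) (m k : ℕ)
    (b : List (Vec ℝ n) × List ℝ) : Prop :=
  ∃ W : List (Vec ℝ n), OrthoList (b.1 ++ W) ∧ (b.1 ++ W).length = n ∧ b.1.length = k ∧
    b.2 = (List.range' 3 (m - 2)).map (gapValue Lam b.1 W)

theorem IsCandidate.nonneg {b : List (Vec ℝ n) × List ℝ} (h : IsCandidate Lam m k b) :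
    ∀ x ∈ b.2, 0 ≤ x := by
  obtain ⟨W, -, -, -, h⟩ := h
  intro x hx
  rw [h] at hx
  obtain ⟨l, -, rfl⟩ := List.mem_map.1 hx
  exact gapValue_nonneg _ _ _

theorem IsCandidate.length_gaps {b : List (Vec ℝ n) × List ℝ} (h : IsCandidate Lam m k b) :
    b.2.length = m - 2 := by
  obtain ⟨W, -, -, -, h⟩ := h
  rw [h, List.length_map, List.length_range']

/-- A candidate without moment gaps. -/
def IsPerfect (Lam : MvPolynomial (Fin n) ℝ →ₗ[ℝ] ℝ) (m k : ℕ)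
    (b : List (Vec ℝ n) × List ℝ) : Prop :=
  IsCandidate Lam m k b ∧ ∀ x ∈ b.2, x = 0

namespace Prog

variable {M : List (Fin n) → ℝ} {O : LocalOptOracle n}

theorem ensures_momentGap {N : ℕ} (hN : 2 ≤ N) (hn : n ≤ N)
    (hM : ∀ is, M is = Lam (is.map MvPolynomial.X).prod) (U W : List (Vec ℝ n))
    (hUW : (U ++ W).length = n) {l : ℕ} (hl : l ≤ m) :
    Ensures M O (momentGap U W l) (N ^ m * (3 * N ^ (3 * m) + 4) + 1)
      (· = gapValue Lam U W l) := by
  rw [List.length_append] at hUW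
  refine (ensures_sumOver (c := 3 * N ^ (3 * m) + 3) fun p hp => ?_).mono ?_ fun _ => id
  · have hlen := (mem_tuples.1 hp).1
    have hc : ∀ {vs : List (Vec ℝ n)}, vs.length ≤ m → Ensures M O (contract [] vs)
        (N ^ (3 * m)) (· = Lam (vs.map linForm).prod) := fun h =>
      (ensures_contract_nil hN hn hM _).mono (Nat.pow_le_pow_right (by omega) (by omega))
        fun _ => id
    refine (hc (by rw [List.length_map]; omega)).bind'
      (c' := N ^ (3 * m) + (N ^ (3 * m) + (1 + (1 + 1)))) (by omega) ?_
    rintro _ rfl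
    refine (hc ?_).bind ?_
    · rw [List.length_map]
      exact (List.length_filter_le _ _).trans (by omega)
    rintro _ rfl
    refine (hc ?_).bind ?_
    · rw [List.length_map]
      exact (List.length_filter_le _ _).trans (by omega)
    rintro _ rfl
    refine (ensures_mul _ _).bind ?_
    rintro _ rfl
    refine (ensures_sub _ _).bind ?_
    rintro _ rfl
    exact ensures_mul _ _
  · rw [length_tuples, List.length_append, List.length_map, List.length_map, hUW]
    have := (Nat.pow_le_pow_left hn l).trans (Nat.pow_le_pow_right (n := N) (by omega) hl)
    exact Nat.add_le_add_right (Nat.mul_le_mul_right _ this) 1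

/-- The zero list is the least among lists of nonnegative numbers: it is not replaced as the best
list, and it replaces every other list. -/
theorem ensures_lexLess : ∀ xs ys : List ℝ, (∀ x ∈ xs, 0 ≤ x) → (∀ y ∈ ys, 0 ≤ y) →
    xs.length = ys.length → Ensures M O (lexLess xs ys) (2 * xs.length) fun b =>
      ((∀ y ∈ ys, y = 0) → b = false) ∧ ((∀ x ∈ xs, x = 0) → b = false → ∀ y ∈ ys, y = 0)
  | [], [], _, _, _ => ensures_ret _ (by simp)
  | [], y :: ys, _, _, h => by simp at h
  | x :: xs, [], _, _, h => by simp at h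
  | x :: xs, y :: ys, hx, hy, hl => by
    refine (ensures_less x y).bind' (c' := 1 + 2 * xs.length)
      (by rw [List.length_cons]; omega) fun b hb => ?_
    have hx0 := hx x (by simp)
    have hy0 := hy y (by simp)
    cases b with
    | true =>
      have hlt := hb.1 rfl
      refine ensures_pure _ ⟨fun h => ?_, fun _ h => by simp at h⟩
      have := h y (by simp)
      linarith
    | false =>
      have hyx : y ≤ x := not_lt.1 fun h => Bool.false_ne_true (hb.2 h)
      refine (ensures_less y x).bind fun b hb => ?_
      cases b with
      | true =>
        have hlt := hb.1 rfl
        refine ensures_pure _ ⟨fun _ => rfl, fun h _ => ?_⟩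
        have := h x (by simp)
        linarith
      | false =>
        have hxy : x ≤ y := not_lt.1 fun h => Bool.false_ne_true (hb.2 h)
        refine (ensures_lexLess xs ys (fun x h => hx x (by simp [h]))
          (fun y h => hy y (by simp [h])) (by simpa using hl)).mono le_rfl fun b hb =>
            ⟨fun h => hb.1 fun y hy => h y (by simp [hy]), fun h hf => ?_⟩
        have := hb.2 (fun x hx => h x (by simp [hx])) hf
        intro z hz
        rcases List.mem_cons.1 hz with rfl | hz
        · have := h x (by simp)
          linarith
        · exact this z hz

/-- Sequential composition of programs is associative. -/
instance {R : Type} : LawfulMonad (Prog R n) := LawfulMonad.mk'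
  (id_map := fun p => by
    change p.bind (fun a => ret (id a)) = p
    induction p with
    | ret a => rfl
    | tick k ih => exact congrArg tick ih
    | const c k ih => exact congrArg (Prog.const c) (funext ih)
    | arith o x y k ih => exact congrArg (arith o x y) (funext ih)
    | sqrt x k ih => exact congrArg (Prog.sqrt x) (funext ih)
    | less x y k ih => exact congrArg (Prog.less x y) (funext ih)
    | draw N k ih => exact congrArg (Prog.draw N) (funext ih)
    | moment is k ih => exact congrArg (Prog.moment is) (funext ih)
    | localOpt b d G C v k ih => exact congrArg (Prog.localOpt b d G C v) (funext ih))
  (pure_bind := fun _ _ => rfl)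
  (bind_assoc := fun p f g => by
    change (p.bind f).bind g = p.bind fun a => (f a).bind g
    induction p with
    | ret a => rfl
    | tick k ih => exact congrArg tick ih
    | const c k ih => exact congrArg (Prog.const c) (funext ih)
    | arith o x y k ih => exact congrArg (arith o x y) (funext ih)
    | sqrt x k ih => exact congrArg (Prog.sqrt x) (funext ih)
    | less x y k ih => exact congrArg (Prog.less x y) (funext ih)
    | draw N k ih => exact congrArg (Prog.draw N) (funext ih)
    | moment is k ih => exact congrArg (Prog.moment is) (funext ih)
    | localOpt b d G C v k ih => exact congrArg (Prog.localOpt b d G C v) (funext ih))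

/-- The better one of the best candidate so far and a new one. -/
def compareBest {R : Type} (best : Option (List (Vec R n) × List R))
    (c : List (Vec R n) × List R) : Prog R n (Option (List (Vec R n) × List R)) :=
  match best with
  | none => pure (some c)
  | some b => do
      let better ← lexLess c.2 b.2
      pure (if better then some c else some b)

/-- The part of the loop of Factor that follows the two calls of ExtendBasis: the new value of the
best candidate. -/
def updateBest {R : Type} (m k : ℕ) (S₁ T₁ : List (Vec R n))
    (best : Option (List (Vec R n) × List R)) : Prog R n (Option (List (Vec R n) × List R)) :=
  if k < S₁.length ∨ n - k < T₁.length then pure best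
  else do
    let A ← complete (List.finRange n) (S₁ ++ T₁)
    let gaps ← listOf (List.range' 3 (m - 2)) fun l =>
      momentGap (S₁ ++ A.take (k - S₁.length)) (T₁ ++ A.drop (k - S₁.length)) l
    compareBest best (S₁ ++ A.take (k - S₁.length), gaps)

/-- One iteration of the loop of Factor, with the update of the best candidate as a subprogram. -/
theorem selectBest_cons {R : Type} (r : ℕ) (T rest : List (Vec R n))
    (l : List (List (Vec R n) × List (Vec R n))) (best : Option (List (Vec R n) × List R)) :
    selectBest m k r ((T, rest) :: l) best = (do
      step
      let S₁ ← extendBasis m r k rest T 2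
      let T₁ ← extendBasis m r (n - k) S₁ rest 2
      let best' ← updateBest m k S₁ T₁ best
      selectBest m k r l best') := by
  rw [selectBest]
  congr 1
  funext _
  congr 1
  funext S₁
  congr 1
  funext T₁
  rw [updateBest]
  split_ifs with h
  · rw [pure_bind]
  · simp only [bind_assoc]
    congr 1
    funext A
    congr 1
    funext gaps
    rcases best with _ | b
    · simp only [compareBest, pure_bind]
    · simp only [compareBest, bind_assoc, pure_bind]
      congr 1
      funext b
      cases b <;> rfl

/-- The candidate computed from the two extended lists. -/
theorem ensures_complete_candidate (hkn : k ≤ n) {S₁ T₁ : List (Vec ℝ n)}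
    (hST : OrthoList (S₁ ++ T₁)) (hS : S₁.length ≤ k) (hT : T₁.length ≤ n - k) :
    Ensures M O (complete (List.finRange n) (S₁ ++ T₁))
      (n * (2 * n * (n * 4 + 1) + n * 6 + 5)) fun A =>
      OrthoList (S₁ ++ T₁ ++ A) ∧ (S₁ ++ T₁ ++ A).length = n ∧
      OrthoList ((S₁ ++ A.take (k - S₁.length)) ++ (T₁ ++ A.drop (k - S₁.length))) ∧
      ((S₁ ++ A.take (k - S₁.length)) ++ (T₁ ++ A.drop (k - S₁.length))).length = n ∧
      (S₁ ++ A.take (k - S₁.length)).length = k := by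
  refine (ensures_complete (K := 2 * n) (List.finRange n) _ hST ?_).mono (by simp) ?_
  · have := hST.length_le_dim
    rw [List.length_finRange]
    omega
  rintro A ⟨hA, -, htriv⟩
  have hlen := length_eq_of_orth_trivial hA fun u hu => funext fun i =>
    htriv u hu i (List.mem_finRange i)
  have hperm : (S₁ ++ T₁ ++ A).Perm
      ((S₁ ++ A.take (k - S₁.length)) ++ (T₁ ++ A.drop (k - S₁.length))) := by
    conv_lhs => rw [← List.take_append_drop (k - S₁.length) A]
    rw [List.append_assoc, List.append_assoc]
    refine List.Perm.append_left _ ?_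
    rw [← List.append_assoc, ← List.append_assoc]
    exact List.Perm.append_right _ List.perm_append_comm
  refine ⟨hA, hlen, hA.perm hperm, hperm.length_eq ▸ hlen, ?_⟩
  simp only [List.length_append, List.length_take] at hlen ⊢
  omega

/-- The new best candidate is perfect if the previous one or the new candidate is. -/
theorem ensures_compareBest {best : Option (List (Vec ℝ n) × List ℝ)}
    (hbest : ∀ b, best = some b → IsCandidate Lam m k b) {c : List (Vec ℝ n) × List ℝ}
    (hc : IsCandidate Lam m k c) :
    Ensures M O (compareBest best c) (2 * m) fun o => (∀ b, o = some b → IsCandidate Lam m k b) ∧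
      ((∃ b, best = some b ∧ IsPerfect Lam m k b) ∨ IsPerfect Lam m k c →
        ∃ b, o = some b ∧ IsPerfect Lam m k b) := by
  rcases best with _ | b
  · refine ensures_pure _ ⟨by rintro _ ⟨⟩; exact hc, ?_⟩
    rintro (⟨_, ⟨⟩, _⟩ | h)
    exact ⟨c, rfl, h⟩
  · have hb := hbest b rfl
    refine (ensures_lexLess c.2 b.2 hc.nonneg hb.nonneg
      (hc.length_gaps.trans hb.length_gaps.symm)).bind' (c' := 0) ?_ fun o ho => ?_
    · rw [hc.length_gaps]; omega
    cases o with
    | true =>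
      refine ensures_pure _ ⟨by rintro _ ⟨⟩; exact hc, ?_⟩
      rintro (⟨b', ⟨⟩, h⟩ | h)
      · exact absurd (ho.1 h.2) (by simp)
      · exact ⟨c, rfl, h⟩
    | false =>
      refine ensures_pure _ ⟨by rintro _ ⟨⟩; exact hb, ?_⟩
      rintro (⟨b', ⟨⟩, h⟩ | h)
      · exact ⟨b, rfl, h⟩
      · exact ⟨b, rfl, hb, ho.2 h.2 rfl⟩

/-- The new best candidate is perfect if the previous one is, or if the two extended lists are not
too long and every completion of them makes the moments factor. -/
theorem ensures_updateBest {N : ℕ} (hN : 2 ≤ N) (hn : n ≤ N) (hkn : k ≤ n)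
    (hM : ∀ is, M is = Lam (is.map MvPolynomial.X).prod) {S₁ T₁ : List (Vec ℝ n)}
    (hST : OrthoList (S₁ ++ T₁)) {best : Option (List (Vec ℝ n) × List ℝ)}
    (hbest : ∀ b, best = some b → IsCandidate Lam m k b) :
    Ensures M O (updateBest m k S₁ T₁ best)
      (n * (2 * n * (n * 4 + 1) + n * 6 + 5) + (m * (N ^ m * (3 * N ^ (3 * m) + 4) + 1) + 2 * m))
      fun o => (∀ b, o = some b → IsCandidate Lam m k b) ∧
        ((∃ b, best = some b ∧ IsPerfect Lam m k b) ∨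
          (S₁.length ≤ k ∧ T₁.length ≤ n - k ∧ ∀ A : List (Vec ℝ n), OrthoList (S₁ ++ T₁ ++ A) →
            (S₁ ++ T₁ ++ A).length = n → MomentIndep Lam m {u | u ∈ S₁ ++ A.take (k - S₁.length)}
              {v | v ∈ T₁ ++ A.drop (k - S₁.length)}) →
          ∃ b, o = some b ∧ IsPerfect Lam m k b) := by
  rw [updateBest]
  split_ifs with h
  · refine ensures_pure _ ⟨hbest, fun h' => h'.resolve_right fun h' => ?_⟩
    have := h'.1
    have := h'.2.1
    omega
  rw [not_or, not_lt, not_lt] at h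
  refine (ensures_complete_candidate hkn hST h.1 h.2).bind ?_
  rintro A ⟨hA, hAlen, hUW, hUWlen, hU⟩
  have hl : ∀ l ∈ List.range' 3 (m - 2), l ≤ m := fun l hl => by
    rw [List.mem_range'_1] at hl
    omega
  refine ((ensures_listOf fun l hl' => ensures_momentGap hN hn hM _ _ hUWlen (hl l hl')).mono
    (Nat.mul_le_mul_right _ (by simp)) fun _ => id).bind ?_
  rintro _ rfl
  have hcand : IsCandidate Lam m k (S₁ ++ A.take (k - S₁.length),
      (List.range' 3 (m - 2)).map (gapValue Lam (S₁ ++ A.take (k - S₁.length))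
        (T₁ ++ A.drop (k - S₁.length)))) := ⟨_, hUW, hUWlen, hU, rfl⟩
  refine (ensures_compareBest hbest hcand).mono le_rfl fun o ho => ⟨ho.1, fun h' =>
    ho.2 (h'.imp_right fun h' => ⟨hcand, fun x hx => ?_⟩)⟩
  obtain ⟨l, hl', rfl⟩ := List.mem_map.1 hx
  exact gapValue_eq_zero (h'.2.2 A hA hAlen) (hl l hl')

/-- The parameters `t` and `T` bound the steps of a trial of the identity test and of an iteration
of ExtendBasis. -/
structure CostBounds (n m N r t T : ℕ) : Prop where
  two_le : 2 ≤ N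
  dim_le : n ≤ N
  one_le : 1 ≤ m
  trial : n * (n * 4 + 1) + N ^ (3 * m) + n * 6 + m + 9 ≤ t
  iteration : 1 + m * N ^ m * (N ^ (3 * m) + N ^ m * (N ^ (3 * m) + 3) + r * t + 1) ≤ T

theorem ensures_extendBasis_start (hO : O.IsExact)
    (hM : ∀ is, M is = Lam (is.map MvPolynomial.X).prod) {N r t T : ℕ}
    (hc : CostBounds n m N r t T) {cap : ℕ} (hcap : cap ≤ n) {S R : List (Vec ℝ n)}
    (hSR : OrthoList (S ++ R)) : Ensures M O (extendBasis m r cap R S 2) ((n * m + m) * T)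
      fun S₁ => OrthoList (S₁ ++ R) :=
  ensures_extendBasis hc.two_le hc.dim_le hO hM hc.one_le hcap hc.trial hc.iteration R _ S 2
    (Nat.add_le_add (Nat.mul_le_mul_right _ (by omega)) (by omega)) hSR

/-- The best candidate stays perfect once it is. -/
theorem ensures_selectBest (hO : O.IsExact) (hM : ∀ is, M is = Lam (is.map MvPolynomial.X).prod)
    {N r t T : ℕ} (hc : CostBounds n m N r t T) (hkn : k ≤ n) :
    ∀ (l : List (List (Vec ℝ n) × List (Vec ℝ n))) (best : Option (List (Vec ℝ n) × List ℝ)),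
    (∀ p ∈ l, OrthoList (p.1 ++ p.2)) → (∀ b, best = some b → IsCandidate Lam m k b) →
    Ensures M O (selectBest m k r l best) (l.length * (1 + 2 * ((n * m + m) * T) +
      n * (2 * n * (n * 4 + 1) + n * 6 + 5) + m * (N ^ m * (3 * N ^ (3 * m) + 4) + 1) + 2 * m))
      fun o => (∃ b, best = some b ∧ IsPerfect Lam m k b) → ∃ b, o = some b ∧ IsPerfect Lam m k b
  | [], best, _, _ => ensures_ret _ id
  | (S, R) :: l, best, hl, hbest => by
    have hstep := (ensures_tick (M := M) (O := O)).bind fun _ _ =>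
      (ensures_extendBasis_start hO hM hc hkn (hl (S, R) (by simp))).bind fun S₁ hS₁ =>
      (ensures_extendBasis_start hO hM hc (Nat.sub_le n k)
        (hS₁.perm List.perm_append_comm)).bind fun T₁ hT₁ =>
      (ensures_updateBest hc.two_le hc.dim_le hkn hM (hT₁.perm List.perm_append_comm)
        hbest).bind fun o ho =>
      (ensures_selectBest hO hM hc hkn l o (fun p hp => hl p (by simp [hp])) ho.1).mono
        le_rfl fun o' ho' h => ho' (ho.2 (Or.inl h))
    rw [selectBest_cons]
    refine hstep.mono ?_ fun _ => id
    rw [List.length_cons, Nat.succ_mul l.length]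
    omega

open Classical in
/-- The indicator of the event that no perfect candidate has been found. -/
noncomputable def notPerfect (Lam : MvPolynomial (Fin n) ℝ →ₗ[ℝ] ℝ) (m k : ℕ)
    (o : Option (List (Vec ℝ n) × List ℝ)) : ENNReal :=
  if ∃ b, o = some b ∧ IsPerfect Lam m k b then 0 else 1

theorem notPerfect_le_one (o : Option (List (Vec ℝ n) × List ℝ)) : notPerfect Lam m k o ≤ 1 := by
  rw [notPerfect]
  split_ifs
  exacts [zero_le_one, le_rfl]

/-- If the splitting of the good basis `B` along `V` and `W` is among those that are tried, then the
selection fails with probability at most `ε` times the number of vectors missing from `B`. -/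
theorem expect_selectBest_le (hO : O.IsExact) (hM : ∀ is, M is = Lam (is.map MvPolynomial.X).prod)
    (hF : Factors Lam m V W) (hiso : IsoMoments Lam) {r : ℕ}
    (hε : (n : ENNReal) * 2⁻¹ ^ r ≤ 1) (hk : k = Module.finrank ℝ V) (hm : 1 ≤ m)
    {B : List (Vec ℝ n)} (hB : GoodBasis Lam m V W B) {T rest : List (Vec ℝ n)}
    (hT : ∀ v ∈ T, v ∈ V) (hrest : ∀ v ∈ rest, v ∈ W) (hperm : (T ++ rest).Perm B) :
    ∀ (l : List (List (Vec ℝ n) × List (Vec ℝ n))) (best : Option (List (Vec ℝ n) × List ℝ)),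
    (∀ p ∈ l, OrthoList (p.1 ++ p.2)) → (∀ b, best = some b → IsCandidate Lam m k b) →
    (T, rest) ∈ l → expect M O (selectBest m k r l best) (notPerfect Lam m k) ≤
      (n - B.length : ℕ) * 2⁻¹ ^ r
  | [], _, _, _, h => by simp at h
  | (S, R) :: l, best, hl, hbest, hmem => by
    have hdim := hF.finrank_add
    have hkn : k ≤ n := by omega
    have hc : CostBounds n m (max 2 n) r _ _ :=
      ⟨le_max_left 2 n, le_max_right 2 n, hm, le_rfl, le_rfl⟩
    have hl' : ∀ p ∈ l, OrthoList (p.1 ++ p.2) := fun p hp => hl p (by simp [hp])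
    have hSR := hl (S, R) (by simp)
    rw [selectBest_cons]
    refine ensures_tick.expect_bind_le fun _ _ => ?_
    by_cases hmem' : (T, rest) ∈ l
    · refine (ensures_extendBasis_start hO hM hc hkn hSR).expect_bind_le fun S₁ hS₁ => ?_
      refine (ensures_extendBasis_start hO hM hc (Nat.sub_le n k)
        (hS₁.perm List.perm_append_comm)).expect_bind_le fun T₁ hT₁ => ?_
      refine (ensures_updateBest hc.two_le hc.dim_le hkn hM (hT₁.perm List.perm_append_comm)
        hbest).expect_bind_le fun o ho => ?_
      exact expect_selectBest_le hO hM hF hiso hε hk hm hB hT hrest hperm l o hl' ho.1 hmem'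
    · obtain ⟨rfl, rfl⟩ : T = S ∧ rest = R := by
        rcases List.mem_cons.1 hmem with h | h
        · exact Prod.mk.inj h
        · exact absurd h hmem'
      rw [expect_bind]
      refine ((ensures_extendBasis_start hO hM hc hkn hSR).expect_mono
        (ψ := extensionRisk Lam m V rest T (2⁻¹ ^ r)) fun S₁ hS₁ => ?_).trans
        ((expect_extendBasis_le hO hM hF hiso hε hrest hk hm _ T 2 le_rfl le_rfl hSR hT
          fun vs hvs d hd => hiso.uncorrelated (fun v hv => List.mem_append_left _ hv) vs hvs d
            (by omega)).trans_eq (by rw [hperm.length_eq]))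
      rw [extensionRisk]
      split_ifs with h₁
      swap
      · exact expect_le notPerfect_le_one
      have hRS := hS₁.perm List.perm_append_comm
      rw [expect_bind]
      refine ((ensures_extendBasis_start hO hM hc (Nat.sub_le n k) hRS).expect_mono
        (ψ := extensionRisk Lam m W S₁ rest (2⁻¹ ^ r)) fun T₁ hT₁ => ?_).trans
        ((expect_extendBasis_le hO hM hF.symm hiso hε h₁.mem (by omega) hm _ rest 2 le_rfl le_rfl
          hRS hrest fun vs hvs d hd => hiso.uncorrelated (fun v hv => List.mem_append_left _ hv) vs
            hvs d (by omega)).trans_eq (by rw [List.perm_append_comm.length_eq]))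
      rw [extensionRisk]
      split_ifs with h₂
      swap
      · exact expect_le notPerfect_le_one
      refine le_trans ?_ zero_le
      refine (ensures_updateBest hc.two_le hc.dim_le hkn hM (hT₁.perm List.perm_append_comm)
        hbest).expect_bind_le fun o ho => ?_
      have hperf := ho.2 (Or.inr ⟨hk ▸ (orthoList_append.1 hS₁).1.length_le V h₁.mem, ?_,
        fun A hA hlen => hF.momentIndep_of_good hiso hB hperm h₁ h₂ hA hlen (by rw [hk])⟩)
      · refine (ensures_selectBest hO hM hc hkn l o hl' ho.1).expect_le fun o' ho' => ?_
        rw [notPerfect, if_pos (ho' hperf)]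
      · have := (orthoList_append.1 hT₁).1.length_le W h₂.mem
        omega

/-- FindBasis makes at most `n + m` iterations, and at most `(n + 1)^k` splittings are tried. -/
theorem ensures_factor (hO : O.IsExact) (hM : ∀ is, M is = Lam (is.map MvPolynomial.X).prod)
    {N r t T T' : ℕ} (hc : CostBounds n m N r t T) (hkn : k ≤ n) (hT' : 1 + N ^ m + r * t ≤ T') :
    Ensures M O (factor m k r) ((n + m) * T' + (n + 1) ^ k * (1 + 2 * ((n * m + m) * T) +
      n * (2 * n * (n * 4 + 1) + n * 6 + 5) + m * (N ^ m * (3 * N ^ (3 * m) + 4) + 1) + 2 * m))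
      fun _ => True := by
  refine ((ensures_findBasis hc.two_le hc.dim_le hO hM hc.trial hT' (n + m) [] 2
    (by simp only [List.length_nil]; omega) le_rfl orthoList_nil).bind fun B hB => ?_)
  refine ((ensures_selectBest hO hM hc hkn (splits k B) none (fun p hp =>
    hB.perm (splits_perm k B p hp).symm) (by simp)).mono (Nat.mul_le_mul_right _ ?_)
    fun _ => id).bind (c' := 0) fun o _ => ensures_pure _ trivial
  exact (length_splits_le k B).trans (Nat.pow_le_pow_left
    (Nat.add_le_add_right hB.length_le_dim 1) k)

open Classical in
/-- Factor fails to return the first part of a perfect candidate with probability at most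
`n 2^{-r}`. -/
theorem expect_factor_le (hO : O.IsExact) (hM : ∀ is, M is = Lam (is.map MvPolynomial.X).prod)
    (hF : Factors Lam m V W) (hiso : IsoMoments Lam) {r : ℕ}
    (hε : (n : ENNReal) * 2⁻¹ ^ r ≤ 1) (hk : k = Module.finrank ℝ V) (hm : 1 ≤ m) :
    expect M O (factor m k r) (fun o =>
      if ∃ b, o = some b.1 ∧ IsPerfect Lam m k b then 0 else 1) ≤ n * 2⁻¹ ^ r := by
  rw [factor, expect_bind]
  refine ((ensures_findBasis (le_max_left 2 n) (le_max_right 2 n) hO hM le_rfl le_rfl _ [] 2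
    le_rfl le_rfl orthoList_nil).expect_mono (ψ := basisRisk Lam m V W (2⁻¹ ^ r))
    fun B hB => ?_).trans ((expect_findBasis_le hO hM hF hiso hε _ [] 2 le_rfl le_rfl
      orthoList_nil (by simp) fun i hi u _ => hiso.gaussGap (by omega) u).trans_eq (by simp))
  have hout : ∀ o : Option (List (Vec ℝ n) × List ℝ), expect M O
      (pure (o.map Prod.fst) : Prog ℝ n (Option (List (Vec ℝ n)))) (fun o =>
        if ∃ b, o = some b.1 ∧ IsPerfect Lam m k b then (0 : ENNReal) else 1) ≤
      notPerfect Lam m k o := by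
    intro o
    refine (expect_ret _ _).trans_le ?_
    rw [notPerfect]
    split_ifs with h1 h2 h2
    · exact le_rfl
    · exact zero_le
    · obtain ⟨b, rfl, hb⟩ := h2
      exact absurd ⟨b, rfl, hb⟩ h1
    · exact le_rfl
  rw [basisRisk]
  split_ifs with hgood
  swap
  · exact expect_le fun o => by split_ifs <;> simp
  rw [expect_bind]
  refine le_trans (expect_mono _ hout) ?_
  have hfV : ∀ v ∈ B.filter fun v => decide (v ∈ V), v ∈ V := fun v hv => by
    simpa using (List.mem_filter.1 hv).2
  have hfW : ∀ v ∈ B.filter fun v => !decide (v ∈ V), v ∈ W := fun v hv => by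
    have := List.mem_filter.1 hv
    exact (hgood.mem v this.1).resolve_left (by simpa using this.2)
  refine expect_selectBest_le hO hM hF hiso hε hk hm hgood hfV hfW
    (List.filter_append_perm _ B) _ none
    (fun p hp => hB.perm (splits_perm k B p hp).symm) (by simp)
    (filter_mem_splits (fun v => decide (v ∈ V)) k B ?_)
  rw [hk]
  refine OrthoList.length_le ⟨fun v hv => hgood.ortho.1 v (List.mem_of_mem_filter hv),
    hgood.ortho.2.filter _⟩ V hfV

end Prog

end

section

/-! ### The total number of steps -/

theorem two_mul_pow_le {X : ℕ} (hX : 2 ≤ X) (i : ℕ) : 2 * X ^ i ≤ X ^ (i + 1) := by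
  rw [pow_succ, mul_comm]
  exact Nat.mul_le_mul_left _ hX

theorem trial_cost_le {X n m : ℕ} (hX : 2 ≤ X) (hn : n ≤ X) (hm : m ≤ X) :
    n * (n * 4 + 1) + X ^ 3 + n * 6 + m + 9 ≤ X ^ 6 := by
  have h1 : n * (n * 4 + 1) ≤ X * (X * 4 + 1) := by gcongr
  have h2 : X * (X * 4 + 1) = 4 * X ^ 2 + X := by ring
  have : 2 * X ≤ X ^ 2 := by simpa using two_mul_pow_le hX 1
  have : 2 * X ^ 2 ≤ X ^ 3 := two_mul_pow_le hX 2
  have : 2 * X ^ 3 ≤ X ^ 4 := two_mul_pow_le hX 3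
  have : 2 * X ^ 4 ≤ X ^ 5 := two_mul_pow_le hX 4
  have : 2 * X ^ 5 ≤ X ^ 6 := two_mul_pow_le hX 5
  omega

theorem iteration_cost_le {X m r t : ℕ} (hX : 2 ≤ X) (hm : m ≤ X) (ht : t ≤ X ^ 6) :
    1 + m * X * (X ^ 3 + X * (X ^ 3 + 3) + r * t + 1) ≤ X ^ 11 * (r + 1) := by
  have h1 : m * X * (X ^ 3 + X * (X ^ 3 + 3) + r * t + 1) ≤
      X * X * (X ^ 3 + X * (X ^ 3 + 3) + r * X ^ 6 + 1) := by gcongr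
  have h2 : X ^ 3 + X * (X ^ 3 + 3) + r * X ^ 6 + 1 ≤ 2 * X ^ 6 * (r + 1) := by
    have e : X * (X ^ 3 + 3) = X ^ 4 + 3 * X := by ring
    have e' : 2 * X ^ 6 * (r + 1) = 2 * (r * X ^ 6) + 2 * X ^ 6 := by ring
    have : 2 * X ≤ X ^ 2 := by simpa using two_mul_pow_le hX 1
    have : 2 * X ^ 2 ≤ X ^ 3 := two_mul_pow_le hX 2
    have : 2 * X ^ 3 ≤ X ^ 4 := two_mul_pow_le hX 3
    have : 2 * X ^ 4 ≤ X ^ 5 := two_mul_pow_le hX 4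
    have : 2 * X ^ 5 ≤ X ^ 6 := two_mul_pow_le hX 5
    omega
  have h3 : X * X * (X ^ 3 + X * (X ^ 3 + 3) + r * X ^ 6 + 1) ≤ 2 * X ^ 8 * (r + 1) := by
    calc _ ≤ X * X * (2 * X ^ 6 * (r + 1)) := by gcongr
      _ = _ := by ring
  have h4 : 1 ≤ X ^ 8 * (r + 1) := Nat.mul_pos (by positivity) (by omega)
  have h5 : 3 * X ^ 8 ≤ X ^ 11 := by
    have : 2 * X ^ 8 ≤ X ^ 9 := two_mul_pow_le hX 8
    have : 2 * X ^ 9 ≤ X ^ 10 := two_mul_pow_le hX 9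
    have : 2 * X ^ 10 ≤ X ^ 11 := two_mul_pow_le hX 10
    omega
  have h6 := Nat.mul_le_mul_right (r + 1) h5
  have e : 3 * X ^ 8 * (r + 1) = 2 * X ^ 8 * (r + 1) + X ^ 8 * (r + 1) := by ring
  omega

/-- All contributions are bounded by powers of `X = N^m`, which exceeds `N`, `n` and `m`; only the
number of splittings depends on `k`. -/
theorem total_cost_le {N n m k r t T T' : ℕ} (hN : 2 ≤ N) (hn : n ≤ N) (hm : 1 ≤ m)
    (ht : t = n * (n * 4 + 1) + N ^ (3 * m) + n * 6 + m + 9)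
    (hT : T = 1 + m * N ^ m * (N ^ (3 * m) + N ^ m * (N ^ (3 * m) + 3) + r * t + 1))
    (hT' : T' = 1 + N ^ m + r * t) :
    (n + m) * T' + (n + 1) ^ k * (1 + 2 * ((n * m + m) * T) +
      n * (2 * n * (n * 4 + 1) + n * 6 + 5) + m * (N ^ m * (3 * N ^ (3 * m) + 4) + 1) + 2 * m) ≤
    N ^ (2 * k + 19 * m) * (r + 1) := by
  have hX3 : N ^ (3 * m) = (N ^ m) ^ 3 := by rw [← pow_mul]; congr 1; ring
  rw [hX3] at ht hT ⊢
  have hXN : N ≤ N ^ m := Nat.le_self_pow (by omega) N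
  have hmX : m ≤ N ^ m := (Nat.lt_two_pow_self).le.trans (Nat.pow_le_pow_left hN m)
  have hpow : N ^ (2 * k + 19 * m) = (N ^ 2) ^ k * (N ^ m) ^ 19 := by
    rw [pow_add, pow_mul, mul_comm 19, pow_mul]
  rw [hpow]
  generalize N ^ m = X at *
  have hX : 2 ≤ X := hN.trans hXN
  have hnX : n ≤ X := hn.trans hXN
  have ht' : t ≤ X ^ 6 := ht ▸ trial_cost_le hX hnX hmX
  have hTle : T ≤ X ^ 11 * (r + 1) := hT ▸ iteration_cost_le hX hmX ht'
  have hpos : 1 ≤ r + 1 := by omega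
  have p1 : 2 * X ≤ X ^ 2 := by simpa using two_mul_pow_le hX 1
  have p2 : 2 * X ^ 2 ≤ X ^ 3 := two_mul_pow_le hX 2
  have p3 : 2 * X ^ 3 ≤ X ^ 4 := two_mul_pow_le hX 3
  have p4 : 2 * X ^ 4 ≤ X ^ 5 := two_mul_pow_le hX 4
  have p5 : 2 * X ^ 5 ≤ X ^ 6 := two_mul_pow_le hX 5
  have p6 : 2 * X ^ 6 ≤ X ^ 7 := two_mul_pow_le hX 6
  have p7 : 2 * X ^ 7 ≤ X ^ 8 := two_mul_pow_le hX 7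
  have p8 : 2 * X ^ 8 ≤ X ^ 9 := two_mul_pow_le hX 8
  have p9 : 2 * X ^ 9 ≤ X ^ 10 := two_mul_pow_le hX 9
  have p10 : 2 * X ^ 10 ≤ X ^ 11 := two_mul_pow_le hX 10
  have p11 : 2 * X ^ 11 ≤ X ^ 12 := two_mul_pow_le hX 11
  have p12 : 2 * X ^ 12 ≤ X ^ 13 := two_mul_pow_le hX 12
  have p13 : 2 * X ^ 13 ≤ X ^ 14 := two_mul_pow_le hX 13
  have p14 : 2 * X ^ 14 ≤ X ^ 15 := two_mul_pow_le hX 14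
  have p15 : 2 * X ^ 15 ≤ X ^ 16 := two_mul_pow_le hX 15
  have p16 : 2 * X ^ 16 ≤ X ^ 17 := two_mul_pow_le hX 16
  have p17 : 2 * X ^ 17 ≤ X ^ 18 := two_mul_pow_le hX 17
  have p18 : 2 * X ^ 18 ≤ X ^ 19 := two_mul_pow_le hX 18
  have hA : (n + m) * T' ≤ X ^ 10 * (r + 1) := by
    have hT'le : T' ≤ X ^ 8 * (r + 1) := by
      have h1 : r * t ≤ r * X ^ 6 := Nat.mul_le_mul_left _ ht'
      have h2 : r * X ^ 6 ≤ r * X ^ 8 := Nat.mul_le_mul_left _ (by omega)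
      have e : X ^ 8 * (r + 1) = r * X ^ 8 + X ^ 8 := by ring
      omega
    calc (n + m) * T' ≤ X ^ 2 * (X ^ 8 * (r + 1)) := Nat.mul_le_mul (by omega) hT'le
      _ = _ := by ring
  have hB : 1 + 2 * ((n * m + m) * T) + n * (2 * n * (n * 4 + 1) + n * 6 + 5) +
      m * (X * (3 * X ^ 3 + 4) + 1) + 2 * m ≤ X ^ 18 * (r + 1) := by
    have h1 : 2 * ((n * m + m) * T) ≤ 2 * ((X * X + X) * (X ^ 11 * (r + 1))) := by gcongr
    have e1 : 2 * ((X * X + X) * (X ^ 11 * (r + 1))) = 2 * X ^ 13 * (r + 1) +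
        2 * X ^ 12 * (r + 1) := by ring
    have h2 : n * (2 * n * (n * 4 + 1) + n * 6 + 5) ≤ X * (2 * X * (X * 4 + 1) + X * 6 + 5) := by
      gcongr
    have e2 : X * (2 * X * (X * 4 + 1) + X * 6 + 5) = 8 * X ^ 3 + 8 * X ^ 2 + 5 * X := by ring
    have h3 : m * (X * (3 * X ^ 3 + 4) + 1) ≤ X * (X * (3 * X ^ 3 + 4) + 1) := by gcongr
    have e3 : X * (X * (3 * X ^ 3 + 4) + 1) = 3 * X ^ 5 + 4 * X ^ 2 + X := by ring
    have h4 : 1 + (8 * X ^ 3 + 8 * X ^ 2 + 5 * X) + (3 * X ^ 5 + 4 * X ^ 2 + X) + 2 * X ≤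
        X ^ 17 := by
      omega
    have h5 : X ^ 17 * 1 ≤ X ^ 17 * (r + 1) := Nat.mul_le_mul_left _ hpos
    have h6 : (2 * X ^ 13 + 2 * X ^ 12 + X ^ 17) * (r + 1) ≤ X ^ 18 * (r + 1) :=
      Nat.mul_le_mul_right _ (by omega)
    have e6 : (2 * X ^ 13 + 2 * X ^ 12 + X ^ 17) * (r + 1) =
      2 * X ^ 13 * (r + 1) + 2 * X ^ 12 * (r + 1) + X ^ 17 * (r + 1) := by ring
    omega
  have hk : (n + 1) ^ k ≤ (N ^ 2) ^ k := Nat.pow_le_pow_left (by nlinarith) k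
  have hk1 : 1 ≤ (N ^ 2) ^ k := Nat.one_le_pow _ _ (by positivity)
  calc _ ≤ (N ^ 2) ^ k * (X ^ 10 * (r + 1)) + (N ^ 2) ^ k * (X ^ 18 * (r + 1)) := by
        refine Nat.add_le_add (hA.trans ?_) (Nat.mul_le_mul hk hB)
        exact Nat.le_mul_of_pos_left _ hk1
    _ = (N ^ 2) ^ k * ((X ^ 10 + X ^ 18) * (r + 1)) := by ring
    _ ≤ (N ^ 2) ^ k * (X ^ 19 * (r + 1)) := by
        gcongr
        omega
    _ = _ := by ring

/-- With `y = log N + log (2 + 1/δ) ≥ log (n/δ)`, the number of trials is at most `2y + 1`; this is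
bounded by a power of `N` times `log (2 + 1/δ)`, which is at least `1/2`. For `n = 0` the junk value
`log 0 = 0` gives no trials. -/
theorem trials_add_one_le {n N : ℕ} (hN : 2 ≤ N) (hn : n ≤ N) {δ : ℝ} (hδ : 0 < δ) :
    (trials n δ : ℝ) + 1 ≤ (N : ℝ) ^ 4 * Real.log (2 + 1 / δ) := by
  have hN' : (2 : ℝ) ≤ N := by exact_mod_cast hN
  have hδ' : 0 < 1 / δ := by positivity
  set Lg := Real.log (2 + 1 / δ) with hLg
  have hlog2 : 1 / 2 < Real.log 2 := by linarith [Real.log_two_gt_d9]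
  have hL : Real.log 2 ≤ Lg := Real.log_le_log (by norm_num) (by linarith)
  have hlogN : Real.log N ≤ N := (Real.log_le_sub_one_of_pos (by linarith)).trans (by linarith)
  have hlogN0 : 0 ≤ Real.log N := Real.log_nonneg (by linarith)
  have key : (trials n δ : ℝ) ≤ (Real.log N + Lg) / Real.log 2 + 1 := by
    have h0 : 0 ≤ (Real.log N + Lg) / Real.log 2 := by
      have : 0 < Lg := by linarith
      positivity
    rcases Nat.eq_zero_or_pos n with rfl | hn0
    · simp only [trials, Nat.cast_zero, zero_div, Real.logb_zero, Nat.ceil_zero]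
      linarith
    · have hn' : (0 : ℝ) < n := by exact_mod_cast hn0
      have h1 : Real.logb 2 (n / δ) ≤ (Real.log N + Lg) / Real.log 2 := by
        rw [Real.logb]
        gcongr
        rw [hLg, ← Real.log_mul (by linarith) (by linarith)]
        apply Real.log_le_log (by positivity)
        rw [div_eq_mul_one_div]
        gcongr
        linarith
      exact (Nat.ceil_le_floor_add_one _ |> Nat.cast_le.2 |>.trans (by
        push_cast
        linarith [Nat.floor_le h0, Nat.floor_le_floor h1, (Nat.cast_le (α := ℝ)).2
          (Nat.floor_le_floor h1)]))
  have h2 : (Real.log N + Lg) / Real.log 2 ≤ 2 * (Real.log N + Lg) := by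
    rw [div_le_iff₀ (by linarith)]
    nlinarith
  have h3 : (N : ℝ) ^ 4 = N * N * N * N := by ring
  have h4 : 6 + 4 * (N : ℝ) ≤ N ^ 4 := by
    have : (4 : ℝ) ≤ N * N := by nlinarith
    have : (8 : ℝ) ≤ N * N * N := by nlinarith
    nlinarith
  have h5 : (6 + 4 * (N : ℝ)) * Lg ≤ N ^ 4 * Lg := by
    have : 0 ≤ Lg := by linarith
    gcongr
  nlinarith

end

section

/-! ### The moment functional of a distribution -/

variable {n m : ℕ} {F : Measure (EuclideanSpace ℝ (Fin n))}

/-- The linear functional `p ↦ E_F[p(x)]` on polynomials. It is defined by its values at the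
monomials, hence linear also in degrees in which `F` has no moments, where it is not an
expectation. -/
noncomputable def momentFunctional (F : Measure (EuclideanSpace ℝ (Fin n))) :
    MvPolynomial (Fin n) ℝ →ₗ[ℝ] ℝ :=
  (MvPolynomial.basisMonomials (Fin n) ℝ).constr ℝ fun s =>
    ∫ x, MvPolynomial.eval (fun i => x i) (MvPolynomial.monomial s (1 : ℝ)) ∂F

theorem momentFunctional_monomial (s : Fin n →₀ ℕ) :
    momentFunctional F (MvPolynomial.monomial s 1) =
      ∫ x, MvPolynomial.eval (fun i => x i) (MvPolynomial.monomial s (1 : ℝ)) ∂F := by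
  have h := (MvPolynomial.basisMonomials (Fin n) ℝ).constr_basis ℝ (fun s =>
    ∫ x, MvPolynomial.eval (fun i => x i) (MvPolynomial.monomial s (1 : ℝ)) ∂F) s
  rwa [MvPolynomial.coe_basisMonomials] at h

theorem exists_monomial_eq_prod (is : List (Fin n)) : ∃ s : Fin n →₀ ℕ,
    (is.map MvPolynomial.X).prod = MvPolynomial.monomial s (1 : ℝ) := by
  induction is with
  | nil => exact ⟨0, rfl⟩
  | cons i is ih =>
    obtain ⟨s, hs⟩ := ih
    refine ⟨Finsupp.single i 1 + s, ?_⟩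
    rw [List.map_cons, List.prod_cons, hs, MvPolynomial.X, MvPolynomial.monomial_mul, one_mul]

/-- The moment entries are values of the moment functional, whether or not the moments exist. -/
theorem momentEntry_eq (is : List (Fin n)) :
    momentEntry F is = momentFunctional F (is.map MvPolynomial.X).prod := by
  obtain ⟨s, hs⟩ := exists_monomial_eq_prod is
  rw [hs, momentFunctional_monomial, ← hs, momentEntry]
  congr 1
  funext x
  rw [map_list_prod, List.map_map]
  congr 1
  exact List.map_congr_left fun i _ => by simp

theorem integrable_eval_monomial [IsProbabilityMeasure F]
    (hF : MemLp (fun x => x) (m : ENNReal) F) {s : Fin n →₀ ℕ} (hs : (s.sum fun _ e => e) ≤ m) :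
    Integrable (fun x : EuclideanSpace ℝ (Fin n) =>
      MvPolynomial.eval (fun i => x i) (MvPolynomial.monomial s (1 : ℝ))) F := by
  have hd : MemLp (fun x => x) ((s.sum fun _ e => e : ℕ) : ENNReal) F :=
    hF.mono_exponent (by exact_mod_cast hs)
  refine hd.integrable_norm_pow'.mono' ?_ (Filter.Eventually.of_forall fun x => ?_)
  · simp only [MvPolynomial.eval_monomial, one_mul, Finsupp.prod]
    exact Continuous.aestronglyMeasurable (by fun_prop)
  · rw [MvPolynomial.eval_monomial, one_mul, Finsupp.prod, Finsupp.sum, norm_prod,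
      ← Finset.prod_pow_eq_pow_sum]
    refine Finset.prod_le_prod (fun i _ => norm_nonneg _) fun i _ => ?_
    rw [norm_pow]
    exact pow_le_pow_left₀ (norm_nonneg _) (PiLp.norm_apply_le x i) _

theorem momentFunctional_eq_integral [IsProbabilityMeasure F]
    (hF : MemLp (fun x => x) (m : ENNReal) F) {p : MvPolynomial (Fin n) ℝ}
    (hp : p.totalDegree ≤ m) :
    momentFunctional F p = ∫ x, MvPolynomial.eval (fun i => x i) p ∂F := by
  have hsum : p = ∑ s ∈ p.support, p.coeff s • MvPolynomial.monomial s (1 : ℝ) := by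
    conv_lhs => rw [← p.support_sum_monomial_coeff]
    simp [MvPolynomial.smul_monomial]
  conv_rhs => rw [hsum]
  conv_lhs => rw [hsum]
  simp only [map_sum, map_smul, MvPolynomial.smul_eval, momentFunctional_monomial]
  rw [integral_finsetSum]
  · simp only [integral_const_mul, smul_eq_mul]
  · exact fun s hs => (integrable_eval_monomial hF
      ((MvPolynomial.le_totalDegree hs).trans hp)).const_mul _

theorem eval_linForm (v : Vec ℝ n) (x : EuclideanSpace ℝ (Fin n)) :
    MvPolynomial.eval (fun i => x i) (linForm v) = inner ℝ x (WithLp.toLp 2 v) := by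
  rw [linForm_apply, map_sum, PiLp.inner_apply]
  refine Finset.sum_congr rfl fun i _ => ?_
  simp [MvPolynomial.smul_eval]

theorem totalDegree_linForm_le (v : Vec ℝ n) : (linForm v).totalDegree ≤ 1 := by
  rw [linForm_apply]
  refine MvPolynomial.totalDegree_finsetSum_le fun i _ => ?_
  exact (MvPolynomial.totalDegree_smul_le _ _).trans (MvPolynomial.totalDegree_X i).le

theorem momentFunctional_linForm_pow [IsProbabilityMeasure F]
    (hF : MemLp (fun x => x) (m : ENNReal) F) (v : Vec ℝ n) {j : ℕ} (hj : j ≤ m) :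
    momentFunctional F (linForm v ^ j) = ∫ x, inner ℝ x (WithLp.toLp 2 v) ^ j ∂F := by
  rw [momentFunctional_eq_integral hF]
  · simp only [map_pow, eval_linForm]
  · refine (MvPolynomial.totalDegree_pow _ _).trans ?_
    exact (Nat.mul_le_mul_left j (totalDegree_linForm_le v)).trans (by omega)

theorem IsIsotropic.isoMoments [IsProbabilityMeasure F] (h : IsIsotropic F) :
    IsoMoments (momentFunctional F) := by
  have hX : ∀ i, momentFunctional F (MvPolynomial.X i) = 0 := fun i => by
    have := momentEntry_eq (F := F) [i]
    simp only [List.map_cons, List.map_nil, List.prod_cons, List.prod_nil, mul_one] at this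
    rw [← this, momentEntry]
    simpa using h.1 i
  have hXX : ∀ i j, momentFunctional F (MvPolynomial.X i * MvPolynomial.X j) =
      if i = j then 1 else 0 := fun i j => by
    have := momentEntry_eq (F := F) [i, j]
    simp only [List.map_cons, List.map_nil, List.prod_cons, List.prod_nil, mul_one] at this
    rw [← this, momentEntry, ← h.2 i j]
    simp
  refine ⟨?_, fun u => ?_, fun u v => ?_⟩
  · have := momentEntry_eq (F := F) []
    simpa [momentEntry] using this.symm
  · rw [linForm_apply, map_sum]
    exact Finset.sum_eq_zero fun i _ => by rw [map_smul, hX, smul_zero]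
  · rw [linForm_apply, linForm_apply, Finset.sum_mul_sum, map_sum]
    refine Finset.sum_congr rfl fun i _ => ?_
    rw [map_sum, Finset.sum_eq_single i]
    · rw [smul_mul_smul_comm, map_smul, hXX, if_pos rfl, smul_eq_mul, mul_one]
    · intro j _ hj
      rw [smul_mul_smul_comm, map_smul, hXX, if_neg hj.symm, smul_zero]
    · simp

/-! ### Moments of the factored distribution -/

theorem integrable_inner_pow [IsProbabilityMeasure F]
    (hF : MemLp (fun x => x) (m : ENNReal) F) (w : EuclideanSpace ℝ (Fin n)) {j : ℕ}
    (hj : j ≤ m) : Integrable (fun x => inner ℝ x w ^ j) F := by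
  have hd : MemLp (fun x => x) (j : ENNReal) F := hF.mono_exponent (by exact_mod_cast hj)
  refine (hd.integrable_norm_pow'.mul_const (‖w‖ ^ j)).mono'
    (Continuous.aestronglyMeasurable (by fun_prop)) (Filter.Eventually.of_forall fun x => ?_)
  rw [norm_pow, ← mul_pow]
  exact pow_le_pow_left₀ (norm_nonneg _) (norm_inner_le_norm x w) j

theorem integral_inner_pow_marginal (V : Submodule ℝ (EuclideanSpace ℝ (Fin n)))
    (w : EuclideanSpace ℝ (Fin n)) (i : ℕ) :
    ∫ x, inner ℝ x w ^ i ∂marginal F V = ∫ x, inner ℝ x (V.starProjection w) ^ i ∂F := by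
  rw [marginal, integral_map (by fun_prop) (Continuous.aestronglyMeasurable (by fun_prop))]
  simp only [Submodule.inner_starProjection_left_eq_right]

theorem integrable_inner_pow_marginal [IsProbabilityMeasure F]
    (hF : MemLp (fun x => x) (m : ENNReal) F) (V : Submodule ℝ (EuclideanSpace ℝ (Fin n)))
    (w : EuclideanSpace ℝ (Fin n)) {j : ℕ} (hj : j ≤ m) :
    Integrable (fun x => inner ℝ x w ^ j) (marginal F V) := by
  rw [marginal, integrable_map_measure (Continuous.aestronglyMeasurable (by fun_prop))
    (by fun_prop)]
  refine (integrable_inner_pow hF (V.starProjection w) hj).congr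
    (Filter.Eventually.of_forall fun x => ?_)
  simp only [Function.comp, Submodule.inner_starProjection_left_eq_right]

/-- The moment of `F_V F_{V^⊥}` in direction `w`, by the binomial expansion of `xᵀw` into the parts
of `V` and of `V^⊥`. -/
theorem integral_inner_pow_factored [IsProbabilityMeasure F]
    (hF : MemLp (fun x => x) (m : ENNReal) F) (V : Submodule ℝ (EuclideanSpace ℝ (Fin n)))
    (w : EuclideanSpace ℝ (Fin n)) {j : ℕ} (hj : j ≤ m) :
    ∫ x, inner ℝ x w ^ j ∂factored F V = ∑ i ∈ Finset.range (j + 1), (j.choose i : ℝ) *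
      ((∫ x, inner ℝ x (V.starProjection w) ^ i ∂F) *
        ∫ x, inner ℝ x (Vᗮ.starProjection w) ^ (j - i) ∂F) := by
  have hprob : ∀ W : Submodule ℝ (EuclideanSpace ℝ (Fin n)), IsProbabilityMeasure (marginal F W) :=
    fun W => Measure.isProbabilityMeasure_map (by fun_prop)
  have := hprob V
  have := hprob Vᗮ
  rw [factored, integral_map (by fun_prop) (Continuous.aestronglyMeasurable (by fun_prop))]
  simp only [inner_add_left, add_pow]
  rw [integral_finsetSum]
  · refine Finset.sum_congr rfl fun i _ => ?_
    rw [integral_mul_const, integral_prod_mul (fun x => inner ℝ x w ^ i)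
      fun x => inner ℝ x w ^ (j - i), integral_inner_pow_marginal, integral_inner_pow_marginal,
      mul_comm]
  · intro i hi
    rw [Finset.mem_range] at hi
    exact ((integrable_inner_pow_marginal hF V w (by omega)).mul_prod
      (integrable_inner_pow_marginal hF Vᗮ w (by omega))).mul_const _

/-- By homogeneity the comparison on the unit sphere extends to all directions. -/
theorem momentDist_eq_zero_iff {G : Measure (EuclideanSpace ℝ (Fin n))} {j : ℕ} (hj : 1 ≤ j) :
    momentDist j F G = 0 ↔
      ∀ w : EuclideanSpace ℝ (Fin n), ∫ x, inner ℝ x w ^ j ∂F = ∫ x, inner ℝ x w ^ j ∂G := by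
  simp only [momentDist, ENNReal.iSup_eq_zero, enorm_eq_zero, sub_eq_zero]
  refine ⟨fun h w => ?_, fun h w _ => h w⟩
  rcases eq_or_ne w 0 with rfl | hw
  · simp [show j ≠ 0 by omega]
  · have h1 := h (‖w‖⁻¹ • w) (by simp [norm_smul, hw])
    simp only [inner_smul_right, mul_pow, integral_const_mul] at h1
    exact mul_left_cancel₀ (pow_ne_zero _ (inv_ne_zero (norm_ne_zero_iff.2 hw))) h1

/-- A subspace of Euclidean space as a space of coordinate vectors. -/
def coordSubmodule (V : Submodule ℝ (EuclideanSpace ℝ (Fin n))) : Submodule ℝ (Vec ℝ n) :=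
  V.comap (WithLp.linearEquiv 2 ℝ (Fin n → ℝ)).symm.toLinearMap

theorem mem_coordSubmodule {V : Submodule ℝ (EuclideanSpace ℝ (Fin n))} {v : Vec ℝ n} :
    v ∈ coordSubmodule V ↔ WithLp.toLp 2 v ∈ V := Iff.rfl

theorem finrank_coordSubmodule (V : Submodule ℝ (EuclideanSpace ℝ (Fin n))) :
    Module.finrank ℝ (coordSubmodule V) = Module.finrank ℝ V :=
  ((WithLp.linearEquiv 2 ℝ (Fin n → ℝ)).symm.ofSubmodule' V).finrank_eq

/-- The moments of `F` up to order `m` in single directions are those of `F_V F_{V^⊥}` exactly if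
all joint moments of `F` up to order `m` in directions of `V` and of `V^⊥` are products. -/
theorem momentDist_factored_iff [IsProbabilityMeasure F]
    (hF : MemLp (fun x => x) (m : ENNReal) F) (V : Submodule ℝ (EuclideanSpace ℝ (Fin n))) :
    (∀ j, 1 ≤ j → j ≤ m → momentDist j F (factored F V) = 0) ↔
      MomentIndep (momentFunctional F) m (coordSubmodule V) (coordSubmodule Vᗮ) := by
  constructor
  · refine fun h => momentIndep_of_pow fun a ha b hb j hj => ?_
    rcases Nat.eq_zero_or_pos j with rfl | hj0
    · have h1 : momentFunctional F 1 = 1 := by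
        simpa using momentFunctional_linForm_pow hF (0 : Vec ℝ n) (Nat.zero_le m)
      simp [h1]
    · rw [mem_coordSubmodule] at ha hb
      rw [momentFunctional_linForm_pow hF _ hj,
        (momentDist_eq_zero_iff hj0).1 (h j hj0 hj) (WithLp.toLp 2 (a + b)),
        integral_inner_pow_factored hF V _ hj]
      refine Finset.sum_congr rfl fun i hi => ?_
      rw [Finset.mem_range] at hi
      have hpa : V.starProjection (WithLp.toLp 2 (a + b)) = WithLp.toLp 2 a := by
        rw [WithLp.toLp_add, map_add, Submodule.starProjection_eq_self_iff.2 ha,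
          (Submodule.starProjection_apply_eq_zero_iff V).2 hb, add_zero]
      have hpb : Vᗮ.starProjection (WithLp.toLp 2 (a + b)) = WithLp.toLp 2 b := by
        rw [WithLp.toLp_add, map_add, Submodule.starProjection_eq_self_iff.2 hb,
          (Submodule.starProjection_apply_eq_zero_iff Vᗮ).2 (V.le_orthogonal_orthogonal ha),
          zero_add]
      rw [hpa, hpb, momentFunctional_linForm_pow hF a (by omega),
        momentFunctional_linForm_pow hF b (by omega)]
  · intro h j hj0 hj
    refine (momentDist_eq_zero_iff hj0).2 fun w => ?_
    have h1 := h.pow_eq (a := (V.starProjection w).ofLp) (b := (Vᗮ.starProjection w).ofLp)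
      (mem_coordSubmodule.2 (Submodule.starProjection_apply_mem V w))
      (mem_coordSubmodule.2 (Submodule.starProjection_apply_mem Vᗮ w)) hj
    rw [momentFunctional_linForm_pow hF _ hj, ← WithLp.ofLp_add,
      Submodule.starProjection_add_starProjection_orthogonal] at h1
    rw [integral_inner_pow_factored hF V w hj]
    refine h1.trans (Finset.sum_congr rfl fun i hi => ?_)
    rw [Finset.mem_range] at hi
    rw [momentFunctional_linForm_pow hF _ (show i ≤ m by omega),
      momentFunctional_linForm_pow hF _ (show j - i ≤ m by omega)]

theorem inner_toLp (u v : Vec ℝ n) :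
    inner ℝ (WithLp.toLp 2 u) (WithLp.toLp 2 v) = u ⬝ᵥ v := by
  rw [EuclideanSpace.inner_toLp_toLp, star_trivial, dotProduct_comm]

theorem factors_of_momentDist [IsProbabilityMeasure F]
    (hF : MemLp (fun x => x) (m : ENNReal) F) {V : Submodule ℝ (EuclideanSpace ℝ (Fin n))}
    (h : ∀ j, 1 ≤ j → j ≤ m → momentDist j F (factored F V) = 0) :
    Factors (momentFunctional F) m (coordSubmodule V) (coordSubmodule Vᗮ) where
  indep := (momentDist_factored_iff hF V).1 h
  orth p hp q hq := by
    rw [← inner_toLp]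
    exact Submodule.inner_right_of_mem_orthogonal hp hq
  decomp u := ⟨(V.starProjection (WithLp.toLp 2 u)).ofLp,
    mem_coordSubmodule.2 (Submodule.starProjection_apply_mem V _),
    (Vᗮ.starProjection (WithLp.toLp 2 u)).ofLp,
    mem_coordSubmodule.2 (Submodule.starProjection_apply_mem Vᗮ _), by
      rw [← WithLp.ofLp_add, Submodule.starProjection_add_starProjection_orthogonal]⟩

/-! ### The subspace of a perfect candidate -/

theorem coordSubmodule_spanOf (L : List (Vec ℝ n)) :
    coordSubmodule (spanOf L) = Submodule.span ℝ {v | v ∈ L} := by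
  let e := WithLp.linearEquiv 2 ℝ (Fin n → ℝ)
  have h1 : spanOf L = (Submodule.span ℝ {v : Vec ℝ n | v ∈ L}).map e.symm.toLinearMap := by
    rw [spanOf, Submodule.map_span]
    congr 1
    ext x
    constructor
    · rintro ⟨v, hv, rfl⟩
      exact ⟨v, hv, rfl⟩
    · rintro ⟨v, hv, rfl⟩
      exact ⟨v, hv, rfl⟩
  rw [h1]
  exact Submodule.comap_map_eq_of_injective e.symm.injective _

theorem OrthoList.finrank_spanOf {L : List (Vec ℝ n)} (hL : OrthoList L) :
    Module.finrank ℝ (spanOf L) = L.length := by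
  rw [← finrank_coordSubmodule, coordSubmodule_spanOf]
  refine le_antisymm ?_ (hL.length_le _ fun v hv => Submodule.subset_span hv)
  have hset : {v | v ∈ L} = Set.range L.get := by
    ext v
    exact List.mem_iff_get
  rw [hset]
  exact (finrank_range_le_card _).trans_eq (Fintype.card_fin _)

/-- If `U` and `W` together are an orthonormal basis, the orthogonal complement of the span of `U`
is the span of `W`. -/
theorem coordSubmodule_spanOf_orthogonal {U W : List (Vec ℝ n)} (hUW : OrthoList (U ++ W))
    (hlen : (U ++ W).length = n) :
    coordSubmodule (spanOf U)ᗮ = Submodule.span ℝ {v | v ∈ W} := by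
  obtain ⟨hU, hW, horth⟩ := orthoList_append.1 hUW
  rw [← coordSubmodule_spanOf]
  symm
  apply Submodule.eq_of_le_of_finrank_eq
  · rw [coordSubmodule_spanOf, Submodule.span_le]
    intro w hw
    refine (Submodule.mem_orthogonal _ _).2 fun x hx => ?_
    refine Submodule.span_induction (p := fun x _ => inner ℝ x (WithLp.toLp 2 w) = 0)
      ?_ ?_ ?_ ?_ hx
    · rintro _ ⟨v, hv, rfl⟩
      rw [inner_toLp, horth v hv w hw]
    · exact inner_zero_left _
    · intro x y _ _ hx hy
      rw [inner_add_left, hx, hy, add_zero]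
    · intro a x _ hx
      rw [inner_smul_left, hx, mul_zero]
  · have h := (spanOf U).finrank_add_finrank_orthogonal
    rw [hU.finrank_spanOf, finrank_euclideanSpace_fin] at h
    rw [finrank_coordSubmodule, finrank_coordSubmodule, hW.finrank_spanOf]
    rw [List.length_append] at hlen
    omega

theorem IsPerfect.momentDist_eq_zero [IsProbabilityMeasure F]
    (hF : MemLp (fun x => x) (m : ENNReal) F) (hiso : IsIsotropic F) {k : ℕ}
    {b : List (Vec ℝ n) × List ℝ} (hb : IsPerfect (momentFunctional F) m k b) :
    Module.finrank ℝ (spanOf b.1) = k ∧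
      ∀ j, 1 ≤ j → j ≤ m → momentDist j F (factored F (spanOf b.1)) = 0 := by
  obtain ⟨⟨W, hUW, hlen, hk, hgaps⟩, hzero⟩ := hb
  obtain ⟨hU, -, horth⟩ := orthoList_append.1 hUW
  refine ⟨hU.finrank_spanOf.trans hk, (momentDist_factored_iff hF _).2 ?_⟩
  have hind : MomentIndep (momentFunctional F) m {u | u ∈ b.1} {v | v ∈ W} := by
    refine momentIndep_of_gapValue hiso.isoMoments horth fun l hl hlm => hzero _ ?_
    rw [hgaps]
    exact List.mem_map.2 ⟨l, by rw [List.mem_range'_1]; omega, rfl⟩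
  rw [coordSubmodule_spanOf, coordSubmodule_spanOf_orthogonal hUW hlen]
  exact hind.span

end

section

/-! ### The success probability -/

/-- The total risk with the prescribed number of trials. -/
theorem mul_inv_two_pow_trials_le (n : ℕ) {δ : ℝ} (hδ : 0 < δ) :
    (n : ENNReal) * 2⁻¹ ^ trials n δ ≤ ENNReal.ofReal δ := by
  rcases Nat.eq_zero_or_pos n with rfl | hn
  · simp
  have hn' : (0 : ℝ) < n := by exact_mod_cast hn
  have h1 : (n : ℝ) / δ ≤ 2 ^ trials n δ := by
    have h2 : Real.logb 2 (n / δ) ≤ trials n δ := Nat.le_ceil _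
    rw [Real.logb_le_iff_le_rpow (by norm_num) (by positivity), Real.rpow_natCast] at h2
    exact h2
  have h3 : (n : ℝ) * 2⁻¹ ^ trials n δ ≤ δ := by
    rw [div_le_iff₀ hδ] at h1
    rw [inv_pow, ← div_eq_mul_inv, div_le_iff₀ (by positivity)]
    linarith
  refine le_trans (le_of_eq ?_) (ENNReal.ofReal_le_ofReal h3)
  rw [ENNReal.ofReal_mul (by positivity), ENNReal.ofReal_natCast,
    ENNReal.ofReal_pow (by positivity),
    ENNReal.ofReal_inv_of_pos (by norm_num), ENNReal.ofReal_ofNat]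

end

end GenICA

theorem mainTheorem3 :
    ∃ C : ℕ, ∀ (n k m : ℕ), 1 ≤ m →
      ∀ (F : Measure (EuclideanSpace ℝ (Fin n))), IsProbabilityMeasure F →
      MemLp (fun x => x) (m : ENNReal) F →
      GenICA.IsIsotropic F →
      (∃ V : Submodule ℝ (EuclideanSpace ℝ (Fin n)), Module.finrank ℝ V = k ∧
        ∀ j, 1 ≤ j → j ≤ m → GenICA.momentDist j F (GenICA.factored F V) = 0) →
      ∀ (O : GenICA.LocalOptOracle n), O.IsExact →
      ∀ δ : ℝ, 0 < δ →
        ENNReal.ofReal (1 - δ) ≤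
          ((GenICA.factor m k (GenICA.trials n δ)).run (GenICA.momentEntry F) O).toOuterMeasure
            {p | ∃ L, p.1 = some L ∧ Module.finrank ℝ (GenICA.spanOf L) = k ∧
              ∀ j, 1 ≤ j → j ≤ m →
                GenICA.momentDist j F (GenICA.factored F (GenICA.spanOf L)) = 0} ∧
        ∀ p ∈ ((GenICA.factor m k (GenICA.trials n δ)).run (GenICA.momentEntry F) O).support,
          (p.2 : ℝ) ≤ (max 2 n : ℝ) ^ (C * (k + m)) * Real.log (2 + 1 / δ) := by
  classical
  open GenICA in
  refine ⟨23, fun n k m hm F hprob hF hiso ⟨V, hV, hdist⟩ O hO δ hδ => ⟨?_, fun p hp => ?_⟩⟩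
  · rcases le_total 1 δ with h1 | h1
    -- the bound is trivial for `δ ≥ 1`, where the total risk may exceed `1`
    · rw [ENNReal.ofReal_of_nonpos (by linarith)]
      exact zero_le
    have hε := mul_inv_two_pow_trials_le n hδ
    have hfail := Prog.expect_factor_le hO momentEntry_eq (factors_of_momentDist hF hdist)
      hiso.isoMoments (hε.trans (ENNReal.ofReal_le_one.2 h1))
      (hV.symm.trans (finrank_coordSubmodule V).symm) hm
    let S : Set (Option (List (Vec ℝ n))) := {o | ∃ L, o = some L ∧
      Module.finrank ℝ (spanOf L) = k ∧
        ∀ j, 1 ≤ j → j ≤ m → momentDist j F (factored F (spanOf L)) = 0}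
    have hset := Prog.toOuterMeasure_run (M := momentEntry F) (O := O) (factor m k (trials n δ)) S
    -- a perfect candidate has a good span, so the indicators of success and of failure add up to at
    -- least `1`
    rw [ENNReal.ofReal_sub _ hδ.le, ENNReal.ofReal_one]
    refine (tsub_le_iff_right.2 ?_).trans hset.ge
    refine le_trans ?_ (add_le_add le_rfl (hfail.trans hε))
    rw [← Prog.expect_add]
    refine (Prog.expect_const (M := momentEntry F) (O := O) (factor m k (trials n δ)) 1).ge.trans
      (Prog.expect_mono _ fun o => ?_)
    by_cases hb : ∃ b, o = some b.1 ∧ IsPerfect (momentFunctional F) m k b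
    · obtain ⟨b, rfl, hb'⟩ := hb
      have hgood := hb'.momentDist_eq_zero hF hiso
      rw [if_pos (show _ ∈ S from ⟨b.1, rfl, hgood⟩)]
      exact le_self_add
    · rw [if_neg hb]
      exact le_add_self
  · have hkn : k ≤ n := by
      rw [← hV]
      exact (Submodule.finrank_le V).trans_eq finrank_euclideanSpace_fin
    have hcost := (Prog.ensures_factor (m := m) (r := trials n δ) hO momentEntry_eq
      ⟨le_max_left 2 n, le_max_right 2 n, hm, le_rfl, le_rfl⟩ hkn le_rfl p hp).1.trans
      (total_cost_le (le_max_left 2 n) (le_max_right 2 n) hm rfl rfl rfl)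
    have hlog : 0 ≤ Real.log (2 + 1 / δ) :=
      Real.log_nonneg (by have : 0 < 1 / δ := by positivity
                          linarith)
    have hN : (max 2 n : ℝ) = ((max 2 n : ℕ) : ℝ) := by push_cast; rfl
    rw [hN]
    have hN1 : (1 : ℝ) ≤ ((max 2 n : ℕ) : ℝ) := by
      exact_mod_cast (by omega : 1 ≤ max 2 n)
    have htr := trials_add_one_le (le_max_left 2 n) (le_max_right 2 n) hδ
    calc (p.2 : ℝ) ≤ ((max 2 n : ℕ) : ℝ) ^ (2 * k + 19 * m) * ((trials n δ : ℝ) + 1) := by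
          exact_mod_cast hcost
      _ ≤ ((max 2 n : ℕ) : ℝ) ^ (2 * k + 19 * m) *
            (((max 2 n : ℕ) : ℝ) ^ 4 * Real.log (2 + 1 / δ)) := by gcongr
      _ = ((max 2 n : ℕ) : ℝ) ^ (2 * k + 19 * m + 4) * Real.log (2 + 1 / δ) := by ring
      _ ≤ ((max 2 n : ℕ) : ℝ) ^ (23 * (k + m)) * Real.log (2 + 1 / δ) := by
          gcongr
          omega
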